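/- Let $\mathbf T=\mathbf R/2\pi\mathbf Z$ carry the measure $d\theta/2\pi$, and for $u\in L^2(\mathbf T;\mathbf C)$ let $\hat u(k)=\int_{\mathbf T}u(\theta)e^{-ik\theta}\,d\theta/2\pi$. For $N>0$ let $$\Omega_N=\Bigl\{u\in L^2(\mathbf T;\mathbf C):\int_{\mathbf T}|u|^2\,\frac{d\theta}{2\pi}\le N\Bigr\}.$$ For $s\in\mathbf R$ put $\Vert u\Vert_{H^s}^2=|\hat u(0)|^2+\sum_{k\ne0}|k|^{2s}|\hat u(k)|^2\in[0,\infty]$. Let $\mu$ be the law on $L^2(\mathbf T;\mathbf C)$ of Brownian loop $\sum_{j\neq 0}e^{ij\theta}(\gamma_j+i\gamma_j')/j$, where $\gamma_j,\gamma'_j$ are mutually independent standard Gaussian random variables. Let $\lambda\in\mathbf R$ and let $$\nu(du)=Z(N,\lambda)^{-1}\,\mathbf I_{\Omega_N}(u)\exp\Bigl(\frac{\lambda}{4}\int_{\mathbf T}|u(\theta)|^4\frac{d\theta}{2\pi}\Bigr)\mu(du),$$ where $Z(N,\lambda)$ is the total mass of the unnormalized measure, be the Gibbs measure of the focussing cubic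 nonlinear Schrödinger equation. Suppose that $N>0$ and $0\le\lambda N<3/(14\pi^2)$, and let $\alpha=1-14\pi^2N\lambda/3$. Then $\nu$ is a probability measure ($0<Z(N,\lambda)<\infty$) and satisfies the logarithmic Sobolev inequality $$\int_{\Omega_N}F^2\log\Bigl(F^2\Big/\int F^2\,d\nu\Bigr)\,d\nu\le\frac{2}{\alpha}\int_{\Omega_N}\Vert\nabla F\Vert_{H^{-1}}^2\,d\nu ,$$ where the integral on the left converges, in each of the following two cases. (i) $F:\Omega_N\to\mathbf R$ is continuously differentiable, with $F$ and $\Vert\nabla F\Vert_{H^{-1}}$ in $L^2(\nu)$; here $\nabla F(u)\in L^2(\mathbf T;\mathbf C)$ is the gradient for the real inner product $\Re\int u\bar v\,d\theta/2\pi$. (ii) $F:\Omega_N\to\mathbf R$ is locally Lipschitz for the $L^2$ norm, with $F$ and $\Vert\nabla F\Vert_{H^{-1}}$ in $L^2(\nu)$; here $\Vert\nabla F\Vert_{H^{-1}}$ is interpreted as the metric norm of the gradient for the $H^1$ distance, $$\limsup_{v\in\Omega_N,\ v\ne u,\ \Vert v-u\Vert_{H^1}\to0}\ \frac{|F(v)-F(u)|}{\Vert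 v-u\Vert_{H^1}} .$$ -/

import Mathlib

open MeasureTheory ProbabilityTheory Filter Topology
open scoped ENNReal

noncomputable section

namespace NLSGibbs

instance fact_two_pi_pos : Fact (0 < 2 * Real.pi) := ⟨Real.two_pi_pos⟩

/-- The circle `𝕋 = ℝ / 2πℤ`. -/
abbrev Circ : Type := AddCircle (2 * Real.pi)

/-- Normalized arc length `dθ / 2π` on the circle. -/
abbrev arc : Measure Circ := AddCircle.haarAddCircle

/-- The complex Hilbert space `L²(𝕋; ℂ)` for `dθ / 2π`. It is also a real Hilbert space for
`Re ∫ u \bar v dθ / 2π`; derivatives and gradients below are the real ones. -/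
abbrev LTwo : Type := Lp ℂ 2 arc

instance : MeasurableSpace LTwo := borel LTwo

instance : BorelSpace LTwo := ⟨rfl⟩

/-- The ball `Ω_N = {u ∈ L² : ∫ |u|² dθ/2π ≤ N}`. -/
def Ball (N : ℝ) : Set LTwo := {u | ∫ θ, ‖u θ‖ ^ 2 ∂arc ≤ N}

/-! ### Brownian loop and the Gibbs measure -/

/-- The law of mutually independent standard Gaussian variables `(γ_j, γ'_j)`, `j ∈ ℤ`. -/
def gaussianLaw : Measure (ℤ → ℝ × ℝ) :=
  Measure.infinitePi fun _ : ℤ => (gaussianReal 0 1).prod (gaussianReal 0 1)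

/-- The Fourier coefficient `(γ_j + i γ'_j) / j` for `j ≠ 0`, and `0` for `j = 0`. -/
def loopCoeff (γ : ℤ → ℝ × ℝ) (j : ℤ) : ℂ :=
  if j = 0 then 0 else (((γ j).1 : ℂ) + Complex.I * ((γ j).2 : ℂ)) / (j : ℂ)

/-- Brownian loop `∑_{j ≠ 0} e^{ijθ} (γ_j + i γ'_j) / j`, as an element of `L²`. The series converges
in `L²` exactly when the coefficients are square summable, which is almost surely the case. -/
def brownianLoop (γ : ℤ → ℝ × ℝ) : LTwo :=
  ∑' j : ℤ, loopCoeff γ j • (fourierLp 2 j : LTwo)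

lemma continuous_loopCoeff (j : ℤ) : Continuous fun γ : ℤ → ℝ × ℝ => loopCoeff γ j := by
  unfold loopCoeff
  split_ifs
  · exact continuous_const
  · fun_prop

lemma summable_loop_iff (γ : ℤ → ℝ × ℝ) :
    (Summable fun j : ℤ => loopCoeff γ j • (fourierLp 2 j : LTwo)) ↔
      Summable fun j : ℤ => ‖loopCoeff γ j‖ ^ 2 := by
  have h := (orthonormal_fourier (T := 2 * Real.pi)).orthogonalFamily.summable_iff_norm_sq_summable
    (fun j => loopCoeff γ j)
  simpa [LinearIsometry.toSpanSingleton_apply] using h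

lemma measurable_brownianLoop : Measurable brownianLoop := by
  classical
  set S : Set (ℤ → ℝ × ℝ) := {γ | Summable fun j : ℤ => ‖loopCoeff γ j‖ ^ 2} with hS
  have hSm : MeasurableSet S := by
    have : S = {γ | ∑' j : ℤ, (‖loopCoeff γ j‖ₑ ^ 2 : ℝ≥0∞) ≠ ∞} := by
      ext γ
      have h0 : ∀ j : ℤ, (‖loopCoeff γ j‖ₑ ^ 2 : ℝ≥0∞) = ((‖loopCoeff γ j‖₊ ^ 2 : NNReal) : ℝ≥0∞) :=
        fun j => by simp [enorm_eq_nnnorm]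
      simp only [hS, Set.mem_ofPred_eq, h0, ENNReal.tsum_coe_ne_top_iff_summable]
      rw [← NNReal.summable_coe]
      simp
    rw [this]
    refine (measurableSet_singleton (∞ : ℝ≥0∞)).compl.preimage ?_
    exact Measurable.tsum fun j => (continuous_loopCoeff j).measurable.enorm.pow_const 2
  have hlim : ∀ γ, Tendsto (fun n : ℕ => S.indicator
      (fun γ => ∑ j ∈ Finset.Icc (-(n : ℤ)) n, loopCoeff γ j • (fourierLp 2 j : LTwo)) γ) atTop
      (𝓝 (brownianLoop γ)) := by
    intro γ
    by_cases hγ : γ ∈ S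
    · have hs := ((summable_loop_iff γ).2 hγ).hasSum
      simp only [Set.indicator_of_mem hγ]
      exact hs.comp Finset.tendsto_Icc_neg
    · have h0 : brownianLoop γ = 0 :=
        tsum_eq_zero_of_not_summable fun h => hγ ((summable_loop_iff γ).1 h)
      simp only [Set.indicator_of_notMem hγ, h0]
      exact tendsto_const_nhds
  refine measurable_of_tendsto_metrizable (fun n => ?_) (tendsto_pi_nhds.2 hlim)
  refine Measurable.indicator ?_ hSm
  exact (continuous_finsetSum _ fun j _ =>
    (continuous_loopCoeff j).smul continuous_const).measurable

/-- The measure induced on `L²` by Brownian loop: under it the Fourier coefficients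
`a_j + i b_j`, `j ≠ 0`, have independent parts with density `∝ exp(-j² a² / 2)`, and
`a_0 + i b_0 = 0`. -/
def loopMeasure : Measure LTwo := gaussianLaw.map brownianLoop

/-- The weight `exp((λ/4) ∫ |u|⁴ dθ/2π)`; `u ∈ L⁴` for almost every `u` for `loopMeasure`. -/
def weight (lam : ℝ) (u : LTwo) : ℝ≥0∞ :=
  ENNReal.ofReal (Real.exp (lam / 4 * ∫ θ, ‖u θ‖ ^ 4 ∂arc))

/-- The normalizing constant `Z(N, λ)`. -/
def partitionFunction (N lam : ℝ) : ℝ≥0∞ := ∫⁻ u in Ball N, weight lam u ∂loopMeasure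

/-- The Gibbs measure `Z(N, λ)⁻¹ 1_{Ω_N}(u) exp((λ/4) ∫ |u|⁴) loopMeasure(du)` of the cubic
focussing NLS. -/
def gibbs (N lam : ℝ) : Measure LTwo :=
  (partitionFunction N lam)⁻¹ • (loopMeasure.restrict (Ball N)).withDensity (weight lam)

/-! ### Sobolev norms and gradients -/

/-- The norm of `H^s(𝕋; ℂ)`, with square `|a_0|² + ∑_{k ≠ 0} |k|^{2s} |a_k|²` where `a_k` are the
Fourier coefficients of `u`; it is `∞` when `u ∉ H^s`. -/
def sobolevENorm (s : ℝ) (u : LTwo) : ℝ≥0∞ :=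
  (∑' k : ℤ, ENNReal.ofReal (if k = 0 then 1 else |(k : ℝ)| ^ (2 * s)) *
    ‖fourierCoeff u k‖ₑ ^ 2) ^ (1 / 2 : ℝ)

/-- The metric norm of the gradient of `F : Ω_N → ℝ` for the `H¹` distance,
`limsup |F(v) - F(u)| / ‖v - u‖_{H¹}` as `v → u` in `H¹`, `v ∈ Ω_N`, `v ≠ u`.
(The quotient is `0` when `v - u ∉ H¹`.) -/
def slope (N : ℝ) (F : LTwo → ℝ) (u : LTwo) : ℝ≥0∞ :=
  limsup (fun v => ‖F v - F u‖ₑ / sobolevENorm 1 (v - u))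
    (comap (fun v => sobolevENorm 1 (v - u)) (𝓝 0) ⊓ 𝓟 (Ball N \ {u}))

/-- The logarithmic Sobolev inequality with constant `α` for the function `F`, where `G u` is the
norm of the gradient of `F` at `u`; it includes that the entropy integral converges. -/
def LogSobolev (ν : Measure LTwo) (α : ℝ) (F G : LTwo → ℝ) : Prop :=
  Integrable (fun u => F u ^ 2 * Real.log (F u ^ 2 / ∫ v, F v ^ 2 ∂ν)) ν ∧
    ∫ u, F u ^ 2 * Real.log (F u ^ 2 / ∫ v, F v ^ 2 ∂ν) ∂ν ≤ 2 / α * ∫ u, G u ^ 2 ∂ν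

end NLSGibbs

end

open MeasureTheory ProbabilityTheory Filter Topology
open scoped ENNReal

noncomputable section

namespace NLSGibbs

section Line

open scoped Pointwise

/-! ### The Prékopa–Leindler inequality on the line -/

/-! A Prékopa–Leindler inequality with a quadratic cost implies a logarithmic Sobolev inequality
(the Bobkov–Ledoux argument), and the Gibbs measure satisfies such an inequality.

For the standard Gaussian, `t x² + s y² = (t x + s y)² + t s (x - y)²`, so the inequality on the
line gains the factor `exp (-t s (x - y)² / 2)`. The cost adds up over coordinates and survives the
passage to the infinite product of the Gaussian coefficients. Pushed forward to `L²` this is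
`prekopaLeindler_loopMeasure`: the two points differ by `cmEmbed c`, a mean zero function in `H¹`,
at cost `‖c‖²`.

The Gibbs weight is not log-concave, but its defect is quadratic in the displacement. By
`norm_pow_four_convexity_defect`, the mass bound `N` and the supremum bound `|cmEmbed c| ≤ 2 ‖c‖`,
the defect of `(λ/4) ∫ |u|⁴` is at most `12 λ N · (t s / 2) ‖c‖²`. Hence the cost survives with any
factor `α ≤ 1 - 12 λ N`, and `12 < 14 π² / 3` leaves room to spare. Comparing the weight with a set
on which the quartic is bounded gives `Z < ∞` in the same way.

`gibbs_prekopaLeindler` then bounds `(∫ exp (g / t)) ^ t` by the integral of the exponential of a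
sup-convolution of `g` with cost `(α t / s) ‖c‖² / 2`. At first order as `s → 0`, the left side
produces the entropy of `exp g` and the right side `∫ exp g |∇g|² / (2 α)`, where only the slope
along `H¹` directions enters. This is `entropy_exp_le`; with `g = log (f² + e²)` the constant
becomes `2 / α`.

That step needs `g` bounded and globally Lipschitz along `H¹` directions. A locally Lipschitz `F` is
brought there by a cutoff in the `H^{1/4}` norm: this norm is almost surely finite, its balls are
relatively compact in `L²`, and the cutoff at radius `R` changes the slope by at most `|F| / R`.
Fatou's lemma removes the cutoff in `logSobolev_of_slope`. The two cases of the theorem differ only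
in how the slope is bounded: by duality of `H⁻¹` and `H¹`, or from the definition of the metric
slope. -/

lemma volume_add_volume_le_of_isCompact {K L : Set ℝ} (hK : IsCompact K) (hL : IsCompact L)
    (hK' : K.Nonempty) (hL' : L.Nonempty) : volume K + volume L ≤ volume (K + L) := by
  obtain ⟨a, ha, hamax⟩ := hK.exists_isGreatest hK'
  obtain ⟨b, hb, hbmin⟩ := hL.exists_isLeast hL'
  have h1 : volume ((fun x => x + b) '' K) = volume K := by simp
  have h2 : volume ((fun x => a + x) '' L) = volume L := by simp
  have hm : MeasurableSet ((fun x => a + x) '' L) := (hL.image (by fun_prop)).measurableSet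
  -- Since `a` is the top of `K` and `b` the bottom of `L`, the translates `K + b` and `a + L`, both
  -- inside `K + L`, share only the point `a + b`.
  have hd : volume (((fun x => x + b) '' K) ∩ ((fun x => a + x) '' L)) = 0 := by
    refine measure_mono_null (t := {a + b}) ?_ (by simp)
    rintro x ⟨⟨k, hk, rfl⟩, l, hl, h⟩
    have := hamax hk
    have := hbmin hl
    simp only [Set.mem_singleton_iff] at *
    linarith
  rw [← h1, ← h2, ← measure_union₀ hm.nullMeasurableSet hd]
  refine measure_mono (Set.union_subset ?_ ?_)
  · rintro x ⟨k, hk, rfl⟩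
    exact Set.add_mem_add hk hb
  · rintro x ⟨l, hl, rfl⟩
    exact Set.add_mem_add ha hl

/-- Inner regularity reduces to compact sets, so `C` need not be measurable. The points `a` and `b`
are inserted to keep the approximating compact sets nonempty. -/
lemma volume_combo_le {t s : ℝ} (ht : 0 < t) (hs : 0 < s) {A B C : Set ℝ}
    (hA : MeasurableSet A) (hB : MeasurableSet B) (hA' : A.Nonempty) (hB' : B.Nonempty)
    (h : ∀ x ∈ A, ∀ y ∈ B, t * x + s * y ∈ C) :
    ENNReal.ofReal t * volume A + ENNReal.ofReal s * volume B ≤ volume C := by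
  obtain ⟨a, ha⟩ := hA'
  obtain ⟨b, hb⟩ := hB'
  rw [hA.measure_eq_iSup_isCompact, hB.measure_eq_iSup_isCompact]
  simp only [ENNReal.mul_iSup, iSup_and']
  refine ENNReal.biSup_add_biSup_le' ⟨∅, Set.empty_subset _, isCompact_empty⟩
    ⟨∅, Set.empty_subset _, isCompact_empty⟩ fun K hK' L hL' => ?_
  obtain ⟨hKA, hK⟩ := hK'
  obtain ⟨hLB, hL⟩ := hL'
  have hK1 : IsCompact (t • insert a K) := (hK.insert a).smul t
  have hL1 : IsCompact (s • insert b L) := (hL.insert b).smul s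
  have key := volume_add_volume_le_of_isCompact hK1 hL1 (Set.insert_nonempty _ _).smul_set
    (Set.insert_nonempty _ _).smul_set
  rw [Measure.addHaar_smul, Measure.addHaar_smul] at key
  simp only [Module.finrank_self, pow_one, abs_of_pos ht, abs_of_pos hs] at key
  calc ENNReal.ofReal t * volume K + ENNReal.ofReal s * volume L
      ≤ ENNReal.ofReal t * volume (insert a K) + ENNReal.ofReal s * volume (insert b L) := by
        gcongr <;> exact Set.subset_insert _ _
    _ ≤ _ := key
    _ ≤ volume C := by
        refine measure_mono ?_
        rintro _ ⟨_, ⟨x, hx, rfl⟩, _, ⟨y, hy, rfl⟩, rfl⟩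
        refine h x ?_ y ?_
        · rcases hx with rfl | hx
          exacts [ha, hKA hx]
        · rcases hy with rfl | hy
          exacts [hb, hLB hy]

lemma rpow_mul_rpow_le_add {t s : ℝ} (ht : 0 < t) (hs : 0 < s) (hts : t + s = 1)
    (a b : ℝ≥0∞) : a ^ t * b ^ s ≤ ENNReal.ofReal t * a + ENNReal.ofReal s * b := by
  have hpq : (t⁻¹).HolderConjugate s⁻¹ := by
    rw [Real.holderConjugate_iff]
    refine ⟨(one_lt_inv₀ ht).2 (by linarith), by simpa using hts⟩
  have h := ENNReal.young_inequality (a ^ t) (b ^ s) hpq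
  rw [← ENNReal.rpow_mul, ← ENNReal.rpow_mul, mul_inv_cancel₀ ht.ne', mul_inv_cancel₀ hs.ne',
    ENNReal.rpow_one, ENNReal.rpow_one, ENNReal.ofReal_inv_of_pos ht, ENNReal.ofReal_inv_of_pos hs,
    div_eq_mul_inv, div_eq_mul_inv, inv_inv, inv_inv, mul_comm a, mul_comm b] at h
  exact h

lemma rpow_mul_rpow_self {t s : ℝ} (ht : 0 < t) (hs : 0 < s) (hts : t + s = 1)
    (a : ℝ≥0∞) : a ^ t * a ^ s = a := by
  rw [← ENNReal.rpow_add_of_nonneg _ _ ht.le hs.le, hts, ENNReal.rpow_one]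

lemma lintegral_eq_lintegral_unitInterval {u : ℝ → ℝ≥0∞} (hu : Measurable u) (hu1 : ∀ x, u x ≤ 1) :
    ∫⁻ x, u x = ∫⁻ l in Set.Ioo (0 : ℝ) 1, volume {x | ENNReal.ofReal l < u x} := by
  have h0 : ∀ x, u x = ENNReal.ofReal (u x).toReal := fun x =>
    (ENNReal.ofReal_toReal (ne_top_of_le_ne_top ENNReal.one_ne_top (hu1 x))).symm
  have h := lintegral_eq_lintegral_meas_lt (volume : Measure ℝ) (f := fun x => (u x).toReal)
    (Eventually.of_forall fun x => ENNReal.toReal_nonneg) hu.ennreal_toReal.aemeasurable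
  have h1 : ∫⁻ x, u x = ∫⁻ x, ENNReal.ofReal (u x).toReal := lintegral_congr h0
  rw [h1, h, ← Set.Ioo_union_Ici_eq_Ioi (zero_lt_one' ℝ),
    lintegral_union measurableSet_Ici
      (Set.disjoint_left.2 fun x hx hx' => absurd hx.2 (not_lt.2 hx'))]
  have h2 : ∫⁻ l in Set.Ici (1 : ℝ), volume {x | l < (u x).toReal} = 0 := by
    rw [setLIntegral_congr_fun (g := fun _ => 0) measurableSet_Ici]
    · simp
    · intro l hl
      have : {x | l < (u x).toReal} = ∅ := by
        ext x
        simp only [Set.mem_ofPred_eq, Set.mem_empty_iff_false, iff_false, not_lt]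
        exact (ENNReal.toReal_le_of_le_ofReal zero_le_one (by simpa using hu1 x)).trans hl
      simp [this]
  rw [h2, add_zero]
  refine setLIntegral_congr_fun measurableSet_Ioo fun l hl => ?_
  congr 1
  ext x
  simp only [Set.mem_ofPred_eq]
  rw [ENNReal.ofReal_lt_iff_lt_toReal hl.1.le (ne_top_of_le_ne_top ENNReal.one_ne_top (hu1 x))]

/-- Equal suprema make the superlevel sets of `u` and `v` nonempty for the same levels `l < 1`, so
the set inequality applies at every level and is integrated in `l`. This gives an arithmetic mean on
the left, which is stronger than the geometric one. -/
lemma prekopa_leindler_of_iSup_eq_one {t s : ℝ} (ht : 0 < t) (hs : 0 < s) (hts : t + s = 1)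
    {u v w : ℝ → ℝ≥0∞} (hu : Measurable u) (hv : Measurable v) (hw : Measurable w)
    (hu1 : ⨆ x, u x = 1) (hv1 : ⨆ x, v x = 1)
    (h : ∀ x y, u x ^ t * v y ^ s ≤ w (t * x + s * y)) :
    ENNReal.ofReal t * (∫⁻ x, u x) + ENNReal.ofReal s * (∫⁻ x, v x) ≤ ∫⁻ x, w x := by
  have hule : ∀ x, u x ≤ 1 := fun x => hu1 ▸ le_iSup u x
  have hvle : ∀ x, v x ≤ 1 := fun x => hv1 ▸ le_iSup v x
  have hw' : ∫⁻ x, min (w x) 1 ≤ ∫⁻ x, w x := lintegral_mono fun x => min_le_left _ _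
  refine le_trans ?_ hw'
  rw [lintegral_eq_lintegral_unitInterval hu hule, lintegral_eq_lintegral_unitInterval hv hvle,
    lintegral_eq_lintegral_unitInterval (hw.min measurable_const) fun x => min_le_right _ _]
  have hanti : ∀ f : ℝ → ℝ≥0∞, Measurable fun l : ℝ => volume {x | ENNReal.ofReal l < f x} := by
    intro f
    refine Antitone.measurable fun a b hab => measure_mono fun x hx => ?_
    exact (ENNReal.ofReal_le_ofReal hab).trans_lt hx
  rw [← lintegral_const_mul _ (hanti u), ← lintegral_const_mul _ (hanti v),
    ← lintegral_add_left ((hanti u).const_mul _)]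
  refine setLIntegral_mono (hanti _) fun l hl => ?_
  have hl1 : ENNReal.ofReal l < 1 := by simpa using hl.2
  refine volume_combo_le ht hs (measurableSet_lt measurable_const hu)
    (measurableSet_lt measurable_const hv) ?_ ?_ ?_
  · exact lt_iSup_iff.1 (hu1.symm ▸ hl1)
  · exact lt_iSup_iff.1 (hv1.symm ▸ hl1)
  · intro x hx y hy
    simp only [Set.mem_ofPred_eq, lt_min_iff] at *
    refine ⟨lt_of_lt_of_le ?_ (h x y), hl1⟩
    rw [← rpow_mul_rpow_self ht hs hts (ENNReal.ofReal l)]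
    exact ENNReal.mul_lt_mul (ENNReal.rpow_lt_rpow hx ht) (ENNReal.rpow_lt_rpow hy hs)

/-- The Prékopa–Leindler inequality on `ℝ`, for bounded `u` and `v`. -/
theorem prekopa_leindler {t s : ℝ} (ht : 0 < t) (hs : 0 < s) (hts : t + s = 1)
    {u v w : ℝ → ℝ≥0∞} (hu : Measurable u) (hv : Measurable v) (hw : Measurable w)
    {M : ℝ≥0∞} (hM : M ≠ ∞) (huM : ∀ x, u x ≤ M) (hvM : ∀ x, v x ≤ M)
    (h : ∀ x y, u x ^ t * v y ^ s ≤ w (t * x + s * y)) :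
    (∫⁻ x, u x) ^ t * (∫⁻ x, v x) ^ s ≤ ∫⁻ x, w x := by
  set a := ⨆ x, u x with ha
  set b := ⨆ x, v x with hb
  have hatop : a ≠ ∞ := ne_top_of_le_ne_top hM (iSup_le huM)
  have hbtop : b ≠ ∞ := ne_top_of_le_ne_top hM (iSup_le hvM)
  rcases eq_or_ne a 0 with ha0 | ha0
  · have : ∀ x, u x = 0 := fun x => le_antisymm (ha0 ▸ le_iSup u x) zero_le
    simp [this, ht]
  rcases eq_or_ne b 0 with hb0 | hb0
  · have : ∀ x, v x = 0 := fun x => le_antisymm (hb0 ▸ le_iSup v x) zero_le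
    simp [this, hs]
  set c := a⁻¹ ^ t * b⁻¹ ^ s with hc
  have key := prekopa_leindler_of_iSup_eq_one ht hs hts (hu.const_mul a⁻¹) (hv.const_mul b⁻¹)
    (hw.const_mul c)
    (by rw [← ENNReal.mul_iSup, ENNReal.inv_mul_cancel ha0 hatop])
    (by rw [← ENNReal.mul_iSup, ENNReal.inv_mul_cancel hb0 hbtop])
    (fun x y => by
      rw [ENNReal.mul_rpow_of_nonneg _ _ ht.le, ENNReal.mul_rpow_of_nonneg _ _ hs.le]
      calc a⁻¹ ^ t * u x ^ t * (b⁻¹ ^ s * v y ^ s) = c * (u x ^ t * v y ^ s) := by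
            rw [hc]; ring
        _ ≤ _ := by gcongr; exact h x y)
  -- The weighted arithmetic–geometric mean inequality returns to the product form, and the
  -- normalization `c` then cancels.
  have key2 := (rpow_mul_rpow_le_add ht hs hts _ _).trans key
  rw [lintegral_const_mul _ hu, lintegral_const_mul _ hv, lintegral_const_mul _ hw,
    ENNReal.mul_rpow_of_nonneg _ _ ht.le, ENNReal.mul_rpow_of_nonneg _ _ hs.le] at key2
  have hc0 : c ≠ 0 := by
    simp [hc, ENNReal.rpow_eq_zero_iff, hatop, hbtop, ha0, hb0]
  have hctop : c ≠ ∞ := by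
    refine ENNReal.mul_ne_top ?_ ?_ <;> simp [ENNReal.rpow_eq_top_iff, hatop, hbtop, ha0, hb0]
  refine (ENNReal.mul_le_mul_iff_right hc0 hctop).1 ?_
  calc c * ((∫⁻ x, u x) ^ t * (∫⁻ x, v x) ^ s)
      = a⁻¹ ^ t * (∫⁻ x, u x) ^ t * (b⁻¹ ^ s * (∫⁻ x, v x) ^ s) := by rw [hc]; ring
    _ ≤ _ := key2

end Line

/-! ### Prékopa–Leindler inequalities with a cost, and their tensorization -/

/-- The probability measure `m` satisfies the Prékopa–Leindler inequality with weights `t`, `s` and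
quadratic correction `cost`. -/
def PrekopaLeindler {X : Type*} [MeasurableSpace X] [AddCommGroup X] [Module ℝ X] (t s : ℝ)
    (m : Measure X) (cost : X → ℝ) : Prop :=
  ∀ ⦃u v w : X → ℝ≥0∞⦄, Measurable u → Measurable v → Measurable w →
    ∀ ⦃M : ℝ≥0∞⦄, M ≠ ∞ → (∀ x, u x ≤ M) → (∀ x, v x ≤ M) →
    (∀ x y, u x ^ t * v y ^ s * ENNReal.ofReal (Real.exp (-(t * s / 2) * cost (x - y)))
      ≤ w (t • x + s • y)) →
    (∫⁻ x, u x ∂m) ^ t * (∫⁻ x, v x ∂m) ^ s ≤ ∫⁻ x, w x ∂m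

/-- The constant `a` stands for the cost of the other coordinates, frozen while one coordinate is
integrated. -/
lemma PrekopaLeindler.scaled {X : Type*} [MeasurableSpace X] [AddCommGroup X] [Module ℝ X]
    {t s : ℝ} {m : Measure X} {cost : X → ℝ} (h : PrekopaLeindler t s m cost)
    {u v w : X → ℝ≥0∞} (hu : Measurable u) (hv : Measurable v) (hw : Measurable w)
    {M : ℝ≥0∞} (hM : M ≠ ∞) (huM : ∀ x, u x ≤ M) (hvM : ∀ x, v x ≤ M) (a : ℝ)
    (huvw : ∀ x y, u x ^ t * v y ^ s * ENNReal.ofReal (Real.exp (a + -(t * s / 2) * cost (x - y)))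
      ≤ w (t • x + s • y)) :
    (∫⁻ x, u x ∂m) ^ t * (∫⁻ x, v x ∂m) ^ s * ENNReal.ofReal (Real.exp a) ≤ ∫⁻ x, w x ∂m := by
  have key := h hu hv (hw.const_mul (ENNReal.ofReal (Real.exp (-a)))) hM huM hvM (fun x y => by
    calc _ = ENNReal.ofReal (Real.exp (-a)) * (u x ^ t * v y ^ s *
          ENNReal.ofReal (Real.exp (a + -(t * s / 2) * cost (x - y)))) := by
          rw [mul_left_comm, ← ENNReal.ofReal_mul (Real.exp_pos _).le, ← Real.exp_add]
          congr 3; ring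
      _ ≤ _ := by gcongr; exact huvw x y)
  rw [lintegral_const_mul _ hw] at key
  calc _ ≤ ENNReal.ofReal (Real.exp (-a)) * (∫⁻ x, w x ∂m) * ENNReal.ofReal (Real.exp a) := by
        gcongr
    _ = (ENNReal.ofReal (Real.exp (-a)) * ENNReal.ofReal (Real.exp a)) * ∫⁻ x, w x ∂m := by ring
    _ = _ := by
      rw [← ENNReal.ofReal_mul (Real.exp_pos _).le, ← Real.exp_add]; simp

/-- The source of the quadratic cost: `t x² + s y² = (t x + s y)² + t s (x - y)²` when `t + s = 1`.
-/
lemma gaussianPDFReal_rpow_mul_rpow {t s : ℝ} (hts : t + s = 1) (x y : ℝ) :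
    gaussianPDFReal 0 1 x ^ t * gaussianPDFReal 0 1 y ^ s =
      gaussianPDFReal 0 1 (t * x + s * y) * Real.exp (-(t * s / 2) * (x - y) ^ 2) := by
  have hc : 0 < (√(2 * Real.pi * 1))⁻¹ := by positivity
  simp only [gaussianPDFReal, NNReal.coe_one]
  rw [Real.mul_rpow hc.le (Real.exp_pos _).le, Real.mul_rpow hc.le (Real.exp_pos _).le,
    ← Real.exp_mul, ← Real.exp_mul, mul_mul_mul_comm, ← Real.rpow_add hc, hts, Real.rpow_one,
    ← Real.exp_add, mul_assoc (√(2 * Real.pi * 1))⁻¹ (Real.exp _), ← Real.exp_add]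
  congr 2
  obtain rfl : s = 1 - t := by linarith
  ring

theorem prekopaLeindler_gaussianReal {t s : ℝ} (ht : 0 < t) (hs : 0 < s) (hts : t + s = 1) :
    PrekopaLeindler t s (gaussianReal 0 1) fun x => x ^ 2 := by
  intro u v w hu hv hw M hM huM hvM h
  have hp : Measurable (gaussianPDF 0 1) := measurable_gaussianPDF 0 1
  rw [gaussianReal_of_var_ne_zero 0 one_ne_zero, lintegral_withDensity_eq_lintegral_mul _ hp hu,
    lintegral_withDensity_eq_lintegral_mul _ hp hv, lintegral_withDensity_eq_lintegral_mul _ hp hw]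
  have hple : ∀ x, gaussianPDF 0 1 x ≤ ENNReal.ofReal (√(2 * Real.pi * 1))⁻¹ := by
    intro x
    rw [gaussianPDF, gaussianPDFReal]
    refine ENNReal.ofReal_le_ofReal ?_
    refine mul_le_of_le_one_right (by positivity) (Real.exp_le_one_iff.2 ?_)
    have := sq_nonneg (x - 0)
    simp only [NNReal.coe_one]
    linarith
  refine prekopa_leindler ht hs hts (hp.mul hu) (hp.mul hv) (hp.mul hw)
    (M := ENNReal.ofReal (√(2 * Real.pi * 1))⁻¹ * M) (ENNReal.mul_ne_top ENNReal.ofReal_ne_top hM)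
    (fun x => mul_le_mul' (hple x) (huM x)) (fun x => mul_le_mul' (hple x) (hvM x)) ?_
  intro x y
  have hpp : gaussianPDF 0 1 x ^ t * gaussianPDF 0 1 y ^ s = gaussianPDF 0 1 (t * x + s * y) *
      ENNReal.ofReal (Real.exp (-(t * s / 2) * (x - y) ^ 2)) := by
    simp only [gaussianPDF]
    rw [ENNReal.ofReal_rpow_of_nonneg (gaussianPDFReal_nonneg _ _ _) ht.le,
      ENNReal.ofReal_rpow_of_nonneg (gaussianPDFReal_nonneg _ _ _) hs.le,
      ← ENNReal.ofReal_mul (Real.rpow_nonneg (gaussianPDFReal_nonneg _ _ _) _),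
      gaussianPDFReal_rpow_mul_rpow hts, ENNReal.ofReal_mul (gaussianPDFReal_nonneg _ _ _)]
  simp only [Pi.mul_apply]
  rw [ENNReal.mul_rpow_of_nonneg _ _ ht.le, ENNReal.mul_rpow_of_nonneg _ _ hs.le,
    mul_mul_mul_comm, hpp, mul_assoc]
  gcongr
  rw [mul_comm]
  exact h x y

/-- For fixed `x`, `x'` the inequality in `y` carries the factor from `c (x - x')` along; the
partial integrals then satisfy the hypothesis in `x`. -/
theorem PrekopaLeindler.prod {X Y : Type*} [MeasurableSpace X] [AddCommGroup X] [Module ℝ X]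
    [MeasurableSpace Y] [AddCommGroup Y] [Module ℝ Y] {t s : ℝ} {m : Measure X} {m' : Measure Y}
    [SFinite m] [IsProbabilityMeasure m'] {c : X → ℝ} {c' : Y → ℝ}
    (h : PrekopaLeindler t s m c) (h' : PrekopaLeindler t s m' c') :
    PrekopaLeindler t s (m.prod m') fun p => c p.1 + c' p.2 := by
  intro u v w hu hv hw M hM huM hvM huvw
  rw [lintegral_prod _ hu.aemeasurable, lintegral_prod _ hv.aemeasurable,
    lintegral_prod _ hw.aemeasurable]
  have hb : ∀ f : X × Y → ℝ≥0∞, (∀ p, f p ≤ M) → ∀ x, ∫⁻ y, f (x, y) ∂m' ≤ M := fun f hf x =>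
    (lintegral_mono fun y => hf (x, y)).trans (by simp)
  refine h hu.lintegral_prod_right' hv.lintegral_prod_right' hw.lintegral_prod_right' hM
    (hb u huM) (hb v hvM) fun x x' => ?_
  refine h'.scaled (by fun_prop) (by fun_prop) (w := fun y => w (t • x + s • x', y)) (by fun_prop)
    hM (fun y => huM _) (fun y => hvM _) _ fun y y' => ?_
  have := huvw (x, y) (x', y')
  simpa [mul_add] using this

/-! ### Countable products -/

section Product

variable {ι X : Type*} [DecidableEq ι] [MeasurableSpace X]

lemma measurable_piecewise_uncurry (J : Finset ι) :
    Measurable fun p : (ι → X) × (ι → X) => J.piecewise p.1 p.2 := by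
  refine measurable_pi_iff.2 fun i => ?_
  by_cases hi : i ∈ J
  · simp only [Finset.piecewise, hi, if_true]; fun_prop
  · simp only [Finset.piecewise, hi, if_false]; fun_prop

lemma measurable_piecewise_left (J : Finset ι) (x : ι → X) :
    Measurable fun r : ι → X => J.piecewise r x :=
  (measurable_piecewise_uncurry J).comp (measurable_id.prodMk measurable_const)

variable (m : Measure X) [IsProbabilityMeasure m]

/-- Resampling the coordinates in `J` independently does not change the law. -/
lemma infinitePi_map_piecewise (J : Finset ι) :
    ((Measure.infinitePi fun _ : ι => m).prod (Measure.infinitePi fun _ : ι => m)).map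
      (fun p => J.piecewise p.1 p.2) = Measure.infinitePi fun _ : ι => m := by
  refine Measure.eq_infinitePi _ fun S T hT => ?_
  rw [Measure.map_apply (measurable_piecewise_uncurry J)
    (MeasurableSet.pi S.countable_toSet fun i _ => hT i)]
  have : (fun p : (ι → X) × (ι → X) => J.piecewise p.1 p.2) ⁻¹' (Set.pi S T) =
      (Set.pi (S.filter (· ∈ J) : Finset ι) T) ×ˢ (Set.pi (S.filter (· ∉ J) : Finset ι) T) := by
    ext p
    simp only [Set.mem_preimage, Set.mem_pi, Finset.mem_coe, Set.mem_prod, Finset.mem_filter,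
      Finset.piecewise]
    constructor
    · intro h
      exact ⟨fun i hi => by simpa [hi.2] using h i hi.1, fun i hi => by simpa [hi.2] using h i hi.1⟩
    · intro h i hi
      by_cases hJ : i ∈ J
      · simpa [hJ] using h.1 i ⟨hi, hJ⟩
      · simpa [hJ] using h.2 i ⟨hi, hJ⟩
  rw [this, Measure.prod_prod, Measure.infinitePi_pi _ fun i _ => hT i,
    Measure.infinitePi_pi _ fun i _ => hT i, Finset.prod_filter_mul_prod_filter_not]

/-- Average of `u` over the coordinates in `J`. -/
def coordAverage (J : Finset ι) (u : (ι → X) → ℝ≥0∞) (x : ι → X) : ℝ≥0∞ :=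
  ∫⁻ r, u (J.piecewise r x) ∂(Measure.infinitePi fun _ : ι => m)

variable {m} {u v w : (ι → X) → ℝ≥0∞} (J : Finset ι)

lemma measurable_coordAverage (hu : Measurable u) : Measurable (coordAverage m J u) :=
  (hu.comp ((measurable_piecewise_uncurry J).comp measurable_swap)).lintegral_prod_right'

lemma lintegral_lintegral_piecewise (hu : Measurable u) :
    ∫⁻ x, ∫⁻ r, u (J.piecewise r x) ∂(Measure.infinitePi fun _ : ι => m)
      ∂(Measure.infinitePi fun _ : ι => m) = ∫⁻ x, u x ∂(Measure.infinitePi fun _ : ι => m) := by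
  conv_rhs => rw [← infinitePi_map_piecewise m J,
    lintegral_map hu (measurable_piecewise_uncurry J)]
  exact (lintegral_prod_symm' _ (hu.comp (measurable_piecewise_uncurry J))).symm

lemma lintegral_coordAverage (hu : Measurable u) :
    ∫⁻ x, coordAverage m J u x ∂(Measure.infinitePi fun _ : ι => m) =
      ∫⁻ x, u x ∂(Measure.infinitePi fun _ : ι => m) :=
  lintegral_lintegral_piecewise J hu

lemma coordAverage_insert (hu : Measurable u) (j : ι) (x : ι → X) :
    coordAverage m (insert j J) u x = coordAverage m J (coordAverage m {j} u) x := by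
  have h := lintegral_lintegral_piecewise (m := m) {j}
    (hu.comp (measurable_piecewise_left (insert j J) x))
  simp only [Function.comp_def] at h
  rw [coordAverage, ← h]
  refine lintegral_congr fun r => lintegral_congr fun q => ?_
  congr 1
  ext i
  by_cases hi : i = j
  · simp [Finset.piecewise, hi]
  · by_cases hJ : i ∈ J <;> simp [Finset.piecewise, hi, hJ]

lemma coordAverage_singleton (hu : Measurable u) (j : ι) (x : ι → X) :
    coordAverage m {j} u x = ∫⁻ q, u (Function.update x j q) ∂m := by
  have hm : Measurable fun q : X => u (Function.update x j q) := hu.comp (measurable_update x)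
  rw [coordAverage, ← (measurePreserving_eval_infinitePi (fun _ : ι => m) j).lintegral_comp hm]
  refine lintegral_congr fun r => ?_
  rw [Finset.piecewise_singleton]

lemma coordAverage_le {M : ℝ≥0∞} (hu : ∀ x, u x ≤ M) (x : ι → X) : coordAverage m J u x ≤ M :=
  (lintegral_mono fun _ => hu _).trans (by simp)

/-! ### Tensorization over finitely many coordinates. -/

section Convex

variable [AddCommGroup X] [Module ℝ X] {t s : ℝ} {c : X → ℝ}

/-- The hypothesis on pairs differing in finitely many coordinates is stable under averaging one
coordinate, so the induction can repeat it. If `j ∈ J`, its cost has been used up by the integration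
and dropping it from the exponent is harmless because `c ≥ 0`. -/
lemma coordAverage_singleton_condition (ht : 0 < t) (hs : 0 < s)
    (h : PrekopaLeindler t s m c) (hc : ∀ x, 0 ≤ c x)
    (hu : Measurable u) (hv : Measurable v) (hw : Measurable w)
    {M : ℝ≥0∞} (hM : M ≠ ∞) (huM : ∀ x, u x ≤ M) (hvM : ∀ x, v x ≤ M)
    (huvw : ∀ (J : Finset ι) (x y : ι → X), (∀ i ∉ J, x i = y i) →
      u x ^ t * v y ^ s * ENNReal.ofReal (Real.exp (-(t * s / 2) * ∑ i ∈ J, c (x i - y i)))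
        ≤ w (t • x + s • y)) (j : ι) (J : Finset ι) (x y : ι → X) (hxy : ∀ i ∉ J, x i = y i) :
    coordAverage m {j} u x ^ t * coordAverage m {j} v y ^ s *
      ENNReal.ofReal (Real.exp (-(t * s / 2) * ∑ i ∈ J, c (x i - y i)))
        ≤ coordAverage m {j} w (t • x + s • y) := by
  rw [coordAverage_singleton hu, coordAverage_singleton hv, coordAverage_singleton hw]
  have hle : ∑ i ∈ J.erase j, c (x i - y i) ≤ ∑ i ∈ J, c (x i - y i) :=
    Finset.sum_le_sum_of_subset_of_nonneg (Finset.erase_subset _ _) fun _ _ _ => hc _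
  have hts' : 0 ≤ t * s / 2 := by positivity
  refine le_trans ?_ (h.scaled (hu.comp (measurable_update x (a := j)))
    (hv.comp (measurable_update y (a := j)))
    (hw.comp (measurable_update (t • x + s • y) (a := j))) hM (fun q => huM _) (fun q => hvM _)
    (-(t * s / 2) * ∑ i ∈ J.erase j, c (x i - y i)) fun q q' => ?_)
  · simp only [Function.comp_def]
    refine mul_le_mul' le_rfl (ENNReal.ofReal_le_ofReal (Real.exp_le_exp.2 ?_))
    nlinarith
  · have key := huvw (insert j (J.erase j)) (Function.update x j q) (Function.update y j q')
      fun i hi => by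
        have hij : i ≠ j := fun h => hi (by simp [h])
        rw [Function.update_of_ne hij, Function.update_of_ne hij]
        exact hxy i fun h => hi (by simp [h, hij])
    rw [Finset.sum_insert (by simp)] at key
    have hsum : ∑ i ∈ J.erase j, c (Function.update x j q i - Function.update y j q' i) =
        ∑ i ∈ J.erase j, c (x i - y i) := Finset.sum_congr rfl fun i hi => by
      have hij : i ≠ j := Finset.ne_of_mem_erase hi
      rw [Function.update_of_ne hij, Function.update_of_ne hij]
    rw [hsum, Function.update_self, Function.update_self] at key
    have hcomb : t • Function.update x j q + s • Function.update y j q' =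
        Function.update (t • x + s • y) j (t • q + s • q') := by
      ext i
      by_cases hij : i = j
      · subst hij; simp
      · simp [Function.update_of_ne hij]
    rw [hcomb] at key
    simp only [Function.comp_def]
    rwa [← mul_add, add_comm]

/-- Once every coordinate of `J` has been averaged, the stable hypothesis is read at `x = y`, where
the cost vanishes. -/
lemma coordAverage_prekopaLeindler (ht : 0 < t) (hs : 0 < s) (hts : t + s = 1)
    (h : PrekopaLeindler t s m c) (hc : ∀ x, 0 ≤ c x)
    {M : ℝ≥0∞} (hM : M ≠ ∞) (J : Finset ι) :
    ∀ {u v w : (ι → X) → ℝ≥0∞}, Measurable u → Measurable v → Measurable w →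
      (∀ x, u x ≤ M) → (∀ x, v x ≤ M) →
      (∀ (J : Finset ι) (x y : ι → X), (∀ i ∉ J, x i = y i) →
        u x ^ t * v y ^ s * ENNReal.ofReal (Real.exp (-(t * s / 2) * ∑ i ∈ J, c (x i - y i)))
          ≤ w (t • x + s • y)) → ∀ x,
      coordAverage m J u x ^ t * coordAverage m J v x ^ s ≤ coordAverage m J w x := by
  induction J using Finset.induction_on with
  | empty =>
    intro u v w hu hv hw huM hvM huvw x
    have := huvw ∅ x x fun _ _ => rfl
    rw [← add_smul, hts, one_smul] at this
    simpa [coordAverage] using this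
  | insert j J hj ih =>
    intro u v w hu hv hw huM hvM huvw x
    rw [coordAverage_insert J hu, coordAverage_insert J hv, coordAverage_insert J hw]
    exact ih (measurable_coordAverage _ hu) (measurable_coordAverage _ hv)
      (measurable_coordAverage _ hw) (coordAverage_le _ huM) (coordAverage_le _ hvM)
      (fun J' x y hxy => coordAverage_singleton_condition ht hs h hc hu hv hw hM huM hvM huvw
        j J' x y hxy) x

end Convex

end Product

/-! ### Averages over finitely many coordinates approach the mean, and the infinite product. -/

section Product

variable {ι X : Type*} [DecidableEq ι] [MeasurableSpace X]
variable {m : Measure X} [IsProbabilityMeasure m]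

-- Cylinder sets form an algebra generating the product σ-algebra, hence are dense in measure;
-- indicators of them approximate indicators, and sums of cylinder functions are again cylinder
-- functions.
open scoped symmDiff in
lemma exists_dependsOn_eLpNorm_sub_le {f : (ι → X) → ℝ}
    (hf : MemLp f 1 (Measure.infinitePi fun _ : ι => m)) {ε : ℝ≥0∞} (hε : ε ≠ 0) :
    ∃ g : (ι → X) → ℝ, eLpNorm (f - g) 1 (Measure.infinitePi fun _ : ι => m) ≤ ε ∧
      (Measurable g ∧ ∃ J : Finset ι, DependsOn g J) := by
  set P := Measure.infinitePi fun _ : ι => m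
  refine MemLp.induction_dense ENNReal.one_ne_top
    (fun g : (ι → X) → ℝ => Measurable g ∧ ∃ J : Finset ι, DependsOn g J) ?_ ?_
    (fun g hg => hg.1.aestronglyMeasurable) hf hε
  · intro c S hS _ δ hδ
    have hdense := Measure.MeasureDense.of_generateFrom_isSetAlgebra_finite P
      (𝒜 := measurableCylinders fun _ : ι => X) isSetAlgebra_measurableCylinders
      generateFrom_measurableCylinders.symm
    obtain ⟨η, hη, hη'⟩ : ∃ η : ℝ, 0 < η ∧ ‖c‖ₑ * ENNReal.ofReal η ≤ δ := by
      rcases eq_or_ne δ ∞ with rfl | hδt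
      · exact ⟨1, one_pos, le_top⟩
      have hpos : 0 < δ.toReal := ENNReal.toReal_pos hδ hδt
      refine ⟨δ.toReal / (‖c‖ + 1), by positivity, ?_⟩
      rw [← ofReal_norm, ← ENNReal.ofReal_mul (norm_nonneg _), ← ENNReal.ofReal_toReal hδt]
      refine ENNReal.ofReal_le_ofReal ?_
      rw [ENNReal.ofReal_toReal hδt, mul_div_assoc', div_le_iff₀ (by positivity)]
      nlinarith [norm_nonneg c]
    obtain ⟨T, hT, hST⟩ := hdense.approx S hS (measure_ne_top _ _) η hη
    have hTm := hdense.measurable T hT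
    obtain ⟨J, T', hT', rfl⟩ := (mem_measurableCylinders _).1 hT
    refine ⟨(cylinder J T').indicator fun _ => c, ?_, measurable_const.indicator hTm, J, ?_⟩
    · have hle : ∀ x : ι → X, ‖(((cylinder J T').indicator (fun _ => c) : (ι → X) → ℝ) -
          S.indicator fun _ => c) x‖ₑ ≤
          (S ∆ cylinder J T').indicator (fun _ => ‖c‖ₑ) x := by
        intro x
        by_cases h1 : x ∈ S <;> by_cases h2 : x ∈ cylinder J T' <;>
          simp [h1, h2, Set.indicator, Set.mem_symmDiff, -mem_cylinder]
      rw [eLpNorm_one_eq_lintegral_enorm]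
      calc _ ≤ ∫⁻ x, (S ∆ cylinder J T').indicator (fun _ => ‖c‖ₑ) x ∂P := lintegral_mono hle
        _ = ‖c‖ₑ * P (S ∆ cylinder J T') := by
          rw [lintegral_indicator (hS.symmDiff hTm), setLIntegral_const]
        _ ≤ ‖c‖ₑ * ENNReal.ofReal η := by gcongr
        _ ≤ δ := hη'
    · intro x y hxy
      have : x ∈ cylinder J T' ↔ y ∈ cylinder J T' := by
        rw [mem_cylinder, mem_cylinder]
        have : J.restrict x = J.restrict y := by
          ext i; exact hxy i i.2
        rw [this]
      by_cases h : x ∈ cylinder J T'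
      · rw [Set.indicator_of_mem h, Set.indicator_of_mem (this.1 h)]
      · rw [Set.indicator_of_notMem h, Set.indicator_of_notMem (fun h' => h (this.2 h'))]
  · rintro f g ⟨hf, J, hJ⟩ ⟨hg, J', hJ'⟩
    refine ⟨hf.add hg, J ∪ J', fun x y hxy => ?_⟩
    simp only [Pi.add_apply]
    rw [hJ fun i hi => hxy i (by simp at hi ⊢; tauto),
      hJ' fun i hi => hxy i (by simp at hi ⊢; tauto)]

/-- One-sided convergence in probability of the averages to the mean. An `L¹` approximation of `u`
by a function of finitely many coordinates has a constant average, and Markov's inequality controls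
the average of the error. -/
lemma exists_measure_coordAverage_lt_le {u : (ι → X) → ℝ≥0∞} (hu : Measurable u) {M : ℝ≥0∞}
    (hM : M ≠ ∞) (huM : ∀ x, u x ≤ M) {a : ℝ≥0∞}
    (ha : a < ∫⁻ x, u x ∂(Measure.infinitePi fun _ : ι => m)) {ε : ℝ≥0∞} (hε : ε ≠ 0) :
    ∃ J₀ : Finset ι, ∀ J, J₀ ⊆ J →
      (Measure.infinitePi fun _ : ι => m) {x | coordAverage m J u x < a} ≤ ε := by
  set P := Measure.infinitePi fun _ : ι => m with hP
  wlog hε1 : ε ≤ 1 generalizing ε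
  · obtain ⟨J₀, h⟩ := this one_ne_zero le_rfl
    exact ⟨J₀, fun J hJ => (h J hJ).trans (not_le.1 hε1).le⟩
  have hatop : a ≠ ∞ := ha.ne_top
  have hutop : ∀ x, u x ≠ ∞ := fun x => ne_top_of_le_ne_top hM (huM x)
  have hItop : ∫⁻ x, u x ∂P ≠ ∞ :=
    ne_top_of_le_ne_top hM ((lintegral_mono huM).trans (by simp))
  -- Half of the gap: one `κ` pays for the error in the mean, the other for the error in the average
  -- at `x`.
  set κ := (∫⁻ x, u x ∂P - a) / 2 with hκ
  have hκ0 : κ ≠ 0 := by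
    simp only [hκ, ne_eq, ENNReal.div_eq_zero_iff, tsub_eq_zero_iff_le, not_le, ha,
      ENNReal.ofNat_ne_top, or_false]
  have hκtop : κ ≠ ∞ := ENNReal.div_ne_top (ENNReal.sub_ne_top hItop) two_ne_zero
  have hsum : a + (κ + κ) = ∫⁻ x, u x ∂P := by
    rw [hκ, ENNReal.add_halves, add_tsub_cancel_of_le ha.le]
  have hmem : MemLp (fun x => (u x).toReal) 1 P := by
    refine MemLp.of_bound hu.ennreal_toReal.aestronglyMeasurable M.toReal
      (Eventually.of_forall fun x => ?_)
    rw [Real.norm_of_nonneg ENNReal.toReal_nonneg]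
    exact ENNReal.toReal_mono hM (huM x)
  obtain ⟨g, hg, hgm, J₀, hJ₀⟩ := exists_dependsOn_eLpNorm_sub_le hmem (mul_ne_zero hκ0 hε)
  set h : (ι → X) → ℝ≥0∞ := fun x => ‖(u x).toReal - g x‖ₑ with hh
  have hhm : Measurable h := (hu.ennreal_toReal.sub hgm).enorm
  have hhint : ∫⁻ x, h x ∂P ≤ κ * ε := by
    rw [eLpNorm_one_eq_lintegral_enorm] at hg
    exact hg
  have hu_enorm : ∀ x, ‖(u x).toReal‖ₑ = u x := fun x => by
    rw [Real.enorm_of_nonneg ENNReal.toReal_nonneg, ENNReal.ofReal_toReal (hutop x)]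
  have hug : ∀ x, u x ≤ ‖g x‖ₑ + h x := fun x => by
    rw [← hu_enorm x]
    calc ‖(u x).toReal‖ₑ = ‖g x + ((u x).toReal - g x)‖ₑ := by congr 1; ring
      _ ≤ _ := enorm_add_le _ _
  have hgu : ∀ x, ‖g x‖ₑ ≤ u x + h x := fun x => by
    rw [← hu_enorm x]
    calc ‖g x‖ₑ = ‖(u x).toReal - ((u x).toReal - g x)‖ₑ := by congr 1; ring
      _ ≤ _ := enorm_sub_le
  refine ⟨J₀, fun J hJ => ?_⟩
  have hconst : ∀ x, coordAverage m J (fun x => ‖g x‖ₑ) x = ∫⁻ x, ‖g x‖ₑ ∂P := by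
    intro x
    refine lintegral_congr fun r => ?_
    rw [hJ₀ fun i hi => ?_]
    rw [Finset.piecewise_eq_of_mem _ _ _ (hJ hi)]
  have h1 : ∀ x, ∫⁻ x, ‖g x‖ₑ ∂P ≤ coordAverage m J u x + coordAverage m J h x := by
    intro x
    rw [← hconst x]
    refine (lintegral_mono fun r => hgu _).trans_eq ?_
    exact lintegral_add_left (hu.comp (measurable_piecewise_left J x)) _
  have h2 : ∫⁻ x, u x ∂P ≤ (∫⁻ x, ‖g x‖ₑ ∂P) + κ := by
    calc _ ≤ ∫⁻ x, (‖g x‖ₑ + h x) ∂P := lintegral_mono hug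
      _ = (∫⁻ x, ‖g x‖ₑ ∂P) + ∫⁻ x, h x ∂P := lintegral_add_left hgm.enorm _
      _ ≤ _ := by
        gcongr
        exact hhint.trans (mul_le_of_le_one_right' hε1)
  have hsub : {x | coordAverage m J u x < a} ⊆ {x | κ ≤ coordAverage m J h x} := by
    intro x hx
    simp only [Set.mem_ofPred_eq] at hx ⊢
    by_contra! hlt
    have h3 : a + (κ + κ) ≤ (coordAverage m J u x + coordAverage m J h x) + κ := by
      rw [hsum]
      exact h2.trans (by gcongr; exact h1 x)
    have h4 : (coordAverage m J u x + coordAverage m J h x) + κ < (a + κ) + κ := by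
      refine ENNReal.add_lt_add_right hκtop (ENNReal.add_lt_add hx hlt)
    rw [add_assoc a κ κ] at h4
    exact absurd h3 (not_le.2 h4)
  refine (measure_mono hsub).trans ?_
  refine (meas_ge_le_lintegral_div (measurable_coordAverage J hhm).aemeasurable hκ0 hκtop).trans ?_
  rw [lintegral_coordAverage J hhm]
  refine ENNReal.div_le_of_le_mul ?_
  rw [mul_comm]
  exact hhint

lemma le_of_forall_lt_one_mul_le_self {x y : ℝ≥0∞}
    (h : ∀ θ : ℝ≥0∞, θ < 1 → θ ≠ 0 → θ * x ≤ y) : x ≤ y := by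
  have ht : Tendsto (fun θ : ℝ≥0∞ => θ * x) (𝓝[<] 1) (𝓝 (1 * x)) :=
    (ENNReal.Tendsto.mul_const tendsto_id (Or.inl one_ne_zero)).mono_left nhdsWithin_le_nhds
  rw [one_mul] at ht
  have : (𝓝[<] (1 : ℝ≥0∞)).NeBot := nhdsLT_neBot_of_exists_lt ⟨0, one_pos⟩
  refine le_of_tendsto ht ?_
  filter_upwards [self_mem_nhdsWithin, mem_nhdsWithin_of_mem_nhds (isOpen_ne.mem_nhds
    (one_ne_zero (α := ℝ≥0∞)))] with θ hθ hθ0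
  exact h θ hθ hθ0

/-- The Prékopa–Leindler inequality for a product measure, where the hypothesis concerns only pairs
of points that differ in finitely many coordinates. -/
theorem prekopaLeindler_infinitePi_of_bounded [AddCommGroup X] [Module ℝ X] {t s : ℝ} {c : X → ℝ}
    (ht : 0 < t) (hs : 0 < s) (hts : t + s = 1)
    (h : PrekopaLeindler t s m c) (hc : ∀ x, 0 ≤ c x)
    {u v w : (ι → X) → ℝ≥0∞} (hu : Measurable u) (hv : Measurable v) (hw : Measurable w)
    {M : ℝ≥0∞} (hM : M ≠ ∞) (huM : ∀ x, u x ≤ M) (hvM : ∀ x, v x ≤ M)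
    (huvw : ∀ (J : Finset ι) (x y : ι → X), (∀ i ∉ J, x i = y i) →
      u x ^ t * v y ^ s * ENNReal.ofReal (Real.exp (-(t * s / 2) * ∑ i ∈ J, c (x i - y i)))
        ≤ w (t • x + s • y)) :
    (∫⁻ x, u x ∂(Measure.infinitePi fun _ : ι => m)) ^ t *
      (∫⁻ x, v x ∂(Measure.infinitePi fun _ : ι => m)) ^ s ≤
        ∫⁻ x, w x ∂(Measure.infinitePi fun _ : ι => m) := by
  set P := Measure.infinitePi fun _ : ι => m with hP
  set a := ∫⁻ x, u x ∂P with ha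
  set b := ∫⁻ x, v x ∂P with hb
  have hat : a ≠ ∞ := ne_top_of_le_ne_top hM ((lintegral_mono huM).trans (by simp))
  have hbt : b ≠ ∞ := ne_top_of_le_ne_top hM ((lintegral_mono hvM).trans (by simp))
  rcases eq_or_ne a 0 with ha0 | ha0
  · simp [ha0, ht]
  rcases eq_or_ne b 0 with hb0 | hb0
  · simp [hb0, hs]
  refine le_of_forall_lt_one_mul_le_self fun θ hθ hθ0 => ?_
  have hθt : θ ≠ ∞ := hθ.ne_top
  have hmul : ∀ {d : ℝ≥0∞}, d ≠ 0 → d ≠ ∞ → θ * d < d := fun {d} h0 htop => by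
    simpa using (ENNReal.mul_lt_mul_iff_left h0 htop).2 hθ
  refine le_of_forall_lt_one_mul_le_self fun η hη _ => ?_
  have hε : (1 - η) / 2 ≠ 0 := by
    simp only [ne_eq, ENNReal.div_eq_zero_iff, tsub_eq_zero_iff_le, not_le, hη,
      ENNReal.ofNat_ne_top, or_false]
  obtain ⟨J₁, hJ₁⟩ := exists_measure_coordAverage_lt_le hu hM huM (hmul ha0 hat) hε
  obtain ⟨J₂, hJ₂⟩ := exists_measure_coordAverage_lt_le hv hM hvM (hmul hb0 hbt) hε
  specialize hJ₁ (J₁ ∪ J₂) Finset.subset_union_left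
  specialize hJ₂ (J₁ ∪ J₂) Finset.subset_union_right
  set J := J₁ ∪ J₂
  set A := {x | coordAverage m J u x < θ * a}
  set B := {x | coordAverage m J v x < θ * b}
  have hAm : MeasurableSet A := measurableSet_lt (measurable_coordAverage J hu) measurable_const
  have hBm : MeasurableSet B := measurableSet_lt (measurable_coordAverage J hv) measurable_const
  -- Off `A ∪ B` both averages are within the factor `θ` of their means. The inequality for averages
  -- there bounds `w` from below on a set of measure at least `η`; finally `θ` and `η` tend to `1`.
  have hgood : η ≤ P (A ∪ B)ᶜ := by
    have h1 : P (A ∪ B) ≤ 1 - η := by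
      refine (measure_union_le _ _).trans ((add_le_add hJ₁ hJ₂).trans ?_)
      rw [ENNReal.add_halves]
    rw [prob_compl_eq_one_sub (hAm.union hBm)]
    calc η = 1 - (1 - η) := (ENNReal.sub_sub_cancel ENNReal.one_ne_top hη.le).symm
      _ ≤ _ := tsub_le_tsub_left h1 1
  have hK : θ * (a ^ t * b ^ s) = (θ * a) ^ t * (θ * b) ^ s := by
    rw [ENNReal.mul_rpow_of_nonneg _ _ ht.le, ENNReal.mul_rpow_of_nonneg _ _ hs.le,
      mul_mul_mul_comm, rpow_mul_rpow_self ht hs hts]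
  calc η * (θ * (a ^ t * b ^ s)) ≤ (θ * (a ^ t * b ^ s)) * P (A ∪ B)ᶜ := by
        rw [mul_comm]; gcongr
    _ = ∫⁻ _ in (A ∪ B)ᶜ, θ * (a ^ t * b ^ s) ∂P := by rw [setLIntegral_const]
    _ ≤ ∫⁻ x in (A ∪ B)ᶜ, coordAverage m J w x ∂P := by
        refine setLIntegral_mono (measurable_coordAverage J hw) fun x hx => ?_
        simp only [Set.mem_compl_iff, Set.mem_union, not_or, A, B, Set.mem_ofPred_eq, not_lt] at hx
        rw [hK]
        refine le_trans ?_ (coordAverage_prekopaLeindler ht hs hts h hc hM J hu hv hw huM hvM huvw x)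
        gcongr
        exacts [hx.1, hx.2]
    _ ≤ ∫⁻ x, coordAverage m J w x ∂P := setLIntegral_le_lintegral _ _
    _ = ∫⁻ x, w x ∂P := lintegral_coordAverage J hw

theorem prekopaLeindler_infinitePi [AddCommGroup X] [Module ℝ X] {t s : ℝ} {c : X → ℝ}
    (ht : 0 < t) (hs : 0 < s) (hts : t + s = 1)
    (h : PrekopaLeindler t s m c) (hc : ∀ x, 0 ≤ c x)
    {u v w : (ι → X) → ℝ≥0∞} (hu : Measurable u) (hv : Measurable v) (hw : Measurable w)
    (huvw : ∀ (J : Finset ι) (x y : ι → X), (∀ i ∉ J, x i = y i) →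
      u x ^ t * v y ^ s * ENNReal.ofReal (Real.exp (-(t * s / 2) * ∑ i ∈ J, c (x i - y i)))
        ≤ w (t • x + s • y)) :
    (∫⁻ x, u x ∂(Measure.infinitePi fun _ : ι => m)) ^ t *
      (∫⁻ x, v x ∂(Measure.infinitePi fun _ : ι => m)) ^ s ≤
        ∫⁻ x, w x ∂(Measure.infinitePi fun _ : ι => m) := by
  set P := Measure.infinitePi fun _ : ι => m with hP
  have hn : ∀ n : ℕ, (∫⁻ x, min (u x) n ∂P) ^ t * (∫⁻ x, min (v x) n ∂P) ^ s ≤ ∫⁻ x, w x ∂P := by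
    intro n
    refine prekopaLeindler_infinitePi_of_bounded ht hs hts h hc (hu.min measurable_const)
      (hv.min measurable_const) hw (ENNReal.natCast_ne_top n) (fun _ => min_le_right _ _)
      (fun _ => min_le_right _ _) fun J x y hxy => le_trans ?_ (huvw J x y hxy)
    gcongr <;> exact min_le_left _ _
  have hlim : ∀ f : (ι → X) → ℝ≥0∞, Measurable f →
      Tendsto (fun n : ℕ => ∫⁻ x, min (f x) n ∂P) atTop (𝓝 (∫⁻ x, f x ∂P)) := by
    intro f hf
    refine lintegral_tendsto_of_tendsto_of_monotone
      (fun n => (hf.min measurable_const).aemeasurable)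
      (Eventually.of_forall fun x i j hij => min_le_min le_rfl (by exact_mod_cast hij))
      (Eventually.of_forall fun x => ?_)
    have := (tendsto_const_nhds (x := f x)).min ENNReal.tendsto_nat_nhds_top
    simpa using this
  -- Vanishing integrals are set aside because multiplication in `ℝ≥0∞` is discontinuous at `0 * ∞`.
  rcases eq_or_ne (∫⁻ x, u x ∂P) 0 with h0 | h0
  · simp [h0, ht]
  rcases eq_or_ne (∫⁻ x, v x ∂P) 0 with h0' | h0'
  · simp [h0', hs]
  refine le_of_tendsto (ENNReal.Tendsto.mul ((hlim u hu).ennrpow_const t) (Or.inl ?_)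
    ((hlim v hv).ennrpow_const s) (Or.inl ?_)) (Eventually.of_forall hn)
  · simp [ENNReal.rpow_eq_zero_iff, h0, ht.le]
  · simp [ENNReal.rpow_eq_zero_iff, h0', hs.le]

end Product

/-! ### Diagonal operators and the Cameron–Martin embedding -/

/-- Square summable sequences on `ℤ`. -/
abbrev Seq : Type := lp (fun _ : ℤ => ℂ) 2

lemma Seq.norm_sq_eq (c : Seq) : ‖c‖ ^ 2 = ∑' j, ‖c j‖ ^ 2 := by
  have := lp.norm_rpow_eq_tsum (p := 2) (by norm_num) c
  simpa using this

lemma Seq.summable_norm_sq (c : Seq) : Summable fun j => ‖c j‖ ^ 2 := by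
  have := (lp.memℓp c).summable (by norm_num)
  simpa using this

/-- Multiplication of a square summable sequence by a sequence bounded by `1`. -/
def diag (q : ℤ → ℂ) (hq : ∀ j, ‖q j‖ ≤ 1) : Seq →L[ℂ] Seq :=
  LinearMap.mkContinuous
    { toFun := fun c => ⟨fun j => q j * c j, by
        refine memℓp_gen (.of_nonneg_of_le (fun j => by positivity) (fun j => ?_)
          ((lp.memℓp c).summable (by norm_num)))
        gcongr
        rw [norm_mul]
        exact mul_le_of_le_one_left (norm_nonneg _) (hq j)⟩
      map_add' := fun c d => by ext j; exact mul_add _ _ _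
      map_smul' := fun a c => by ext j; simp [mul_left_comm] } 1 fun c => by
    rw [one_mul, ← sq_le_sq₀ (norm_nonneg _) (norm_nonneg _), Seq.norm_sq_eq, Seq.norm_sq_eq]
    refine Summable.tsum_le_tsum (fun j => ?_) (Seq.summable_norm_sq _) (Seq.summable_norm_sq _)
    gcongr
    simp only [LinearMap.coe_mk, AddHom.coe_mk, norm_mul]
    exact mul_le_of_le_one_left (norm_nonneg _) (hq j)

@[simp] lemma diag_apply (q : ℤ → ℂ) (hq : ∀ j, ‖q j‖ ≤ 1) (c : Seq) (j : ℤ) :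
    diag q hq c j = q j * c j := rfl

/-- `1 / j` for `j ≠ 0`, and `0` for `j = 0`. -/
def invFreq (j : ℤ) : ℂ := if j = 0 then 0 else 1 / (j : ℂ)

lemma norm_invFreq_le_one (j : ℤ) : ‖invFreq j‖ ≤ 1 := by
  unfold invFreq
  split_ifs with h
  · simp
  · rw [norm_div, norm_one, Complex.norm_intCast, div_le_one (by positivity)]
    exact_mod_cast Int.one_le_abs h

/-- The embedding of `ℓ²` into `L²` whose image is the space of mean zero functions in `H¹`. -/
def cmEmbed : Seq →L[ℂ] LTwo :=
  (fourierBasis.repr.symm.toContinuousLinearEquiv.toContinuousLinearMap : Seq →L[ℂ] LTwo) ∘L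
    diag invFreq norm_invFreq_le_one

lemma fourierCoeff_cmEmbed (c : Seq) (j : ℤ) :
    fourierCoeff (cmEmbed c) j = invFreq j * c j := by
  rw [← fourierBasis_repr]
  simp [cmEmbed]

lemma hasSum_cmEmbed (c : Seq) :
    HasSum (fun j : ℤ => (invFreq j * c j) • (fourierLp 2 j : LTwo)) (cmEmbed c) := by
  have h := fourierBasis.hasSum_repr (cmEmbed c)
  simp only [fourierBasis_repr, fourierCoeff_cmEmbed, coe_fourierBasis] at h
  exact h

lemma norm_cmEmbed_le (c : Seq) : ‖cmEmbed c‖ ≤ ‖c‖ := by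
  have h : ‖cmEmbed c‖ = ‖diag invFreq norm_invFreq_le_one c‖ := by simp [cmEmbed]
  rw [h]
  have := (diag invFreq norm_invFreq_le_one).le_of_opNorm_le
    (LinearMap.mkContinuous_norm_le _ zero_le_one _) c
  simpa using this

/-! ### The Prékopa–Leindler inequality for the Brownian loop -/

lemma brownianLoop_of_not_summable {γ : ℤ → ℝ × ℝ}
    (h : ¬ Summable fun j : ℤ => loopCoeff γ j • (fourierLp 2 j : LTwo)) : brownianLoop γ = 0 :=
  tsum_eq_zero_of_not_summable h

/-- Adding a square summable perturbation does not affect summability, so the default value `0` of a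
divergent series occurs at both points or at neither. -/
lemma brownianLoop_shift {x y : ℤ → ℝ × ℝ} (c : Seq)
    (h : ∀ j, loopCoeff y j = loopCoeff x j + invFreq j * c j) :
    (Summable (fun j : ℤ => loopCoeff y j • (fourierLp 2 j : LTwo)) ↔
      Summable (fun j : ℤ => loopCoeff x j • (fourierLp 2 j : LTwo))) ∧
    (Summable (fun j : ℤ => loopCoeff x j • (fourierLp 2 j : LTwo)) →
      brownianLoop y = brownianLoop x + cmEmbed c) := by
  have h' : (fun j : ℤ => loopCoeff y j • (fourierLp 2 j : LTwo)) = fun j : ℤ =>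
      loopCoeff x j • (fourierLp 2 j : LTwo) + (invFreq j * c j) • (fourierLp 2 j : LTwo) := by
    ext1 j; rw [h, add_smul]
  have hc := hasSum_cmEmbed c
  refine ⟨?_, fun hx => ?_⟩
  · rw [h']
    exact ⟨fun hy => by simpa using hy.sub hc.summable, fun hx => hx.add hc.summable⟩
  · rw [brownianLoop, h', hx.tsum_add hc.summable, hc.tsum_eq]
    rfl

/-- Complex coordinate of a pair of reals. -/
def toComplex (p : ℝ × ℝ) : ℂ := (p.1 : ℂ) + Complex.I * (p.2 : ℂ)

lemma norm_toComplex_sq (p : ℝ × ℝ) : ‖toComplex p‖ ^ 2 = p.1 ^ 2 + p.2 ^ 2 := by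
  rw [Complex.sq_norm, Complex.normSq_apply]
  simp [toComplex]
  ring

lemma loopCoeff_eq (γ : ℤ → ℝ × ℝ) (j : ℤ) : loopCoeff γ j = invFreq j * toComplex (γ j) := by
  unfold loopCoeff invFreq toComplex
  split_ifs
  · simp
  · rw [div_mul_eq_mul_div, one_mul]

lemma prekopaLeindler_gaussian_pair {t s : ℝ} (ht : 0 < t) (hs : 0 < s) (hts : t + s = 1) :
    PrekopaLeindler t s ((gaussianReal 0 1).prod (gaussianReal 0 1))
      fun p : ℝ × ℝ => p.1 ^ 2 + p.2 ^ 2 :=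
  (prekopaLeindler_gaussianReal ht hs hts).prod (prekopaLeindler_gaussianReal ht hs hts)

/-- With `z = t x + s y`, the two points are `z + s (x - y)` and `z - t (x - y)`. A difference in
finitely many coordinates is a finitely supported `c`, so directions in `ℓ²` suffice. -/
theorem prekopaLeindler_loopMeasure {t s : ℝ} (ht : 0 < t) (hs : 0 < s) (hts : t + s = 1)
    {u v w : LTwo → ℝ≥0∞} (hu : Measurable u) (hv : Measurable v) (hw : Measurable w)
    (huvw : ∀ z c, u (z + s • cmEmbed c) ^ t * v (z - t • cmEmbed c) ^ s *
      ENNReal.ofReal (Real.exp (-(t * s / 2) * ‖c‖ ^ 2)) ≤ w z) :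
    (∫⁻ x, u x ∂loopMeasure) ^ t * (∫⁻ x, v x ∂loopMeasure) ^ s ≤ ∫⁻ x, w x ∂loopMeasure := by
  unfold loopMeasure
  rw [lintegral_map hu measurable_brownianLoop, lintegral_map hv measurable_brownianLoop,
    lintegral_map hw measurable_brownianLoop]
  refine prekopaLeindler_infinitePi ht hs hts (prekopaLeindler_gaussian_pair ht hs hts)
    (fun p => by positivity) (hu.comp measurable_brownianLoop) (hv.comp measurable_brownianLoop)
    (hw.comp measurable_brownianLoop) fun J x y hxy => ?_
  set z := t • x + s • y with hz
  have hmem : Memℓp (fun j => toComplex (x j - y j)) (2 : ℝ≥0∞) := by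
    refine (memℓp_zero (E := fun _ : ℤ => ℂ) ?_).of_exponent_ge zero_le
    refine J.finite_toSet.subset fun j hj => ?_
    by_contra hJ
    refine hj ?_
    simp only [Finset.mem_coe] at hJ
    simp [hxy j hJ, toComplex]
  set c : Seq := ⟨_, hmem⟩ with hc
  have hcj : ∀ j, c j = toComplex (x j - y j) := fun j => rfl
  have hcnorm : ‖c‖ ^ 2 = ∑ i ∈ J, ((x i - y i).1 ^ 2 + (x i - y i).2 ^ 2) := by
    rw [Seq.norm_sq_eq, tsum_eq_sum (s := J)]
    · exact Finset.sum_congr rfl fun i _ => norm_toComplex_sq _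
    · intro j hj
      simp [hcj, hxy j hj, toComplex]
  have hx : ∀ j, loopCoeff x j = loopCoeff z j + invFreq j * (s • c) j := by
    intro j
    obtain rfl : t = 1 - s := by linarith
    simp only [loopCoeff_eq, lp.coeFn_smul, Pi.smul_apply, hcj, ← mul_add]
    congr 1
    simp only [toComplex, hz, Pi.add_apply, Pi.smul_apply, Prod.fst_add, Prod.smul_fst,
      Prod.snd_add, Prod.smul_snd, Prod.fst_sub, Prod.snd_sub, Complex.real_smul, smul_eq_mul]
    push_cast
    ring
  have hy : ∀ j, loopCoeff y j = loopCoeff z j + invFreq j * (-(t • c)) j := by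
    intro j
    obtain rfl : t = 1 - s := by linarith
    simp only [loopCoeff_eq, lp.coeFn_smul, lp.coeFn_neg, Pi.neg_apply, Pi.smul_apply, hcj,
      ← mul_add]
    congr 1
    simp only [toComplex, hz, Pi.add_apply, Pi.smul_apply, Prod.fst_add, Prod.smul_fst,
      Prod.snd_add, Prod.smul_snd, Prod.fst_sub, Prod.snd_sub, Complex.real_smul, smul_eq_mul]
    push_cast
    ring
  have hsx := brownianLoop_shift _ hx
  have hsy := brownianLoop_shift _ hy
  rw [← hcnorm]
  by_cases hsum : Summable (fun j : ℤ => loopCoeff z j • (fourierLp 2 j : LTwo))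
  · have h1 : brownianLoop x = brownianLoop z + s • cmEmbed c := by
      rw [hsx.2 hsum, cmEmbed.map_smul_of_tower]
    have h2 : brownianLoop y = brownianLoop z - t • cmEmbed c := by
      rw [hsy.2 hsum, map_neg, cmEmbed.map_smul_of_tower, sub_eq_add_neg]
    rw [h1, h2]
    exact huvw _ c
  -- All three loops take the default value `0` here, and the hypothesis at `z = 0`, `c = 0` covers
  -- the case.
  · rw [brownianLoop_of_not_summable hsum,
      brownianLoop_of_not_summable (fun h => hsum (hsx.1.1 h)),
      brownianLoop_of_not_summable (fun h => hsum (hsy.1.1 h))]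
    have h0 := huvw 0 0
    simp only [map_zero, smul_zero, add_zero, sub_zero, norm_zero, ne_eq, OfNat.ofNat_ne_zero,
      not_false_eq_true, zero_pow, mul_zero, Real.exp_zero, ENNReal.ofReal_one, mul_one] at h0
    refine le_trans ?_ h0
    refine mul_le_of_le_one_right' ?_
    rw [ENNReal.ofReal_le_one, Real.exp_le_one_iff]
    have : 0 ≤ t * s / 2 * ‖c‖ ^ 2 := by positivity
    linarith

instance : IsProbabilityMeasure gaussianLaw := by unfold gaussianLaw; infer_instance

instance : IsProbabilityMeasure loopMeasure :=
  Measure.isProbabilityMeasure_map measurable_brownianLoop.aemeasurable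

/-! ### The ball, the quartic functional, and its convexity defect -/

lemma integral_norm_sq_eq (u : LTwo) : ∫ θ, ‖u θ‖ ^ 2 ∂arc = ‖u‖ ^ 2 := by
  have h := inner_self_eq_norm_sq (𝕜 := ℝ) u
  rw [L2.inner_def] at h
  rw [← h]
  simp

lemma integrable_norm_sq (u : LTwo) : Integrable (fun θ => ‖u θ‖ ^ 2) arc :=
  (memLp_two_iff_integrable_sq_norm (Lp.aestronglyMeasurable u)).1 (Lp.memLp u)

lemma mem_ball_iff {N : ℝ} {u : LTwo} : u ∈ Ball N ↔ ‖u‖ ^ 2 ≤ N := by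
  rw [Ball, Set.mem_ofPred_eq, integral_norm_sq_eq]

lemma ball_eq_closedBall {N : ℝ} (hN : 0 ≤ N) : Ball N = Metric.closedBall 0 (√N) := by
  ext u
  rw [mem_ball_iff, mem_closedBall_zero_iff, Real.le_sqrt (norm_nonneg _) hN]

lemma measurableSet_ball (N : ℝ) : MeasurableSet (Ball N) := by
  have : Ball N = {u : LTwo | ‖u‖ ^ 2 ≤ N} := by ext u; exact mem_ball_iff
  rw [this]
  exact measurableSet_le (by fun_prop) measurable_const

lemma convex_ball {N : ℝ} (hN : 0 ≤ N) : Convex ℝ (Ball N) := by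
  rw [ball_eq_closedBall hN]
  exact convex_closedBall _ _

/-- The extended real number `∫ |u|⁴`. -/
def quartic (u : LTwo) : ℝ≥0∞ := ∫⁻ θ, ‖u θ‖ₑ ^ 4 ∂arc

lemma integral_norm_pow_four (u : LTwo) : ∫ θ, ‖u θ‖ ^ 4 ∂arc = (quartic u).toReal := by
  rw [integral_eq_lintegral_of_nonneg_ae (Eventually.of_forall fun θ => by positivity)
    (f := fun θ => ‖u θ‖ ^ 4) ((Lp.aestronglyMeasurable u).norm.pow 4)]
  simp only [quartic, ENNReal.ofReal_pow (norm_nonneg _), ofReal_norm]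

/-- Lower semicontinuity on `L²`: a convergent sequence has an almost everywhere convergent
subsequence, and Fatou's lemma shows that sublevel sets are closed. -/
lemma measurable_quartic : Measurable quartic := by
  refine measurable_of_Iic fun a => IsClosed.measurableSet ?_
  refine IsSeqClosed.isClosed fun x u hx hu => ?_
  obtain ⟨φ, -, hφ⟩ := (tendstoInMeasure_of_tendsto_Lp hu).exists_seq_tendsto_ae
  simp only [Set.mem_preimage, Set.mem_Iic] at hx ⊢
  calc quartic u ≤ ∫⁻ θ, liminf (fun n => ‖x (φ n) θ‖ₑ ^ 4) atTop ∂arc := by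
        refine lintegral_mono_ae ?_
        filter_upwards [hφ] with θ hθ
        exact (((ENNReal.continuous_pow 4).tendsto _).comp hθ.enorm).liminf_eq.ge
    _ ≤ liminf (fun n => ∫⁻ θ, ‖x (φ n) θ‖ₑ ^ 4 ∂arc) atTop :=
        lintegral_liminf_le' fun n => (Lp.aestronglyMeasurable _).enorm.pow_const 4
    _ ≤ a := by
        refine liminf_le_of_le (by isBoundedDefault) fun b hb => ?_
        obtain ⟨n, hn⟩ := hb.exists
        exact hn.trans (hx (φ n))

lemma measurable_weight (lam : ℝ) : Measurable (weight lam) := by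
  unfold weight
  simp only [integral_norm_pow_four]
  have := measurable_quartic
  fun_prop

lemma integrable_pow_four_of_sub_le {x y : LTwo} {B : ℝ} (hB : ∀ᵐ θ ∂arc, ‖x θ - y θ‖ ≤ B)
    (hx : Integrable (fun θ => ‖x θ‖ ^ 4) arc) : Integrable (fun θ => ‖y θ‖ ^ 4) arc := by
  refine Integrable.mono' ((hx.const_mul 8).add (integrable_const (8 * B ^ 4)))
    ((Lp.aestronglyMeasurable y).norm.pow 4) ?_
  filter_upwards [hB] with θ hθ
  have h1 : ‖y θ‖ ≤ ‖x θ‖ + B := by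
    calc ‖y θ‖ = ‖x θ - (x θ - y θ)‖ := by congr 1; ring
      _ ≤ _ := (norm_sub_le _ _).trans (by gcongr)
  have hB0 : 0 ≤ B := (norm_nonneg _).trans hθ
  rw [Real.norm_of_nonneg (by positivity)]
  calc ‖y θ‖ ^ 4 ≤ (‖x θ‖ + B) ^ 4 := by gcongr
    _ ≤ 2 ^ 3 * (‖x θ‖ ^ 4 + B ^ 4) := add_pow_le (norm_nonneg _) hB0 4
    _ = _ := by simp; ring

/-- Put `A = |a|²`, `B = |b|²`, `D = |a - b|²`, `P = t A + s B`. Then `|t a + s b|² = P - t s D`,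
whose square is at least `P² - 2 t s D P`, while `t A² + s B² - P² = t s (A - B)² ≤ 2 t s D (A +
B)`. -/
lemma norm_pow_four_convexity_defect {t s : ℝ} (ht : 0 < t) (hs : 0 < s) (hts : t + s = 1)
    (a b : ℂ) : t * ‖a‖ ^ 4 + s * ‖b‖ ^ 4 ≤ ‖t • a + s • b‖ ^ 4 +
      t * s * ‖a - b‖ ^ 2 * (2 * (t * ‖a‖ ^ 2 + s * ‖b‖ ^ 2) + 2 * (‖a‖ ^ 2 + ‖b‖ ^ 2)) := by
  have hm : ‖t • a + s • b‖ ^ 2 = t * ‖a‖ ^ 2 + s * ‖b‖ ^ 2 - t * s * ‖a - b‖ ^ 2 := by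
    simp only [Complex.sq_norm, Complex.normSq_apply, Complex.add_re, Complex.add_im,
      Complex.real_smul, Complex.mul_re, Complex.mul_im, Complex.ofReal_re, Complex.ofReal_im,
      Complex.sub_re, Complex.sub_im]
    obtain rfl : s = 1 - t := by linarith
    ring
  have h1 : (‖a‖ ^ 2 - ‖b‖ ^ 2) ^ 2 ≤ ‖a - b‖ ^ 2 * (2 * (‖a‖ ^ 2 + ‖b‖ ^ 2)) := by
    have h2 : (‖a‖ - ‖b‖) ^ 2 ≤ ‖a - b‖ ^ 2 := sq_le_sq' (by
      have := norm_sub_norm_le b a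
      rw [norm_sub_rev] at this
      linarith) (norm_sub_norm_le a b)
    have h3 : (‖a‖ + ‖b‖) ^ 2 ≤ 2 * (‖a‖ ^ 2 + ‖b‖ ^ 2) := by nlinarith [sq_nonneg (‖a‖ - ‖b‖)]
    calc (‖a‖ ^ 2 - ‖b‖ ^ 2) ^ 2 = (‖a‖ - ‖b‖) ^ 2 * (‖a‖ + ‖b‖) ^ 2 := by ring
      _ ≤ _ := by gcongr
  have h4 : ‖t • a + s • b‖ ^ 4 = (‖t • a + s • b‖ ^ 2) ^ 2 := by ring
  rw [h4, hm]
  have h5 := mul_le_mul_of_nonneg_left h1 (mul_pos ht hs).le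
  have h6 := sq_nonneg (t * s * ‖a - b‖ ^ 2)
  generalize ‖a - b‖ ^ 2 = D at *
  have h7 : ‖a‖ ^ 4 = (‖a‖ ^ 2) ^ 2 := by ring
  have h8 : ‖b‖ ^ 4 = (‖b‖ ^ 2) ^ 2 := by ring
  rw [h7, h8]
  generalize ‖a‖ ^ 2 = A at *
  generalize ‖b‖ ^ 2 = B at *
  obtain rfl : s = 1 - t := by linarith
  nlinarith

lemma quartic_convexity_defect {N t s B : ℝ} (ht : 0 < t) (hs : 0 < s) (hts : t + s = 1)
    {x y : LTwo} (hx : x ∈ Ball N) (hy : y ∈ Ball N)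
    (hB : ∀ᵐ θ ∂arc, ‖x θ - y θ‖ ≤ B) :
    t * (∫ θ, ‖x θ‖ ^ 4 ∂arc) + s * (∫ θ, ‖y θ‖ ^ 4 ∂arc) ≤
      (∫ θ, ‖(t • x + s • y) θ‖ ^ 4 ∂arc) + t * s * (6 * N * B ^ 2) := by
  have hN : 0 ≤ N := (sq_nonneg _).trans (mem_ball_iff.1 hx)
  have hxy : ∀ᵐ θ ∂arc, ‖y θ - x θ‖ ≤ B := by
    filter_upwards [hB] with θ hθ
    rwa [norm_sub_rev]
  have hz : ∀ᵐ θ ∂arc, (t • x + s • y) θ = t • x θ + s • y θ := by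
    filter_upwards [Lp.coeFn_add (t • x) (s • y), Lp.coeFn_smul t x, Lp.coeFn_smul s y]
      with θ h1 h2 h3
    rw [h1, Pi.add_apply, h2, h3, Pi.smul_apply, Pi.smul_apply]
  have hxz : ∀ᵐ θ ∂arc, ‖x θ - (t • x + s • y) θ‖ ≤ s * B := by
    filter_upwards [hB, hz] with θ hθ h1
    have h2 : x θ - (t • x θ + s • y θ) = s • (x θ - y θ) := by
      obtain rfl : t = 1 - s := by linarith
      module
    rw [h1, h2, norm_smul, Real.norm_of_nonneg hs.le]
    gcongr
  by_cases hix : Integrable (fun θ => ‖x θ‖ ^ 4) arc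
  · have hiy := integrable_pow_four_of_sub_le hB hix
    have hiz := integrable_pow_four_of_sub_le hxz hix
    have h2x := integrable_norm_sq x
    have h2y := integrable_norm_sq y
    have hint : Integrable (fun θ => t * s * B ^ 2 * (2 * t + 2) * ‖x θ‖ ^ 2 +
        t * s * B ^ 2 * (2 * s + 2) * ‖y θ‖ ^ 2) arc :=
      (h2x.const_mul _).add (h2y.const_mul _)
    have hmono := integral_mono_ae ((hix.const_mul t).add (hiy.const_mul s)) (hiz.add hint) (by
      filter_upwards [hB, hz] with θ hθ h1
      have h2 := norm_pow_four_convexity_defect ht hs hts (x θ) (y θ)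
      simp only [Pi.add_apply]
      rw [h1]
      have h3 : t * s * ‖x θ - y θ‖ ^ 2 * (2 * (t * ‖x θ‖ ^ 2 + s * ‖y θ‖ ^ 2) +
          2 * (‖x θ‖ ^ 2 + ‖y θ‖ ^ 2)) ≤ t * s * B ^ 2 * (2 * (t * ‖x θ‖ ^ 2 + s * ‖y θ‖ ^ 2) +
          2 * (‖x θ‖ ^ 2 + ‖y θ‖ ^ 2)) := by gcongr
      linarith)
    simp only [Pi.add_apply] at hmono
    rw [integral_add (hix.const_mul t) (hiy.const_mul s), integral_const_mul, integral_const_mul,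
      integral_add hiz hint, integral_add (h2x.const_mul _) (h2y.const_mul _), integral_const_mul,
      integral_const_mul] at hmono
    have hx' : ∫ θ, ‖x θ‖ ^ 2 ∂arc ≤ N := hx
    have hy' : ∫ θ, ‖y θ‖ ^ 2 ∂arc ≤ N := hy
    -- The constant `6` is `2` from the convex combination plus `2 + 2` from the two masses.
    have hle : 2 * (t * (∫ θ, ‖x θ‖ ^ 2 ∂arc) + s * ∫ θ, ‖y θ‖ ^ 2 ∂arc) +
        2 * ((∫ θ, ‖x θ‖ ^ 2 ∂arc) + ∫ θ, ‖y θ‖ ^ 2 ∂arc) ≤ 6 * N := by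
      have h1 := mul_le_mul_of_nonneg_left hx' ht.le
      have h2 := mul_le_mul_of_nonneg_left hy' hs.le
      have h3 : t * N + s * N = N := by rw [← add_mul, hts, one_mul]
      linarith
    have := mul_le_mul_of_nonneg_left hle (show 0 ≤ t * s * B ^ 2 by positivity)
    linarith
  -- A bounded difference puts `x` and `y` in `L⁴` together. Outside `L⁴` both integrals on the left
  -- have the default value `0`.
  · have hiy : ¬ Integrable (fun θ => ‖y θ‖ ^ 4) arc := fun h =>
      hix (integrable_pow_four_of_sub_le hxy h)
    rw [integral_undef hix, integral_undef hiy]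
    have : 0 ≤ ∫ θ, ‖(t • x + s • y) θ‖ ^ 4 ∂arc := integral_nonneg fun θ => by positivity
    have : 0 ≤ t * s * (6 * N * B ^ 2) := by positivity
    linarith

/-! ### The supremum bound for the Cameron–Martin embedding -/

lemma hasSum_norm_invFreq_sq : HasSum (fun j => ‖invFreq j‖ ^ 2) (Real.pi ^ 2 / 3) := by
  have h0 : ∀ j : ℤ, ‖invFreq j‖ ^ 2 = 1 / (j : ℝ) ^ 2 := by
    intro j
    unfold invFreq
    split_ifs with h
    · simp [h]
    · simp [Complex.norm_intCast]
  simp only [h0]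
  have h1 := hasSum_zeta_two
  have h2 := (hasSum_nat_add_iff' 1).2 h1
  have h3 := HasSum.of_nat_of_neg_add_one (f := fun j : ℤ => 1 / (j : ℝ) ^ 2)
    (m := Real.pi ^ 2 / 6) (m' := Real.pi ^ 2 / 6) (by simpa using h1) (by
      simp only [Finset.range_one, Finset.sum_singleton, Nat.cast_zero] at h2
      have h4 : (fun n : ℕ => 1 / ((-((n : ℤ) + 1) : ℤ) : ℝ) ^ 2) =
          fun n : ℕ => 1 / ((n + 1 : ℕ) : ℝ) ^ 2 := by
        ext n; push_cast; rw [neg_sq]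
      rw [h4]
      rw [show Real.pi ^ 2 / 6 - 1 / (0 : ℝ) ^ 2 = Real.pi ^ 2 / 6 by simp] at h2
      exact h2)
  convert h3 using 1
  ring

/-- The Fourier series converges absolutely: `|c_j| / |j| ≤ (‖c‖ / 4) / j² + |c_j|² / ‖c‖` for `j ≠
0`. Summing gives `(π² / 12 + 1) ‖c‖`, and `π² ≤ 12`. -/
lemma norm_cmEmbed_apply_le (c : Seq) : ∀ᵐ θ ∂arc, ‖cmEmbed c θ‖ ≤ 2 * ‖c‖ := by
  rcases eq_or_ne c 0 with rfl | hc
  · filter_upwards [Lp.coeFn_zero ℂ 2 arc] with θ hθ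
    rw [map_zero, hθ]
    simp
  have hc : 0 < ‖c‖ := norm_pos_iff.2 hc
  have hb : HasSum (fun j => ‖c‖ / 4 * ‖invFreq j‖ ^ 2 + ‖c‖⁻¹ * ‖c j‖ ^ 2)
      (‖c‖ / 4 * (Real.pi ^ 2 / 3) + ‖c‖⁻¹ * ‖c‖ ^ 2) := by
    refine (hasSum_norm_invFreq_sq.mul_left _).add (HasSum.mul_left _ ?_)
    rw [Seq.norm_sq_eq]
    exact c.summable_norm_sq.hasSum
  have hle : ∀ j, ‖(invFreq j * c j) • (fourier j : C(Circ, ℂ))‖ ≤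
      ‖c‖ / 4 * ‖invFreq j‖ ^ 2 + ‖c‖⁻¹ * ‖c j‖ ^ 2 := by
    intro j
    rw [norm_smul, fourier_norm, mul_one, norm_mul]
    have h1 := sq_nonneg (‖c‖ / 2 * ‖invFreq j‖ - ‖c j‖)
    have h2 : ‖c‖ / 4 * ‖invFreq j‖ ^ 2 + ‖c‖⁻¹ * ‖c j‖ ^ 2 - ‖invFreq j‖ * ‖c j‖ =
        ‖c‖⁻¹ * (‖c‖ / 2 * ‖invFreq j‖ - ‖c j‖) ^ 2 := by
      field_simp
      ring
    have h3 : 0 ≤ ‖c‖⁻¹ * (‖c‖ / 2 * ‖invFreq j‖ - ‖c j‖) ^ 2 := by positivity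
    linarith
  have hs : Summable fun j => (invFreq j * c j) • (fourier j : C(Circ, ℂ)) :=
    Summable.of_norm_bounded hb.summable hle
  have hnorm : ‖∑' j, (invFreq j * c j) • (fourier j : C(Circ, ℂ))‖ ≤ 2 * ‖c‖ := by
    refine (tsum_of_norm_bounded hb hle).trans ?_
    have hpi : Real.pi ^ 2 ≤ 12 := by nlinarith [Real.pi_lt_d2, Real.pi_pos]
    rw [sq ‖c‖, inv_mul_cancel_left₀ hc.ne']
    nlinarith
  have heq : cmEmbed c = ContinuousMap.toLp 2 arc ℂ (∑' j, (invFreq j * c j) • (fourier j)) := by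
    refine (hasSum_cmEmbed c).unique ?_
    have := hs.hasSum.mapL (ContinuousMap.toLp (E := ℂ) 2 arc ℂ)
    simpa [fourierLp] using this
  rw [heq]
  filter_upwards [ContinuousMap.coeFn_toLp (p := 2) (𝕜 := ℂ) arc
    (∑' j, (invFreq j * c j) • (fourier j : C(Circ, ℂ)))] with θ hθ
  rw [hθ]
  exact (ContinuousMap.norm_coe_le_norm _ θ).trans hnorm

/-! ### The Gibbs measure is a probability measure -/

lemma brownianLoop_neg (γ : ℤ → ℝ × ℝ) : brownianLoop (-γ) = -brownianLoop γ := by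
  unfold brownianLoop
  rw [← tsum_neg]
  refine tsum_congr fun j => ?_
  rw [← neg_smul]
  congr 1
  simp only [loopCoeff_eq, toComplex, Pi.neg_apply, Prod.fst_neg, Prod.snd_neg]
  push_cast
  ring

lemma gaussianLaw_map_neg : gaussianLaw.map (fun γ => -γ) = gaussianLaw := by
  have h1 : (gaussianReal 0 1).map (fun x : ℝ => -x) = gaussianReal 0 1 := by
    rw [gaussianReal_map_neg, neg_zero]
  have h2 : ((gaussianReal 0 1).prod (gaussianReal 0 1)).map (fun p : ℝ × ℝ => -p) =
      (gaussianReal 0 1).prod (gaussianReal 0 1) := by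
    have := Measure.map_prod_map (gaussianReal 0 1) (gaussianReal 0 1)
      (f := fun x : ℝ => -x) (g := fun x : ℝ => -x) measurable_neg measurable_neg
    rw [h1] at this
    exact this.symm
  have h3 := Measure.infinitePi_map_pi
    (fun _ : ℤ => (gaussianReal 0 1).prod (gaussianReal 0 1))
    (f := fun _ => fun p : ℝ × ℝ => -p) (fun _ => measurable_neg)
  simp only [h2] at h3
  exact h3

lemma loopMeasure_map_neg : loopMeasure.map (fun u => -u) = loopMeasure := by
  unfold loopMeasure
  rw [Measure.map_map measurable_neg measurable_brownianLoop]
  conv_rhs => rw [← gaussianLaw_map_neg, Measure.map_map measurable_brownianLoop measurable_neg]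
  congr 1
  ext1 γ
  exact (brownianLoop_neg γ).symm

/-- An Anderson-type inequality: the midpoint of the balls about `h` and `-h` lies in the ball about
`0`, and the two outer balls have equal measure by symmetry. -/
lemma loopMeasure_closedBall_le (h : LTwo) (r : ℝ) :
    loopMeasure (Metric.closedBall h r) ≤ loopMeasure (Metric.closedBall 0 r) := by
  have hmeas : ∀ x : LTwo, MeasurableSet (Metric.closedBall x r) := fun x =>
    Metric.isClosed_closedBall.measurableSet
  have hsymm : loopMeasure (Metric.closedBall (-h) r) = loopMeasure (Metric.closedBall h r) := by
    conv_lhs => rw [← loopMeasure_map_neg, Measure.map_apply measurable_neg (hmeas _)]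
    congr 1
    ext u
    simp only [Set.mem_preimage, Metric.mem_closedBall, dist_neg_neg]
  have key := prekopaLeindler_loopMeasure (t := 1 / 2) (s := 1 / 2) (by norm_num) (by norm_num)
    (by norm_num) (u := (Metric.closedBall h r).indicator 1)
    (v := (Metric.closedBall (-h) r).indicator 1) (w := (Metric.closedBall 0 r).indicator 1)
    (measurable_one.indicator (hmeas _)) (measurable_one.indicator (hmeas _))
    (measurable_one.indicator (hmeas _)) (fun z c => by
      by_cases h1 : z + (1 / 2 : ℝ) • cmEmbed c ∈ Metric.closedBall h r
      · by_cases h2 : z - (1 / 2 : ℝ) • cmEmbed c ∈ Metric.closedBall (-h) r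
        · have h3 : z ∈ Metric.closedBall 0 r := by
            rw [mem_closedBall_iff_norm] at h1 h2
            rw [mem_closedBall_zero_iff]
            have h4 : (2 : ℝ) • z = (z + (1 / 2 : ℝ) • cmEmbed c - h) +
                (z - (1 / 2 : ℝ) • cmEmbed c - -h) := by
              rw [two_smul]; abel
            have h5 : 2 * ‖z‖ ≤ r + r := by
              calc 2 * ‖z‖ = ‖(2 : ℝ) • z‖ := by rw [norm_smul]; simp
                _ ≤ _ := by rw [h4]; exact norm_add_le_of_le h1 h2
            linarith
          rw [Set.indicator_of_mem h1, Set.indicator_of_mem h2, Set.indicator_of_mem h3]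
          simp only [Pi.one_apply, ENNReal.one_rpow, one_mul, ENNReal.ofReal_le_one,
            Real.exp_le_one_iff]
          have : 0 ≤ ‖c‖ ^ 2 := by positivity
          linarith
        · rw [Set.indicator_of_notMem h2]
          simp
      · rw [Set.indicator_of_notMem h1]
        simp)
  rw [lintegral_indicator_one (hmeas _), lintegral_indicator_one (hmeas _),
    lintegral_indicator_one (hmeas _), hsymm,
    rpow_mul_rpow_self (by norm_num) (by norm_num) (by norm_num)] at key
  exact key

instance fact_two_ne_top : Fact ((2 : ℝ≥0∞) ≠ ∞) := ⟨ENNReal.ofNat_ne_top⟩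

instance : SecondCountableTopology LTwo := inferInstance

instance : TopologicalSpace.SeparableSpace Seq :=
  (fourierBasis (T := 2 * Real.pi)).repr.toHomeomorph.surjective.denseRange.separableSpace
    (fourierBasis (T := 2 * Real.pi)).repr.continuous

/-- If the centred ball were null, so would be every ball of that radius, and countably many of them
cover the separable space `L²`. -/
lemma loopMeasure_ball_pos {N : ℝ} (hN : 0 < N) : 0 < loopMeasure (Ball N) := by
  rw [ball_eq_closedBall hN.le]
  by_contra! h
  have hr : 0 < √N := Real.sqrt_pos.2 hN
  have h0 : ∀ x : LTwo, loopMeasure (Metric.closedBall x (√N)) = 0 := fun x =>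
    le_antisymm ((loopMeasure_closedBall_le x _).trans h) zero_le
  have hcov : (Set.univ : Set LTwo) ⊆
      ⋃ n, Metric.closedBall (TopologicalSpace.denseSeq LTwo n) (√N) := by
    intro x _
    obtain ⟨n, hn⟩ := (TopologicalSpace.denseRange_denseSeq LTwo).exists_dist_lt x hr
    exact Set.mem_iUnion.2 ⟨n, hn.le⟩
  have h1 := measure_mono_null hcov (measure_iUnion_null fun n => h0 _)
  simp at h1

lemma norm_sub_le_of_sub_eq_cmEmbed {x y : LTwo} {c : Seq} (h : x - y = cmEmbed c) :
    ∀ᵐ θ ∂arc, ‖x θ - y θ‖ ≤ 2 * ‖c‖ := by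
  filter_upwards [Lp.coeFn_sub x y, norm_cmEmbed_apply_le c] with θ h1 h2
  rw [h] at h1
  rw [← Pi.sub_apply, ← h1]
  exact h2

lemma integrable_pow_four_of_quartic_ne_top {x : LTwo} (hx : quartic x ≠ ∞) :
    Integrable (fun θ => ‖x θ‖ ^ 4) arc := by
  refine ⟨(Lp.aestronglyMeasurable x).norm.pow 4, ?_⟩
  rw [hasFiniteIntegral_iff_enorm]
  refine lt_of_eq_of_lt ?_ hx.lt_top
  refine lintegral_congr fun θ => ?_
  rw [enorm_pow, enorm_norm]

/-- From `|x|² ≤ 2 |y|² + 2 B²`, multiplied by `|x|²`, with `2 |x|² |y|² ≤ |x|⁴ / 2 + 2 |y|⁴`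
absorbed. Thus `B` enters only quadratically, which the Gaussian cost can beat. -/
lemma integral_pow_four_le {N B : ℝ} {x y : LTwo} (hx : x ∈ Ball N) (hqx : quartic x ≠ ∞)
    (hqy : quartic y ≠ ∞) (hB : ∀ᵐ θ ∂arc, ‖x θ - y θ‖ ≤ B) :
    ∫ θ, ‖x θ‖ ^ 4 ∂arc ≤ 4 * B ^ 2 * N + 4 * (quartic y).toReal := by
  have hix := integrable_pow_four_of_quartic_ne_top hqx
  have hiy := integrable_pow_four_of_quartic_ne_top hqy
  have h2x := integrable_norm_sq x
  have hx' : ∫ θ, ‖x θ‖ ^ 2 ∂arc ≤ N := hx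
  calc ∫ θ, ‖x θ‖ ^ 4 ∂arc ≤ ∫ θ, (4 * B ^ 2 * ‖x θ‖ ^ 2 + 4 * ‖y θ‖ ^ 4) ∂arc := by
        refine integral_mono_ae hix ((h2x.const_mul _).add (hiy.const_mul _)) ?_
        filter_upwards [hB] with θ hθ
        have h1 : ‖x θ‖ ≤ ‖y θ‖ + B := by
          calc ‖x θ‖ = ‖y θ + (x θ - y θ)‖ := by congr 1; ring
            _ ≤ _ := (norm_add_le _ _).trans (by gcongr)
        have h2 : ‖x θ‖ ^ 2 ≤ 2 * ‖y θ‖ ^ 2 + 2 * B ^ 2 := by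
          have h3 : ‖x θ‖ ^ 2 ≤ (‖y θ‖ + B) ^ 2 := by gcongr
          nlinarith [sq_nonneg (‖y θ‖ - B)]
        have h4 := mul_le_mul_of_nonneg_left h2 (sq_nonneg ‖x θ‖)
        nlinarith [sq_nonneg (‖x θ‖ ^ 2 - 2 * ‖y θ‖ ^ 2)]
    _ = 4 * B ^ 2 * (∫ θ, ‖x θ‖ ^ 2 ∂arc) + 4 * (quartic y).toReal := by
        rw [integral_add (h2x.const_mul _) (hiy.const_mul _), integral_const_mul,
          integral_const_mul, integral_norm_pow_four y]
    _ ≤ _ := by gcongr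

/-- The weight is paired at `t = s = 1/2` with the indicator of a set of positive measure on which
the quartic is at most `r`. The exponent gains at most `2 λ N ‖c‖² + λ r / 2` and the cost is `‖c‖²
/ 8`; this is where `1 / 16` comes from. -/
lemma partitionFunction_ne_top {N lam : ℝ} (hlam : 0 ≤ lam)
    (h1 : lam * N ≤ 1 / 16) : partitionFunction N lam ≠ ∞ := by
  set A : Set LTwo := {u | u ∈ Ball N ∧ quartic u ≠ ∞} with hA
  set A' : ℕ → Set LTwo := fun r => {u | u ∈ Ball N ∧ quartic u ≤ r} with hA'
  have hAm : MeasurableSet A := (measurableSet_ball N).inter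
    (measurable_quartic (measurableSet_singleton ∞).compl)
  have hA'm : ∀ r, MeasurableSet (A' r) := fun r => (measurableSet_ball N).inter
    (measurable_quartic measurableSet_Iic)
  have hAU : A = ⋃ r, A' r := by
    ext u
    simp only [hA, hA', Set.mem_ofPred_eq, Set.mem_iUnion, exists_and_left, and_congr_right_iff]
    intro _
    constructor
    · intro h
      obtain ⟨r, hr⟩ := ENNReal.exists_nat_gt h
      exact ⟨r, hr.le⟩
    · rintro ⟨r, hr⟩
      exact ne_top_of_le_ne_top (ENNReal.natCast_ne_top r) hr
  have hfin : ∫⁻ u in A, weight lam u ∂loopMeasure ≠ ∞ := by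
    rcases eq_or_ne (loopMeasure A) 0 with h0 | h0
    · rw [setLIntegral_measure_zero _ _ h0]; exact ENNReal.zero_ne_top
    obtain ⟨r, hr⟩ : ∃ r, loopMeasure (A' r) ≠ 0 := by
      by_contra! h
      exact h0 (hAU ▸ measure_iUnion_null h)
    have key := prekopaLeindler_loopMeasure (t := 1 / 2) (s := 1 / 2) (by norm_num) (by norm_num)
      (by norm_num) (u := A.indicator (weight lam)) (v := (A' r).indicator 1)
      (w := fun _ => ENNReal.ofReal (Real.exp (lam * r / 2)))
      ((measurable_weight lam).indicator hAm) (measurable_one.indicator (hA'm r))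
      measurable_const (fun z c => by
        by_cases hx : z + (1 / 2 : ℝ) • cmEmbed c ∈ A
        · by_cases hy : z - (1 / 2 : ℝ) • cmEmbed c ∈ A' r
          · rw [Set.indicator_of_mem hx, Set.indicator_of_mem hy, Pi.one_apply, ENNReal.one_rpow,
              mul_one, weight, ENNReal.ofReal_rpow_of_pos (Real.exp_pos _), ← Real.exp_mul,
              ← ENNReal.ofReal_mul (Real.exp_pos _).le, ← Real.exp_add]
            refine ENNReal.ofReal_le_ofReal (Real.exp_le_exp.2 ?_)
            have hsub : (z + (1 / 2 : ℝ) • cmEmbed c) - (z - (1 / 2 : ℝ) • cmEmbed c) =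
                cmEmbed c := by module
            have hb := integral_pow_four_le hx.1 hx.2
              (ne_top_of_le_ne_top (ENNReal.natCast_ne_top r) hy.2)
              (norm_sub_le_of_sub_eq_cmEmbed hsub)
            have hqr : (quartic (z - (1 / 2 : ℝ) • cmEmbed c)).toReal ≤ r :=
              ENNReal.toReal_le_of_le_ofReal (Nat.cast_nonneg r) (by simpa using hy.2)
            have h2 : ∫ θ, ‖(z + (1 / 2 : ℝ) • cmEmbed c : LTwo) θ‖ ^ 4 ∂arc ≤
                16 * N * ‖c‖ ^ 2 + 4 * r := by nlinarith
            have h3 := mul_le_mul_of_nonneg_left h2 hlam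
            have h4 := mul_le_mul_of_nonneg_right h1 (sq_nonneg ‖c‖)
            nlinarith
          · rw [Set.indicator_of_notMem hy]
            simp
        · rw [Set.indicator_of_notMem hx]
          simp)
    rw [lintegral_indicator hAm, lintegral_indicator_one (hA'm r), lintegral_const,
      measure_univ, mul_one] at key
    intro htop
    rw [htop, ENNReal.top_rpow_of_pos (by norm_num), ENNReal.top_mul] at key
    · exact absurd key (by simp)
    · simp [ENNReal.rpow_eq_zero_iff, hr]
  have hsplit : Ball N = A ∪ (Ball N \ A) := by
    rw [Set.union_sdiff_cancel]
    exact fun u hu => hu.1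
  have hle : partitionFunction N lam ≤ (∫⁻ u in A, weight lam u ∂loopMeasure) +
      ∫⁻ u in Ball N \ A, weight lam u ∂loopMeasure := by
    rw [partitionFunction]
    conv_lhs => rw [hsplit]
    exact lintegral_union_le _ _ _
  refine ne_top_of_le_ne_top (ENNReal.add_ne_top.2 ⟨hfin, ?_⟩) hle
  -- Outside `L⁴` the Bochner integral in the weight is `0`, so the weight is `1`.
  rw [setLIntegral_congr_fun (g := fun _ => 1) ((measurableSet_ball N).diff hAm)]
  · rw [setLIntegral_const, one_mul]
    exact measure_ne_top _ _
  · intro u hu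
    have hq : quartic u = ∞ := by
      by_contra h
      exact hu.2 ⟨hu.1, h⟩
    simp only
    rw [weight, integral_norm_pow_four, hq]
    simp

lemma one_le_weight {lam : ℝ} (hlam : 0 ≤ lam) (u : LTwo) : 1 ≤ weight lam u := by
  rw [weight, ENNReal.one_le_ofReal, Real.one_le_exp_iff]
  have : 0 ≤ ∫ θ, ‖u θ‖ ^ 4 ∂arc := integral_nonneg fun θ => by positivity
  positivity

lemma partitionFunction_ne_zero {N lam : ℝ} (hN : 0 < N) (hlam : 0 ≤ lam) :
    partitionFunction N lam ≠ 0 := by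
  refine ((loopMeasure_ball_pos hN).trans_le ?_).ne'
  rw [← setLIntegral_one]
  exact lintegral_mono fun u => one_le_weight hlam u

lemma lintegral_gibbs {N lam : ℝ} {f : LTwo → ℝ≥0∞} (hf : Measurable f) :
    ∫⁻ u, f u ∂gibbs N lam =
      (partitionFunction N lam)⁻¹ * ∫⁻ u in Ball N, weight lam u * f u ∂loopMeasure := by
  rw [gibbs, lintegral_smul_measure,
    lintegral_withDensity_eq_lintegral_mul _ (measurable_weight lam) hf]
  rfl

lemma isProbabilityMeasure_gibbs {N lam : ℝ} (hN : 0 < N) (hlam : 0 ≤ lam)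
    (h1 : lam * N ≤ 1 / 16) : IsProbabilityMeasure (gibbs N lam) := by
  refine ⟨?_⟩
  have h := lintegral_gibbs (N := N) (lam := lam) (measurable_const (a := (1 : ℝ≥0∞)))
  simp only [lintegral_one, mul_one] at h
  rw [h]
  exact ENNReal.inv_mul_cancel (partitionFunction_ne_zero hN hlam)
    (partitionFunction_ne_top hlam h1)

lemma ae_mem_ball_gibbs (N lam : ℝ) : ∀ᵐ u ∂gibbs N lam, u ∈ Ball N := by
  refine Measure.ae_smul_measure ?_ _
  exact (withDensity_absolutelyContinuous _ _).ae_le (ae_restrict_mem (measurableSet_ball N))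

/-! ### Sup-convolution along the Cameron–Martin space -/

/-- The exponential of the sup-convolution `sup_c (g (z + cmEmbed c) - κ ‖c‖² / 2)` over points of
the ball, computed on a countable dense set of directions. -/
def supConv (N κ : ℝ) (g : LTwo → ℝ) (z : LTwo) : ℝ≥0∞ :=
  open scoped Classical in
  ENNReal.ofReal (Real.exp (g z)) ⊔ ⨆ n : ℕ,
    if z + cmEmbed (TopologicalSpace.denseSeq Seq n) ∈ Ball N then
      ENNReal.ofReal (Real.exp (g (z + cmEmbed (TopologicalSpace.denseSeq Seq n)) -
        κ / 2 * ‖TopologicalSpace.denseSeq Seq n‖ ^ 2))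
    else 0

lemma measurable_supConv (N κ : ℝ) {g : LTwo → ℝ} (hg : Measurable g) :
    Measurable (supConv N κ g) := by
  unfold supConv
  refine hg.exp.ennreal_ofReal.sup (Measurable.iSup fun n => ?_)
  have hm : Measurable fun z : LTwo => z + cmEmbed (TopologicalSpace.denseSeq Seq n) :=
    (continuous_id.add continuous_const).measurable
  refine Measurable.ite (hm (measurableSet_ball N)) ?_ measurable_const
  exact ((hg.comp hm).sub measurable_const).exp.ennreal_ofReal

lemma le_supConv_self (N κ : ℝ) (g : LTwo → ℝ) (z : LTwo) :
    ENNReal.ofReal (Real.exp (g z)) ≤ supConv N κ g z := le_sup_left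

lemma supConv_le {N κ : ℝ} {g : LTwo → ℝ} {z : LTwo} {y : ℝ} (hy : 0 ≤ y)
    (h : ∀ c, z + cmEmbed c ∈ Ball N → g (z + cmEmbed c) - κ / 2 * ‖c‖ ^ 2 ≤ g z + y) :
    supConv N κ g z ≤ ENNReal.ofReal (Real.exp (g z + y)) := by
  refine sup_le (ENNReal.ofReal_le_ofReal (Real.exp_le_exp.2 (by linarith))) (iSup_le fun n => ?_)
  split_ifs with hn
  · exact ENNReal.ofReal_le_ofReal (Real.exp_le_exp.2 (h _ hn))
  · exact zero_le

/-- `g` is Lipschitz with constant `L` on the ball, along the Cameron–Martin space. -/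
def CMLipschitz (N L : ℝ) (g : LTwo → ℝ) : Prop :=
  ∀ x ∈ Ball N, ∀ c, x + cmEmbed c ∈ Ball N → |g (x + cmEmbed c) - g x| ≤ L * ‖c‖

/-- At the point `z` of the ball, the slope of `g` along the Cameron–Martin space is at most `a`. -/
def CMSlopeLE (N : ℝ) (g : LTwo → ℝ) (z : LTwo) (a : ℝ) : Prop :=
  ∀ ε > 0, ∃ δ > 0, ∀ c, ‖c‖ < δ → z + cmEmbed c ∈ Ball N →
    |g (z + cmEmbed c) - g z| ≤ (a + ε) * ‖c‖

/-- The endpoint may lie on the sphere, where nearby directions can leave the ball. Strict convexity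
moves it inside by shrinking `c` slightly, and an open set of directions meets the dense sequence.
-/
lemma exists_denseSeq_near {N : ℝ} (hN : 0 ≤ N) {z : LTwo} (hz : z ∈ Ball N) {c : Seq}
    (hc : z + cmEmbed c ∈ Ball N) (hc0 : cmEmbed c ≠ 0) {δ : ℝ} (hδ : 0 < δ) :
    ∃ n, z + cmEmbed (TopologicalSpace.denseSeq Seq n) ∈ Ball N ∧
      ‖TopologicalSpace.denseSeq Seq n - c‖ < δ := by
  set U : Set Seq := {d | z + cmEmbed d ∈ interior (Ball N)} ∩ Metric.ball c δ with hU
  have hUo : IsOpen U := (isOpen_interior.preimage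
    (continuous_const.add cmEmbed.continuous)).inter Metric.isOpen_ball
  have hUne : U.Nonempty := by
    set η : ℝ := min (1 / 2) (δ / (2 * (‖c‖ + 1))) with hη
    have hη0 : 0 < η := lt_min (by norm_num) (by positivity)
    have hη1 : η < 1 := (min_le_left _ _).trans_lt (by norm_num)
    refine ⟨(1 - η) • c, ?_, ?_⟩
    · have hsc : StrictConvex ℝ (Ball N) := by
        rw [ball_eq_closedBall hN]
        exact strictConvex_closedBall ℝ _ _
      have := hsc hz hc (fun h => hc0 (by simpa using h.symm)) hη0 (sub_pos.2 hη1) (by ring)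
      have heq : z + cmEmbed ((1 - η) • c) = η • z + (1 - η) • (z + cmEmbed c) := by
        rw [cmEmbed.map_smul_of_tower]
        module
      rw [Set.mem_ofPred_eq, heq]
      exact this
    · rw [mem_ball_iff_norm]
      have h1 : (1 - η) • c - c = -(η • c) := by module
      rw [h1, norm_neg, norm_smul, Real.norm_of_nonneg hη0.le]
      calc η * ‖c‖ ≤ δ / (2 * (‖c‖ + 1)) * ‖c‖ := by gcongr; exact min_le_right _ _
        _ < δ := by
          rw [div_mul_eq_mul_div, div_lt_iff₀ (by positivity)]
          nlinarith [norm_nonneg c]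
  obtain ⟨n, hn⟩ := (TopologicalSpace.denseRange_denseSeq Seq).exists_mem_open hUo hUne
  exact ⟨n, interior_subset hn.1, mem_ball_iff_norm.1 hn.2⟩

/-- The countable supremum, chosen for measurability, dominates every admissible direction, since
`g` varies little along a small change of direction. The case `cmEmbed c = 0` is separate because
strict convexity needs two distinct points. -/
lemma le_supConv {N κ L : ℝ} (hN : 0 ≤ N) (hκ : 0 ≤ κ) {g : LTwo → ℝ} (hL : CMLipschitz N L g)
    {z : LTwo} (hz : z ∈ Ball N) {c : Seq} (hc : z + cmEmbed c ∈ Ball N) :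
    ENNReal.ofReal (Real.exp (g (z + cmEmbed c) - κ / 2 * ‖c‖ ^ 2)) ≤ supConv N κ g z := by
  by_cases hc0 : cmEmbed c = 0
  · refine le_trans (ENNReal.ofReal_le_ofReal (Real.exp_le_exp.2 ?_)) (le_supConv_self N κ g z)
    rw [hc0, add_zero]
    have : 0 ≤ κ / 2 * ‖c‖ ^ 2 := by positivity
    linarith
  have hcont : Tendsto (fun d : Seq => L * ‖d - c‖ + κ / 2 * (‖d‖ ^ 2 - ‖c‖ ^ 2)) (𝓝 c) (𝓝 0) := by
    have : Continuous fun d : Seq => L * ‖d - c‖ + κ / 2 * (‖d‖ ^ 2 - ‖c‖ ^ 2) := by fun_prop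
    have h := this.tendsto c
    simpa using h
  have key : ∀ ε : ℝ, 0 < ε →
      ENNReal.ofReal (Real.exp (g (z + cmEmbed c) - κ / 2 * ‖c‖ ^ 2 - ε)) ≤ supConv N κ g z := by
    intro ε hε
    obtain ⟨δ, hδ, hδ'⟩ := Metric.eventually_nhds_iff.1 (hcont.eventually (gt_mem_nhds hε))
    obtain ⟨n, hn, hnc⟩ := exists_denseSeq_near hN hz hc hc0 hδ
    set d := TopologicalSpace.denseSeq Seq n with hd
    have h1 := hδ' (by rwa [dist_eq_norm])
    have h2 := hL _ hc (d - c) (by simpa [map_sub] using hn)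
    have h3 : z + cmEmbed c + cmEmbed (d - c) = z + cmEmbed d := by rw [map_sub]; abel
    rw [h3] at h2
    have h4 := (abs_le.1 h2).1
    refine le_trans ?_ (le_sup_of_le_right (le_iSup _ n))
    rw [if_pos hn]
    exact ENNReal.ofReal_le_ofReal (Real.exp_le_exp.2 (by linarith))
  have hlim : Tendsto (fun ε : ℝ =>
      ENNReal.ofReal (Real.exp (g (z + cmEmbed c) - κ / 2 * ‖c‖ ^ 2 - ε))) (𝓝[>] 0)
      (𝓝 (ENNReal.ofReal (Real.exp (g (z + cmEmbed c) - κ / 2 * ‖c‖ ^ 2 - 0)))) := by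
    have hc : Continuous fun ε : ℝ =>
      ENNReal.ofReal (Real.exp (g (z + cmEmbed c) - κ / 2 * ‖c‖ ^ 2 - ε)) :=
      ENNReal.continuous_ofReal.comp (by fun_prop)
    exact (hc.tendsto 0).mono_left nhdsWithin_le_nhds
  rw [sub_zero] at hlim
  exact le_of_tendsto hlim (eventually_nhdsWithin_of_forall fun ε hε => key ε hε)

/-- The Prékopa–Leindler inequality for the Gibbs measure. -/
theorem gibbs_prekopaLeindler {N lam α L t s : ℝ} (hN : 0 < N) (hlam : 0 ≤ lam)
    (h1 : lam * N ≤ 1 / 16) (hα : 0 < α) (hαle : 12 * (lam * N) ≤ 1 - α)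
    (ht : 0 < t) (hs : 0 < s) (hts : t + s = 1) {g : LTwo → ℝ} (hg : Measurable g)
    (hL : CMLipschitz N L g) :
    (∫⁻ z, ENNReal.ofReal (Real.exp (g z / t)) ∂gibbs N lam) ^ t ≤
      ∫⁻ z, supConv N (α * t / s) g z ∂gibbs N lam := by
  have hBm := measurableSet_ball N
  have hWm := measurable_weight lam
  have hem : Measurable fun z => ENNReal.ofReal (Real.exp (g z / t)) :=
    (hg.div_const t).exp.ennreal_ofReal
  have hsm := measurable_supConv N (α * t / s) hg
  have key := prekopaLeindler_loopMeasure ht hs hts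
    (u := (Ball N).indicator fun z => weight lam z * ENNReal.ofReal (Real.exp (g z / t)))
    (v := (Ball N).indicator (weight lam))
    (w := (Ball N).indicator fun z => weight lam z * supConv N (α * t / s) g z)
    ((hWm.mul hem).indicator hBm) (hWm.indicator hBm) ((hWm.mul hsm).indicator hBm)
    (fun z c => by
      set x := z + s • cmEmbed c with hx
      set y := z - t • cmEmbed c with hy
      by_cases hxB : x ∈ Ball N
      swap
      · rw [Set.indicator_of_notMem hxB, ENNReal.zero_rpow_of_pos ht]
        simp
      by_cases hyB : y ∈ Ball N
      swap
      · rw [Set.indicator_of_notMem hyB, ENNReal.zero_rpow_of_pos hs]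
        simp
      have hzxy : z = t • x + s • y := by
        obtain rfl : t = 1 - s := by linarith
        rw [hx, hy]; module
      have hzB : z ∈ Ball N := hzxy ▸ convex_ball hN.le hxB hyB ht.le hs.le hts
      have hxy : x - y = cmEmbed c := by
        obtain rfl : t = 1 - s := by linarith
        rw [hx, hy]; module
      -- Seen from `z`, the point `x` lies in direction `s • c`; with `κ = α t / s` the penalty is
      -- `α t s ‖c‖² / 2`.
      have hsup := le_supConv (κ := α * t / s) hN.le (by positivity) hL hzB (c := s • c)
        (by rw [cmEmbed.map_smul_of_tower]; exact hxB)
      rw [cmEmbed.map_smul_of_tower, ← hx] at hsup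
      rw [Set.indicator_of_mem hxB, Set.indicator_of_mem hyB, Set.indicator_of_mem hzB]
      refine le_trans ?_ (mul_le_mul' le_rfl hsup)
      simp only [weight]
      rw [← ENNReal.ofReal_mul (Real.exp_pos _).le, ← Real.exp_add,
        ENNReal.ofReal_rpow_of_pos (Real.exp_pos _), ENNReal.ofReal_rpow_of_pos (Real.exp_pos _),
        ← Real.exp_mul, ← Real.exp_mul, ← ENNReal.ofReal_mul (Real.exp_pos _).le, ← Real.exp_add,
        ← ENNReal.ofReal_mul (Real.exp_pos _).le, ← Real.exp_add,
        ← ENNReal.ofReal_mul (Real.exp_pos _).le, ← Real.exp_add]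
      refine ENNReal.ofReal_le_ofReal (Real.exp_le_exp.2 ?_)
      have hdef := quartic_convexity_defect ht hs hts hxB hyB (norm_sub_le_of_sub_eq_cmEmbed hxy)
      rw [← hzxy] at hdef
      have h2 := mul_le_mul_of_nonneg_left hdef (show 0 ≤ lam / 4 by positivity)
      have h3 : α * t / s / 2 * ‖s • c‖ ^ 2 = α * (t * s / 2 * ‖c‖ ^ 2) := by
        rw [norm_smul, Real.norm_of_nonneg hs.le]
        field_simp
      have h4 : (lam / 4 * (∫ θ, ‖x θ‖ ^ 4 ∂arc) + g x / t) * t =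
          lam / 4 * (t * ∫ θ, ‖x θ‖ ^ 4 ∂arc) + g x := by field_simp
      have h5 := mul_le_mul_of_nonneg_right hαle (show 0 ≤ t * s / 2 * ‖c‖ ^ 2 by positivity)
      rw [h3, h4]
      nlinarith)
  rw [lintegral_indicator hBm, lintegral_indicator hBm, lintegral_indicator hBm] at key
  rw [lintegral_gibbs hem, lintegral_gibbs hsm]
  change _ * (partitionFunction N lam) ^ s ≤ _ at key
  set Z := partitionFunction N lam with hZ
  have hZ0 : Z ≠ 0 := partitionFunction_ne_zero hN hlam
  have hZt : Z ≠ ∞ := partitionFunction_ne_top hlam h1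
  -- Only the factor with exponent `t` contains `g`; the other is `Z ^ s`, which the normalization
  -- turns into `1`.
  have hZs : Z⁻¹ ^ t = Z⁻¹ * Z ^ s := by
    have h6 : Z⁻¹ ^ t * Z⁻¹ ^ s = Z⁻¹ := rpow_mul_rpow_self ht hs hts _
    nth_rewrite 2 [← h6]
    rw [mul_assoc, ← ENNReal.mul_rpow_of_nonneg _ _ hs.le, ENNReal.inv_mul_cancel hZ0 hZt,
      ENNReal.one_rpow, mul_one]
  rw [ENNReal.mul_rpow_of_nonneg _ _ ht.le, hZs, mul_assoc, mul_comm (Z ^ s)]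
  gcongr

/-! ### The entropy inequality for bounded Lipschitz functions -/

/-- Jensen's inequality for the tilted measure, in the form of a tangent line inequality for
`s ↦ (∫ exp (g / (1 - s))) ^ (1 - s)` at `s = 0`. -/
lemma add_mul_entropy_le {Ω : Type*} [MeasurableSpace Ω] {ν : Measure Ω} [IsProbabilityMeasure ν]
    {g : Ω → ℝ} (hg : Measurable g) {M : ℝ} (hM : ∀ z, |g z| ≤ M) {t s : ℝ} (ht : 0 < t)
    (hs : 0 < s) (hts : t + s = 1) :
    ∫ z, Real.exp (g z) ∂ν + s * ((∫ z, g z * Real.exp (g z) ∂ν) -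
      (∫ z, Real.exp (g z) ∂ν) * Real.log (∫ z, Real.exp (g z) ∂ν)) ≤
      (∫ z, Real.exp (g z / t) ∂ν) ^ t := by
  have hi1 : Integrable (fun z => Real.exp (g z)) ν :=
    Integrable.of_bound hg.exp.aestronglyMeasurable (Real.exp M) (Eventually.of_forall fun z => by
      rw [Real.norm_of_nonneg (Real.exp_pos _).le]
      exact Real.exp_le_exp.2 (abs_le.1 (hM z)).2)
  have hi2 : Integrable (fun z => g z * Real.exp (g z)) ν :=
    hi1.bdd_mul hg.aestronglyMeasurable (Eventually.of_forall hM)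
  have hi3 : Integrable (fun z => Real.exp (g z / t)) ν :=
    Integrable.of_bound (hg.div_const t).exp.aestronglyMeasurable (Real.exp (M / t))
      (Eventually.of_forall fun z => by
        rw [Real.norm_of_nonneg (Real.exp_pos _).le]
        gcongr
        exact (abs_le.1 (hM z)).2)
  set I := ∫ z, Real.exp (g z) ∂ν with hI
  set K := ∫ z, g z * Real.exp (g z) ∂ν with hK
  have hIpos : 0 < I := integral_exp_pos hi1
  set θ := K / I with hθ
  have hlow : I * Real.exp (s / t * θ) ≤ ∫ z, Real.exp (g z / t) ∂ν := by
    -- The tangent line of the exponential at `θ`, the mean of `g` under the probability with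
    -- density `exp g / I`.
    have hpt : ∀ z, Real.exp (s / t * θ) * (1 - s / t * θ) * Real.exp (g z) +
        Real.exp (s / t * θ) * (s / t) * (g z * Real.exp (g z)) ≤ Real.exp (g z / t) := by
      intro z
      have h1 : g z / t = s / t * θ + (s / t * (g z - θ) + g z) := by
        obtain rfl : s = 1 - t := by linarith
        field_simp
        ring
      have h2 := Real.add_one_le_exp (s / t * (g z - θ))
      rw [h1, Real.exp_add, Real.exp_add]
      have h3 : Real.exp (s / t * θ) * ((s / t * (g z - θ) + 1) * Real.exp (g z)) ≤
          Real.exp (s / t * θ) * (Real.exp (s / t * (g z - θ)) * Real.exp (g z)) := by gcongr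
      refine le_trans (le_of_eq ?_) h3
      ring
    have h4 := integral_mono ((hi1.const_mul _).add (hi2.const_mul _)) hi3 hpt
    simp only [Pi.add_apply] at h4
    rw [integral_add (hi1.const_mul _) (hi2.const_mul _), integral_const_mul,
      integral_const_mul, ← hI, ← hK] at h4
    refine le_trans (le_of_eq ?_) h4
    have h5 : K = θ * I := by rw [hθ, div_mul_cancel₀ _ hIpos.ne']
    rw [h5]
    ring
  have h6 : (I * Real.exp (s / t * θ)) ^ t ≤ (∫ z, Real.exp (g z / t) ∂ν) ^ t :=
    Real.rpow_le_rpow (by positivity) hlow ht.le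
  refine le_trans ?_ h6
  have h7 : (I * Real.exp (s / t * θ)) ^ t = I * Real.exp (s * (θ - Real.log I)) := by
    rw [Real.mul_rpow hIpos.le (Real.exp_pos _).le, ← Real.exp_mul, Real.rpow_def_of_pos hIpos,
      ← Real.exp_add]
    nth_rewrite 2 [← Real.exp_log hIpos]
    rw [← Real.exp_add]
    congr 1
    obtain rfl : s = 1 - t := by linarith
    field_simp
    ring
  rw [h7]
  have h8 := mul_le_mul_of_nonneg_left (Real.add_one_le_exp (s * (θ - Real.log I))) hIpos.le
  refine le_trans (le_of_eq ?_) h8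
  have h5 : K = θ * I := by rw [hθ, div_mul_cancel₀ _ hIpos.ne']
  rw [h5]
  ring

lemma exp_sub_one_le_mul_exp (y : ℝ) : Real.exp y - 1 ≤ y * Real.exp y := by
  have h := mul_le_mul_of_nonneg_left (Real.add_one_le_exp (-y)) (Real.exp_pos y).le
  rw [← Real.exp_add, add_neg_cancel, Real.exp_zero] at h
  linarith

lemma CMLipschitz.supConv_le {N L κ : ℝ} (hκ : 0 < κ) {g : LTwo → ℝ} (hL : CMLipschitz N L g)
    {z : LTwo} (hz : z ∈ Ball N) :
    supConv N κ g z ≤ ENNReal.ofReal (Real.exp (g z + L ^ 2 / (2 * κ))) := by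
  refine NLSGibbs.supConv_le (by positivity) fun c hc => ?_
  have h1 := (abs_le.1 (hL z hz c hc)).2
  have h2 : L * ‖c‖ - κ / 2 * ‖c‖ ^ 2 ≤ L ^ 2 / (2 * κ) := by
    rw [le_div_iff₀ (by positivity)]
    nlinarith [sq_nonneg (L - κ * ‖c‖)]
  linarith

/-- For `κ ≥ 2 L / δ` the penalty outweighs the Lipschitz growth beyond distance `δ`, so only
directions governed by the slope at `z` count. -/
lemma CMSlopeLE.eventually_supConv_le {N L a ε : ℝ} {g : LTwo → ℝ} (hL : CMLipschitz N L g)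
    {z : LTwo} (hz : z ∈ Ball N) (h : CMSlopeLE N g z a) (hε : 0 < ε) :
    ∀ᶠ κ in atTop, supConv N κ g z ≤ ENNReal.ofReal (Real.exp (g z + (a + ε) ^ 2 / (2 * κ))) := by
  obtain ⟨δ, hδ, hδ'⟩ := h ε hε
  filter_upwards [eventually_ge_atTop (2 * L / δ), eventually_gt_atTop 0] with κ hκ hκ0
  refine NLSGibbs.supConv_le (by positivity) fun c hc => ?_
  have hpos : 0 ≤ (a + ε) ^ 2 / (2 * κ) := by positivity
  rcases lt_or_ge ‖c‖ δ with hcδ | hcδ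
  · have h1 := (abs_le.1 (hδ' c hcδ hc)).2
    have h2 : (a + ε) * ‖c‖ - κ / 2 * ‖c‖ ^ 2 ≤ (a + ε) ^ 2 / (2 * κ) := by
      rw [le_div_iff₀ (by positivity)]
      nlinarith [sq_nonneg ((a + ε) - κ * ‖c‖)]
    linarith
  · have h1 := (abs_le.1 (hL z hz c hc)).2
    rw [div_le_iff₀ hδ] at hκ
    have h2 : 2 * L ≤ κ * ‖c‖ := hκ.trans (by gcongr)
    nlinarith [norm_nonneg c]

lemma supConv_sub_div_le {x y : ℝ≥0∞} {b r s : ℝ} (hs : 0 < s)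
    (hx : x ≤ ENNReal.ofReal (Real.exp (b + r * s))) (hy : y = ENNReal.ofReal (Real.exp b)) :
    (x - y) / ENNReal.ofReal s ≤ ENNReal.ofReal (Real.exp b * (r * Real.exp (r * s))) := by
  have h1 : x - y ≤ ENNReal.ofReal (Real.exp (b + r * s) - Real.exp b) := by
    rw [hy, ENNReal.ofReal_sub _ (Real.exp_pos _).le]
    exact tsub_le_tsub_right hx _
  refine (ENNReal.div_le_div_right h1 _).trans ?_
  rw [← ENNReal.ofReal_div_of_pos hs]
  refine ENNReal.ofReal_le_ofReal ?_
  rw [div_le_iff₀ hs, Real.exp_add]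
  have := mul_le_mul_of_nonneg_left (exp_sub_one_le_mul_exp (r * s)) (Real.exp_pos b).le
  linarith

/-- The logarithmic Sobolev inequality for `exp g`, where `g` is bounded and Lipschitz along the
Cameron–Martin space. -/
theorem entropy_exp_le {N lam α L M : ℝ} (hN : 0 < N) (hlam : 0 ≤ lam)
    (h1 : lam * N ≤ 1 / 16) (hα : 0 < α) (hαle : 12 * (lam * N) ≤ 1 - α)
    {g : LTwo → ℝ} (hg : Measurable g) (hM : ∀ z, |g z| ≤ M) (hL : CMLipschitz N L g)
    {G : LTwo → ℝ} (hG : ∀ z ∈ Ball N, CMSlopeLE N g z (G z)) :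
    ENNReal.ofReal ((∫ z, g z * Real.exp (g z) ∂gibbs N lam) -
      (∫ z, Real.exp (g z) ∂gibbs N lam) * Real.log (∫ z, Real.exp (g z) ∂gibbs N lam)) ≤
      ∫⁻ z, ENNReal.ofReal (Real.exp (g z) * (G z ^ 2 / (2 * α))) ∂gibbs N lam := by
  have := isProbabilityMeasure_gibbs hN hlam h1
  set ν := gibbs N lam with hν
  set Ent := (∫ z, g z * Real.exp (g z) ∂ν) -
      (∫ z, Real.exp (g z) ∂ν) * Real.log (∫ z, Real.exp (g z) ∂ν) with hEnt
  have hem : Measurable fun z => ENNReal.ofReal (Real.exp (g z)) := hg.exp.ennreal_ofReal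
  have hint : ∀ t : ℝ, 0 < t → Integrable (fun z => Real.exp (g z / t)) ν := fun t ht =>
    Integrable.of_bound (hg.div_const t).exp.aestronglyMeasurable (Real.exp (M / t))
      (Eventually.of_forall fun z => by
        rw [Real.norm_of_nonneg (Real.exp_pos _).le]
        gcongr
        exact (abs_le.1 (hM z)).2)
  have hint1 : Integrable (fun z => Real.exp (g z)) ν := by simpa using hint 1 one_pos
  -- Starting at `1 / 2` keeps `1 - s n ≥ 1 / 2`, which makes the later bounds uniform in `n`.
  set s : ℕ → ℝ := fun n => 1 / ((n : ℝ) + 2) with hs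
  have hs0 : ∀ n, 0 < s n := fun n => by positivity
  have hs1 : ∀ n, s n ≤ 1 / 2 := fun n => by
    simp only [hs]
    gcongr
    linarith [(Nat.cast_nonneg n : (0 : ℝ) ≤ n)]
  have hslim : Tendsto s atTop (𝓝 0) := by
    have h := tendsto_one_div_add_atTop_nhds_zero_nat (𝕜 := ℝ)
    have h' := (tendsto_add_atTop_iff_nat 1).2 h
    refine h'.congr fun n => ?_
    simp only [hs]
    push_cast
    ring
  set a : ℕ → LTwo → ℝ≥0∞ := fun n z =>
    (supConv N (α * (1 - s n) / s n) g z - ENNReal.ofReal (Real.exp (g z))) / ENNReal.ofReal (s n)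
    with ha
  have ham : ∀ n, Measurable (a n) := fun n => ((measurable_supConv N _ hg).sub hem).div_const _
  have hle : ∀ n, ENNReal.ofReal Ent ≤ ∫⁻ z, a n z ∂ν := by
    intro n
    have ht : 0 < 1 - s n := by linarith [hs1 n]
    rcases le_total Ent 0 with hE | hE
    · rw [ENNReal.ofReal_of_nonpos hE]; exact zero_le
    have h2 := add_mul_entropy_le (ν := ν) hg hM ht (hs0 n) (by ring)
    have h3 := gibbs_prekopaLeindler hN hlam h1 hα hαle ht (hs0 n) (by ring) hg hL
    rw [← ofReal_integral_eq_lintegral_ofReal (hint _ ht)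
      (Eventually.of_forall fun z => (Real.exp_pos _).le),
      ENNReal.ofReal_rpow_of_nonneg (integral_nonneg fun z => (Real.exp_pos _).le) ht.le] at h3
    have h4 := (ENNReal.ofReal_le_ofReal h2).trans h3
    rw [← hEnt, ENNReal.ofReal_add (integral_nonneg fun z => (Real.exp_pos _).le)
      (mul_nonneg (hs0 n).le hE), ENNReal.ofReal_mul (hs0 n).le] at h4
    have h5 : ∫⁻ z, supConv N (α * (1 - s n) / s n) g z ∂ν =
        ENNReal.ofReal (∫ z, Real.exp (g z) ∂ν) + ∫⁻ z, (supConv N (α * (1 - s n) / s n) g z -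
          ENNReal.ofReal (Real.exp (g z))) ∂ν := by
      rw [ofReal_integral_eq_lintegral_ofReal hint1
        (Eventually.of_forall fun z => (Real.exp_pos _).le), ← lintegral_add_left hem]
      exact lintegral_congr fun z => (add_tsub_cancel_of_le (le_supConv_self _ _ _ _)).symm
    rw [h5] at h4
    have h6 := (ENNReal.add_le_add_iff_left ENNReal.ofReal_ne_top).1 h4
    have h7 : ∫⁻ z, a n z ∂ν = (∫⁻ z, (supConv N (α * (1 - s n) / s n) g z -
        ENNReal.ofReal (Real.exp (g z))) ∂ν) * (ENNReal.ofReal (s n))⁻¹ :=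
      lintegral_mul_const _ ((measurable_supConv N _ hg).sub hem)
    rw [h7, ← div_eq_mul_inv, ENNReal.le_div_iff_mul_le (Or.inl (by simpa using hs0 n)) (Or.inl ENNReal.ofReal_ne_top),
      mul_comm]
    exact h6
  have hκ : ∀ (n : ℕ) (D : ℝ), D / (2 * (α * (1 - s n) / s n)) = D / (2 * α) / (1 - s n) * s n := by
    intro n D
    have : 1 - s n ≠ 0 := by linarith [hs1 n]
    have := (hs0 n).ne'
    field_simp
  -- A constant majorant, needed for the reverse Fatou lemma; this is where boundedness and the
  -- global Lipschitz constant enter.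
  have hbound : ∀ n, ∀ᵐ z ∂ν, a n z ≤
      ENNReal.ofReal (Real.exp M * (L ^ 2 / α * Real.exp (L ^ 2 / α))) := by
    intro n
    filter_upwards [ae_mem_ball_gibbs N lam] with z hz
    have ht : 0 < 1 - s n := by linarith [hs1 n]
    have h2 := hL.supConv_le (κ := α * (1 - s n) / s n)
      (div_pos (mul_pos hα ht) (hs0 n)) hz
    rw [hκ] at h2
    refine (supConv_sub_div_le (hs0 n) h2 rfl).trans (ENNReal.ofReal_le_ofReal ?_)
    have h3 : L ^ 2 / (2 * α) / (1 - s n) ≤ L ^ 2 / α := by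
      rw [div_div, div_le_div_iff₀ (by positivity) hα]
      have : 0 ≤ L ^ 2 * α := by positivity
      nlinarith [hs1 n]
    have h4 : 0 ≤ L ^ 2 / (2 * α) / (1 - s n) := by positivity
    have h5 : L ^ 2 / (2 * α) / (1 - s n) * s n ≤ L ^ 2 / α :=
      (mul_le_of_le_one_right h4 (by linarith [hs1 n])).trans h3
    gcongr
    exact (abs_le.1 (hM z)).2
  have hlimsup : ∀ z ∈ Ball N, limsup (fun n => a n z) atTop ≤
      ENNReal.ofReal (Real.exp (g z) * (G z ^ 2 / (2 * α))) := by
    intro z hz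
    have hε : ∀ ε : ℝ, 0 < ε → limsup (fun n => a n z) atTop ≤
        ENNReal.ofReal (Real.exp (g z) * ((G z + ε) ^ 2 / (2 * α))) := by
      intro ε hε
      have hκlim : Tendsto (fun n => α * (1 - s n) / s n) atTop atTop := by
        have h2 : Tendsto (fun n => (s n)⁻¹) atTop atTop :=
          (tendsto_nhdsWithin_iff.2 ⟨hslim, Eventually.of_forall hs0⟩).inv_tendsto_nhdsGT_zero
        have h3 : Tendsto (fun n => α * (1 - s n)) atTop (𝓝 (α * (1 - 0))) :=
          (hslim.const_sub 1).const_mul α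
        simp only [div_eq_mul_inv]
        exact h3.pos_mul_atTop (by simpa using hα) h2
      have hev := hκlim.eventually ((hG z hz).eventually_supConv_le hL hz hε)
      set D := (G z + ε) ^ 2 / (2 * α) with hD
      have hle2 : ∀ᶠ n in atTop, a n z ≤ ENNReal.ofReal
          (Real.exp (g z) * (D / (1 - s n) * Real.exp (D / (1 - s n) * s n))) := by
        filter_upwards [hev] with n hn
        rw [hκ] at hn
        exact supConv_sub_div_le (hs0 n) hn rfl
      have hlim : Tendsto (fun n => ENNReal.ofReal
          (Real.exp (g z) * (D / (1 - s n) * Real.exp (D / (1 - s n) * s n)))) atTop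
          (𝓝 (ENNReal.ofReal (Real.exp (g z) * D))) := by
        refine ENNReal.tendsto_ofReal ?_
        have h2 : Tendsto (fun n => D / (1 - s n)) atTop (𝓝 (D / (1 - 0))) :=
          tendsto_const_nhds.div (hslim.const_sub 1) (by norm_num)
        have h3 : Tendsto (fun n => Real.exp (D / (1 - s n) * s n)) atTop
            (𝓝 (Real.exp (D / (1 - 0) * 0))) := (Real.continuous_exp.tendsto _).comp (h2.mul hslim)
        have h4 := (h2.mul h3).const_mul (Real.exp (g z))
        simpa using h4
      calc limsup (fun n => a n z) atTop ≤ limsup (fun n => ENNReal.ofReal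
            (Real.exp (g z) * (D / (1 - s n) * Real.exp (D / (1 - s n) * s n)))) atTop :=
            limsup_le_limsup hle2
        _ = _ := hlim.limsup_eq
    have hlim : Tendsto (fun ε : ℝ =>
        ENNReal.ofReal (Real.exp (g z) * ((G z + ε) ^ 2 / (2 * α)))) (𝓝[>] 0)
        (𝓝 (ENNReal.ofReal (Real.exp (g z) * ((G z + 0) ^ 2 / (2 * α))))) := by
      have hc : Continuous fun ε : ℝ =>
          ENNReal.ofReal (Real.exp (g z) * ((G z + ε) ^ 2 / (2 * α))) :=
        ENNReal.continuous_ofReal.comp (by fun_prop)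
      exact (hc.tendsto 0).mono_left nhdsWithin_le_nhds
    rw [add_zero] at hlim
    exact ge_of_tendsto hlim (eventually_nhdsWithin_of_forall fun ε h => hε ε h)
  calc ENNReal.ofReal Ent ≤ limsup (fun n => ∫⁻ z, a n z ∂ν) atTop :=
        le_limsup_of_frequently_le (Frequently.of_forall hle)
    _ ≤ ∫⁻ z, limsup (fun n => a n z) atTop ∂ν :=
        limsup_lintegral_le _ ham hbound (by simp)
    _ ≤ _ := by
        refine lintegral_mono_ae ?_
        filter_upwards [ae_mem_ball_gibbs N lam] with z hz
        exact hlimsup z hz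

/-! ### Sobolev norms -/

/-- The weight of the frequency `k` in the square of the norm of `H^s`. -/
def sobolevWeight (s : ℝ) (k : ℤ) : ℝ := if k = 0 then 1 else |(k : ℝ)| ^ (2 * s)

lemma sobolevWeight_pos (s : ℝ) (k : ℤ) : 0 < sobolevWeight s k := by
  unfold sobolevWeight
  split_ifs with h
  · exact one_pos
  · have : (0 : ℝ) < |(k : ℝ)| := by positivity
    positivity

lemma sobolevENorm_eq (s : ℝ) (u : LTwo) : sobolevENorm s u =
    (∑' k : ℤ, ENNReal.ofReal (sobolevWeight s k) * ‖fourierCoeff u k‖ₑ ^ 2) ^ (1 / 2 : ℝ) := rfl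

lemma sobolevENorm_sq (s : ℝ) (u : LTwo) : sobolevENorm s u ^ 2 =
    ∑' k : ℤ, ENNReal.ofReal (sobolevWeight s k) * ‖fourierCoeff u k‖ₑ ^ 2 := by
  rw [sobolevENorm_eq, ← ENNReal.rpow_two, ← ENNReal.rpow_mul]
  norm_num

lemma fourierCoeff_add (u v : LTwo) (k : ℤ) :
    fourierCoeff (u + v : LTwo) k = fourierCoeff u k + fourierCoeff v k := by
  simp only [← fourierBasis_repr, map_add]
  rfl

lemma continuous_fourierCoeff (k : ℤ) : Continuous fun u : LTwo => fourierCoeff u k := by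
  simp only [← fourierBasis_repr, HilbertBasis.repr_apply_apply]
  fun_prop

lemma measurable_sobolevENorm (s : ℝ) : Measurable (sobolevENorm s) := by
  refine Measurable.pow_const (Measurable.tsum fun k => ?_) _
  exact ((continuous_fourierCoeff k).measurable.enorm.pow_const 2).const_mul _

lemma sobolevENorm_add_le (s : ℝ) (u v : LTwo) :
    sobolevENorm s (u + v) ≤ sobolevENorm s u + sobolevENorm s v := by
  set f : LTwo → ℤ → ℝ≥0∞ := fun u k =>
    ENNReal.ofReal (sobolevWeight s k) ^ (1 / 2 : ℝ) * ‖fourierCoeff u k‖ₑ with hf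
  have h0 : ∀ u, sobolevENorm s u = (∫⁻ k, f u k ^ (2 : ℝ) ∂Measure.count) ^ (1 / 2 : ℝ) := by
    intro u
    rw [lintegral_count, sobolevENorm_eq]
    congr 1
    refine tsum_congr fun k => ?_
    rw [hf, ENNReal.mul_rpow_of_nonneg _ _ zero_le_two, ← ENNReal.rpow_mul]
    norm_num
  rw [h0, h0, h0]
  refine le_trans ?_ (ENNReal.lintegral_Lp_add_le (measurable_of_countable _).aemeasurable
    (measurable_of_countable _).aemeasurable one_le_two)
  gcongr with k
  rw [Pi.add_apply, hf]
  simp only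
  rw [← mul_add, fourierCoeff_add]
  gcongr
  exact enorm_add_le _ _

lemma Seq.tsum_enorm_sq (c : Seq) : ∑' k, ‖c k‖ₑ ^ 2 = ENNReal.ofReal ‖c‖ ^ 2 := by
  rw [← ENNReal.ofReal_pow (norm_nonneg _), Seq.norm_sq_eq,
    ENNReal.ofReal_tsum_of_nonneg (fun k => by positivity) c.summable_norm_sq]
  refine tsum_congr fun k => ?_
  rw [ENNReal.ofReal_pow (norm_nonneg _), ofReal_norm]

lemma sobolevWeight_mul_norm_invFreq_sq_le {s : ℝ} (hs : s ≤ 1) (k : ℤ) :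
    sobolevWeight s k * ‖invFreq k‖ ^ 2 ≤ 1 := by
  unfold sobolevWeight invFreq
  split_ifs with h
  · simp
  · have hk : 1 ≤ |(k : ℝ)| := by exact_mod_cast Int.one_le_abs h
    rw [norm_div, norm_one, Complex.norm_intCast, div_pow, one_pow, mul_one_div,
      div_le_one (by positivity)]
    calc |(k : ℝ)| ^ (2 * s) ≤ |(k : ℝ)| ^ (2 : ℝ) :=
          Real.rpow_le_rpow_of_exponent_le hk (by linarith)
      _ = _ := Real.rpow_two _

lemma sobolevENorm_cmEmbed_le {s : ℝ} (hs : s ≤ 1) (c : Seq) :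
    sobolevENorm s (cmEmbed c) ≤ ENNReal.ofReal ‖c‖ := by
  rw [← ENNReal.pow_le_pow_left_iff two_ne_zero, sobolevENorm_sq, ← Seq.tsum_enorm_sq]
  refine ENNReal.tsum_le_tsum fun k => ?_
  rw [fourierCoeff_cmEmbed, enorm_mul, mul_pow, ← mul_assoc]
  refine mul_le_of_le_one_left' ?_
  rw [← ofReal_norm, ← ENNReal.ofReal_pow (norm_nonneg _),
    ← ENNReal.ofReal_mul (sobolevWeight_pos s k).le, ENNReal.ofReal_le_one]
  exact sobolevWeight_mul_norm_invFreq_sq_le hs k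

/-! ### Almost sure regularity of the Brownian loop -/

lemma enorm_fourierCoeff_brownianLoop_le (γ : ℤ → ℝ × ℝ) (k : ℤ) :
    ‖fourierCoeff (brownianLoop γ) k‖ₑ ≤ ‖loopCoeff γ k‖ₑ := by
  rw [← fourierBasis_repr]
  by_cases h : Summable fun j : ℤ => loopCoeff γ j • (fourierLp 2 j : LTwo)
  · have h1 : HasSum (fun j : ℤ => loopCoeff γ j • (fourierLp 2 j : LTwo)) (brownianLoop γ) :=
      h.hasSum
    have hmem : Memℓp (fun j => loopCoeff γ j) (2 : ℝ≥0∞) := by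
      refine memℓp_gen ?_
      simpa using (summable_loop_iff γ).1 h
    have h2 := (fourierBasis (T := 2 * Real.pi)).hasSum_repr_symm (⟨_, hmem⟩ : Seq)
    rw [coe_fourierBasis] at h2
    have h3 := h1.unique h2
    rw [h3, LinearIsometryEquiv.apply_symm_apply]
  · rw [brownianLoop_of_not_summable h, map_zero]
    simp

lemma lintegral_enorm_loopCoeff_sq (k : ℤ) : ∫⁻ γ, ‖loopCoeff γ k‖ₑ ^ 2 ∂gaussianLaw =
    ‖invFreq k‖ₑ ^ 2 *
      ∫⁻ p, ‖toComplex p‖ₑ ^ 2 ∂((gaussianReal 0 1).prod (gaussianReal 0 1)) := by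
  have hm : Measurable fun p : ℝ × ℝ => ‖toComplex p‖ₑ ^ 2 := by
    unfold toComplex
    fun_prop
  rw [← (measurePreserving_eval_infinitePi
    (fun _ : ℤ => (gaussianReal 0 1).prod (gaussianReal 0 1)) k).lintegral_comp hm,
    ← lintegral_const_mul (‖invFreq k‖ₑ ^ 2)
      (f := fun γ : ℤ → ℝ × ℝ => ‖toComplex (Function.eval k γ)‖ₑ ^ 2)
      (hm.comp (measurable_pi_apply k))]
  refine lintegral_congr fun γ => ?_
  rw [loopCoeff_eq, enorm_mul, mul_pow]

lemma lintegral_toComplex_sq_ne_top :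
    ∫⁻ p, ‖toComplex p‖ₑ ^ 2 ∂((gaussianReal 0 1).prod (gaussianReal 0 1)) ≠ ∞ := by
  have h1 : Integrable (fun x : ℝ => x ^ 2) (gaussianReal 0 1) :=
    (memLp_id_gaussianReal' 2 ENNReal.ofNat_ne_top).integrable_sq
  have h2 : Integrable (fun p : ℝ × ℝ => p.1 ^ 2 + p.2 ^ 2)
      ((gaussianReal 0 1).prod (gaussianReal 0 1)) :=
    (h1.comp_fst (gaussianReal 0 1)).add (h1.comp_snd (gaussianReal 0 1))
  refine ne_of_eq_of_ne ?_ h2.lintegral_lt_top.ne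
  refine lintegral_congr fun p => ?_
  rw [← norm_toComplex_sq, ENNReal.ofReal_pow (norm_nonneg _), ofReal_norm]

lemma summable_sobolevWeight_mul_invFreq {s : ℝ} (hs : s < 1 / 2) :
    Summable fun k => sobolevWeight s k * ‖invFreq k‖ ^ 2 := by
  refine Summable.of_nonneg_of_le (fun k => by have := sobolevWeight_pos s k; positivity)
    (fun k => ?_) (Real.summable_abs_int_rpow (b := 2 - 2 * s) (by linarith))
  unfold sobolevWeight invFreq
  split_ifs with h
  · simp only [norm_zero, ne_eq, OfNat.ofNat_ne_zero, not_false_eq_true, zero_pow, mul_zero]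
    positivity
  · have hk : 0 < |(k : ℝ)| := by positivity
    rw [norm_div, norm_one, Complex.norm_intCast, div_pow, one_pow, mul_one_div,
      ← Real.rpow_two, ← Real.rpow_sub hk]
    exact le_of_eq (by congr 1; ring)

/-- The expected square of the norm is bounded by a multiple of `∑ |k| ^ (2 s - 2)`, which converges
for `s < 1 / 2`. -/
lemma ae_sobolevENorm_ne_top {s : ℝ} (hs : s < 1 / 2) :
    ∀ᵐ u ∂loopMeasure, sobolevENorm s u ≠ ∞ := by
  have hfin : ∫⁻ u, sobolevENorm s u ^ 2 ∂loopMeasure ≠ ∞ := by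
    rw [loopMeasure, lintegral_map ((measurable_sobolevENorm s).pow_const 2)
      measurable_brownianLoop]
    have hle : ∀ γ, sobolevENorm s (brownianLoop γ) ^ 2 ≤
        ∑' k : ℤ, ENNReal.ofReal (sobolevWeight s k) * ‖loopCoeff γ k‖ₑ ^ 2 := by
      intro γ
      rw [sobolevENorm_sq]
      refine ENNReal.tsum_le_tsum fun k => ?_
      gcongr
      exact enorm_fourierCoeff_brownianLoop_le γ k
    refine ne_top_of_le_ne_top ?_ (lintegral_mono hle)
    have hm : ∀ k : ℤ, Measurable fun γ => ‖loopCoeff γ k‖ₑ ^ 2 := fun k =>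
      (continuous_loopCoeff k).measurable.enorm.pow_const 2
    rw [lintegral_tsum fun k => ((hm k).const_mul _).aemeasurable]
    simp only [lintegral_const_mul _ (hm _), lintegral_enorm_loopCoeff_sq, ← mul_assoc]
    rw [ENNReal.tsum_mul_right]
    refine ENNReal.mul_ne_top ?_ lintegral_toComplex_sq_ne_top
    have : ∀ k, ENNReal.ofReal (sobolevWeight s k) * ‖invFreq k‖ₑ ^ 2 =
        ENNReal.ofReal (sobolevWeight s k * ‖invFreq k‖ ^ 2) := fun k => by
      rw [ENNReal.ofReal_mul (sobolevWeight_pos s k).le, ENNReal.ofReal_pow (norm_nonneg _),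
        ofReal_norm]
    simp only [this]
    exact (summable_sobolevWeight_mul_invFreq hs).tsum_ofReal_ne_top
  filter_upwards [ae_lt_top ((measurable_sobolevENorm s).pow_const 2) hfin] with u hu
  intro h
  rw [h] at hu
  simp at hu

/-! ### Compactness of Sobolev balls -/

lemma Seq.norm_le_mul_norm {c d : Seq} {ε : ℝ} (hε : 0 ≤ ε) (h : ∀ j, ‖d j‖ ≤ ε * ‖c j‖) :
    ‖d‖ ≤ ε * ‖c‖ := by
  rw [← sq_le_sq₀ (norm_nonneg _) (by positivity), mul_pow, Seq.norm_sq_eq, Seq.norm_sq_eq,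
    ← tsum_mul_left]
  refine Summable.tsum_le_tsum (fun j => ?_) d.summable_norm_sq (c.summable_norm_sq.mul_left _)
  rw [← mul_pow]
  gcongr
  exact h j

/-- The operator is a norm limit of its finite rank truncations, since the multipliers tend to `0`.
-/
lemma isCompactOperator_diag {q : ℤ → ℂ} (hq : ∀ j, ‖q j‖ ≤ 1) (hq0 : Tendsto q cofinite (𝓝 0)) :
    IsCompactOperator (diag q hq) := by
  classical
  set T : Finset ℤ → Seq →L[ℂ] Seq := fun J => ∑ j ∈ J,
    (lp.singleContinuousLinearMap ℂ (fun _ : ℤ => ℂ) 2 j) ∘L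
      (q j • lp.evalCLM ℂ (fun _ : ℤ => ℂ) 2 j) with hT
  have hTc : ∀ J, IsCompactOperator (T J) := by
    intro J
    have : T J ∈ compactOperator (RingHom.id ℂ) Seq Seq := by
      refine Submodule.sum_mem _ fun j _ => ?_
      exact (isCompactOperator_of_locallyCompactSpace_dom
        (q j • lp.evalCLM ℂ (fun _ : ℤ => ℂ) 2 j)).clm_comp
        (lp.singleContinuousLinearMap ℂ (fun _ : ℤ => ℂ) 2 j)
    exact this
  have hTa : ∀ J c k, T J c k = if k ∈ J then q k * c k else 0 := by
    intro J c k
    simp only [hT, sum_apply, ContinuousLinearMap.comp_apply,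
      lp.singleContinuousLinearMap_apply, lp.coeFn_sum, Finset.sum_apply, lp.single_apply,
      Pi.single_apply]
    simp [lp.evalCLM]
  refine isCompactOperator_of_tendsto (F := T) (l := atTop) ?_ (Eventually.of_forall hTc)
  rw [Metric.tendsto_atTop]
  intro ε hε
  have hfin : {j | ¬ ‖q j‖ < ε / 2}.Finite := by
    have := (tendsto_zero_iff_norm_tendsto_zero.1 hq0).eventually (gt_mem_nhds (half_pos hε))
    exact this
  refine ⟨hfin.toFinset, fun J hJ => ?_⟩
  rw [dist_eq_norm]
  refine (ContinuousLinearMap.opNorm_le_bound _ (half_pos hε).le fun c => ?_).trans_lt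
    (half_lt_self hε)
  refine Seq.norm_le_mul_norm (half_pos hε).le fun k => ?_
  have h1 : ((T J - diag q hq) c) k = T J c k - q k * c k := rfl
  rw [h1, hTa]
  split_ifs with hk
  · simp only [sub_self, norm_zero]; positivity
  · rw [zero_sub, norm_neg, norm_mul]
    gcongr
    by_contra hlt
    exact hk (hJ (hfin.mem_toFinset.2 fun h => hlt (le_of_lt h)))

/-- The reciprocal square root of the weight of `H^s`. -/
def sobolevDamping (s : ℝ) (k : ℤ) : ℂ := if k = 0 then 1 else ((|(k : ℝ)| ^ (-s) : ℝ) : ℂ)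

lemma norm_sobolevDamping (s : ℝ) {k : ℤ} (hk : k ≠ 0) :
    ‖sobolevDamping s k‖ = |(k : ℝ)| ^ (-s) := by
  rw [sobolevDamping, if_neg hk, Complex.norm_real, Real.norm_of_nonneg (by positivity)]

lemma norm_sobolevDamping_le_one {s : ℝ} (hs : 0 ≤ s) (k : ℤ) : ‖sobolevDamping s k‖ ≤ 1 := by
  rcases eq_or_ne k 0 with rfl | hk
  · simp [sobolevDamping]
  · rw [norm_sobolevDamping s hk]
    have hk : 1 ≤ |(k : ℝ)| := by exact_mod_cast Int.one_le_abs hk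
    exact Real.rpow_le_one_of_one_le_of_nonpos hk (by linarith)

lemma sobolevWeight_mul_norm_sobolevDamping_sq (s : ℝ) (k : ℤ) :
    sobolevWeight s k * ‖sobolevDamping s k‖ ^ 2 = 1 := by
  rcases eq_or_ne k 0 with rfl | hk
  · simp [sobolevDamping, sobolevWeight]
  · have hk' : 0 < |(k : ℝ)| := by positivity
    rw [norm_sobolevDamping s hk, sobolevWeight, if_neg hk, ← Real.rpow_natCast,
      ← Real.rpow_mul hk'.le, ← Real.rpow_add hk']
    push_cast
    ring_nf
    exact Real.rpow_zero _

lemma sobolevDamping_ne_zero (s : ℝ) (k : ℤ) : sobolevDamping s k ≠ 0 := by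
  intro h
  have := sobolevWeight_mul_norm_sobolevDamping_sq s k
  simp [h] at this

lemma tendsto_sobolevDamping {s : ℝ} (hs : 0 < s) :
    Tendsto (sobolevDamping s) cofinite (𝓝 0) := by
  rw [tendsto_zero_iff_norm_tendsto_zero]
  have h1 : Tendsto (fun k : ℤ => |(k : ℝ)| ^ (-s)) cofinite (𝓝 0) :=
    (tendsto_rpow_neg_atTop hs).comp
      ((tendsto_norm_cocompact_atTop (E := ℝ)).comp Int.tendsto_coe_cofinite)
  refine h1.congr' ?_
  filter_upwards [(Set.finite_singleton (0 : ℤ)).compl_mem_cofinite] with k hk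
  exact (norm_sobolevDamping s hk).symm

/-- Balls of `H^s` are relatively compact in `L²` for `s > 0`. -/
lemma exists_isCompact_of_sobolevENorm_le {s : ℝ} (hs : 0 < s) {R : ℝ} (hR : 0 ≤ R) :
    ∃ K : Set LTwo, IsCompact K ∧ ∀ u, sobolevENorm s u ≤ ENNReal.ofReal R → u ∈ K := by
  set D := diag (sobolevDamping s) (norm_sobolevDamping_le_one hs.le) with hD
  have hDc : IsCompactOperator D := isCompactOperator_diag _ (tendsto_sobolevDamping hs)
  refine ⟨fourierBasis.repr.symm '' closure (D '' Metric.closedBall 0 R),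
    (hDc.isCompact_closure_image_closedBall (f := (D : Seq →ₗ[ℂ] Seq)) R).image
      fourierBasis.repr.symm.continuous, fun u hu => ?_⟩
  -- Dividing the coefficients of `u` by the damping gives a sequence whose `ℓ²` norm is the `H^s`
  -- norm of `u`, so `u` lies in the image of an `ℓ²` ball under a compact operator.
  have hsum : ∑' k, ‖fourierCoeff u k / sobolevDamping s k‖ₑ ^ 2 = sobolevENorm s u ^ 2 := by
    rw [sobolevENorm_sq]
    refine tsum_congr fun k => ?_
    rw [← ofReal_norm, ← ofReal_norm, ← ENNReal.ofReal_pow (norm_nonneg _),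
      ← ENNReal.ofReal_pow (norm_nonneg _), ← ENNReal.ofReal_mul (sobolevWeight_pos s k).le]
    congr 1
    have h0 : ‖sobolevDamping s k‖ ≠ 0 := norm_ne_zero_iff.2 (sobolevDamping_ne_zero s k)
    rw [norm_div, div_pow, div_eq_iff (pow_ne_zero _ h0), mul_right_comm,
      sobolevWeight_mul_norm_sobolevDamping_sq, one_mul]
  have hle : ∑' k, ‖fourierCoeff u k / sobolevDamping s k‖ₑ ^ 2 ≤ ENNReal.ofReal R ^ 2 := by
    rw [hsum]
    gcongr
  have hmem : Memℓp (fun k => fourierCoeff u k / sobolevDamping s k) (2 : ℝ≥0∞) := by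
    refine memℓp_gen ?_
    have h1 : ∑' k, ENNReal.ofReal (‖fourierCoeff u k / sobolevDamping s k‖ ^ 2) ≠ ∞ := by
      simp only [ENNReal.ofReal_pow (norm_nonneg _), ofReal_norm]
      exact ne_top_of_le_ne_top (ENNReal.pow_ne_top ENNReal.ofReal_ne_top) hle
    have h2 := ENNReal.summable_toReal h1
    simpa [ENNReal.toReal_ofReal, sq_nonneg] using h2
  set d : Seq := ⟨_, hmem⟩ with hd
  have hdnorm : ‖d‖ ≤ R := by
    have h1 := d.tsum_enorm_sq
    have h2 : ENNReal.ofReal ‖d‖ ^ 2 ≤ ENNReal.ofReal R ^ 2 := h1 ▸ hle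
    rw [ENNReal.pow_le_pow_left_iff two_ne_zero, ENNReal.ofReal_le_ofReal_iff hR] at h2
    exact h2
  refine ⟨D d, subset_closure ⟨d, by simpa using hdnorm, rfl⟩, ?_⟩
  rw [LinearIsometryEquiv.symm_apply_eq]
  ext k
  rw [fourierBasis_repr, hD, diag_apply]
  exact mul_div_cancel₀ _ (sobolevDamping_ne_zero s k)

/-! ### Cutoff functions -/

/-- A cutoff function that is `1` where the norm of `H^{1/4}` is at most `R`, and `0` where it is at
least `2 R`. -/
def cutoff (R : ℝ) (u : LTwo) : ℝ :=
  open scoped Classical in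
  if sobolevENorm (1 / 4) u = ∞ then 0
  else max 0 (min 1 (2 - (sobolevENorm (1 / 4) u).toReal / R))

lemma measurable_cutoff (R : ℝ) : Measurable (cutoff R) := by
  have h := measurable_sobolevENorm (1 / 4)
  exact Measurable.ite (h (measurableSet_singleton ∞)) measurable_const (by fun_prop)

lemma cutoff_nonneg (R : ℝ) (u : LTwo) : 0 ≤ cutoff R u := by
  unfold cutoff
  split_ifs
  exacts [le_rfl, le_max_left _ _]

lemma cutoff_le_one (R : ℝ) (u : LTwo) : cutoff R u ≤ 1 := by
  unfold cutoff
  split_ifs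
  exacts [zero_le_one, max_le zero_le_one (min_le_left _ _)]

lemma sobolevENorm_le_of_cutoff_ne_zero {R : ℝ} (hR : 0 < R) {u : LTwo} (h : cutoff R u ≠ 0) :
    sobolevENorm (1 / 4) u ≤ ENNReal.ofReal (2 * R) := by
  unfold cutoff at h
  split_ifs at h with htop
  · exact absurd rfl h
  · rw [ENNReal.le_ofReal_iff_toReal_le htop (by positivity)]
    by_contra! hlt
    rw [← lt_div_iff₀ hR] at hlt
    exact h (max_eq_left ((min_le_right _ _).trans (by linarith)))

lemma sobolevENorm_add_cmEmbed_ne_top {x : LTwo} (c : Seq) (h : sobolevENorm (1 / 4) x ≠ ∞) :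
    sobolevENorm (1 / 4) (x + cmEmbed c) ≠ ∞ ∧
      (sobolevENorm (1 / 4) (x + cmEmbed c)).toReal ≤ (sobolevENorm (1 / 4) x).toReal + ‖c‖ := by
  have h1 : sobolevENorm (1 / 4) (x + cmEmbed c) ≤
      sobolevENorm (1 / 4) x + ENNReal.ofReal ‖c‖ :=
    (sobolevENorm_add_le _ _ _).trans (by gcongr; exact sobolevENorm_cmEmbed_le (by norm_num) c)
  have h2 : sobolevENorm (1 / 4) x + ENNReal.ofReal ‖c‖ ≠ ∞ :=
    ENNReal.add_ne_top.2 ⟨h, ENNReal.ofReal_ne_top⟩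
  refine ⟨ne_top_of_le_ne_top h2 h1, (ENNReal.toReal_mono h2 h1).trans_eq ?_⟩
  rw [ENNReal.toReal_add h ENNReal.ofReal_ne_top, ENNReal.toReal_ofReal (norm_nonneg _)]

lemma abs_cutoff_sub_le {R : ℝ} (hR : 0 < R) (x : LTwo) (c : Seq) :
    |cutoff R (x + cmEmbed c) - cutoff R x| ≤ 1 / R * ‖c‖ := by
  have hx : x = (x + cmEmbed c) + cmEmbed (-c) := by rw [map_neg]; abel
  by_cases h : sobolevENorm (1 / 4) x = ∞
  · have h' : sobolevENorm (1 / 4) (x + cmEmbed c) = ∞ := by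
      by_contra hne
      exact (sobolevENorm_add_cmEmbed_ne_top (-c) hne).1 (hx ▸ h)
    rw [cutoff, cutoff, if_pos h, if_pos h', sub_zero, abs_zero]
    positivity
  · obtain ⟨h', h1⟩ := sobolevENorm_add_cmEmbed_ne_top c h
    have h2 := (sobolevENorm_add_cmEmbed_ne_top (-c) h').2
    rw [← hx, norm_neg] at h2
    rw [cutoff, cutoff, if_neg h, if_neg h']
    set a := (sobolevENorm (1 / 4) (x + cmEmbed c)).toReal
    set b := (sobolevENorm (1 / 4) x).toReal
    calc |max 0 (min 1 (2 - a / R)) - max 0 (min 1 (2 - b / R))|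
        ≤ |min 1 (2 - a / R) - min 1 (2 - b / R)| := by
          have := abs_max_sub_max_le_max 0 (min 1 (2 - a / R)) 0 (min 1 (2 - b / R))
          simpa using this
      _ ≤ |(2 - a / R) - (2 - b / R)| := by
          have := abs_min_sub_min_le_max 1 (2 - a / R) 1 (2 - b / R)
          simpa using this
      _ = 1 / R * |a - b| := by
          rw [show (2 - a / R) - (2 - b / R) = -(1 / R * (a - b)) by ring, abs_neg, abs_mul,
            abs_of_pos (by positivity : 0 < 1 / R)]
      _ ≤ _ := by
          gcongr
          rw [abs_le]
          constructor <;> linarith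

lemma tendsto_cutoff {u : LTwo} (h : sobolevENorm (1 / 4) u ≠ ∞) :
    Tendsto (fun n : ℕ => cutoff (n + 1) u) atTop (𝓝 1) := by
  refine tendsto_const_nhds.congr' ?_
  obtain ⟨m, hm⟩ := exists_nat_ge (sobolevENorm (1 / 4) u).toReal
  filter_upwards [eventually_ge_atTop m] with n hn
  rw [cutoff, if_neg h]
  have hn' : (m : ℝ) ≤ n := by exact_mod_cast hn
  have : (sobolevENorm (1 / 4) u).toReal / ((n : ℝ) + 1) ≤ 1 := by
    rw [div_le_one (by positivity)]
    linarith
  rw [min_eq_left (by linarith), max_eq_right zero_le_one]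

/-! ### Localization of a locally Lipschitz function -/

lemma isClosed_ball (N : ℝ) : IsClosed (Ball N) := by
  have : Ball N = {u : LTwo | ‖u‖ ^ 2 ≤ N} := by ext u; exact mem_ball_iff
  rw [this]
  exact isClosed_le (by fun_prop) continuous_const

/-- The localization of `F`, which vanishes outside of the ball and of a compact set. -/
def localize (N R : ℝ) (F : LTwo → ℝ) (u : LTwo) : ℝ := (Ball N).indicator F u * cutoff R u

lemma measurable_indicator_ball {N : ℝ} {F : LTwo → ℝ} (hF : ContinuousOn F (Ball N)) :
    Measurable ((Ball N).indicator F) := by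
  classical
  rw [← Set.piecewise_eq_indicator]
  exact hF.measurable_piecewise continuousOn_const (measurableSet_ball N)

lemma localize_of_mem {N R : ℝ} {F : LTwo → ℝ} {u : LTwo} (hu : u ∈ Ball N) :
    localize N R F u = F u * cutoff R u := by
  rw [localize, Set.indicator_of_mem hu]

/-- The cutoff lives on a set relatively compact in `L²`, and a locally Lipschitz function is
bounded and Lipschitz on a compact set. -/
lemma exists_bound_localize {N R : ℝ} (hR : 0 < R) {F : LTwo → ℝ}
    (hF : LocallyLipschitzOn (Ball N) F) :
    ∃ B L : ℝ, 0 ≤ B ∧ (∀ u, |localize N R F u| ≤ B) ∧ CMLipschitz N L (localize N R F) := by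
  obtain ⟨K₀, hK₀, hK₀'⟩ := exists_isCompact_of_sobolevENorm_le (s := 1 / 4) (by norm_num)
    (R := 2 * R) (by positivity)
  set K := K₀ ∩ Ball N with hKdef
  have hK : IsCompact K := hK₀.inter_right (isClosed_ball N)
  have hFK : LocallyLipschitzOn K F := hF.mono Set.inter_subset_right
  obtain ⟨L, hL⟩ := hFK.exists_lipschitzOnWith_of_compact hK
  obtain ⟨B₀, hB₀⟩ := hK.exists_bound_of_continuousOn hFK.continuousOn
  set B := max B₀ 0 with hB
  have hB0 : 0 ≤ B := le_max_right _ _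
  have hBK : ∀ u ∈ K, |F u| ≤ B := fun u hu => (hB₀ u hu).trans (le_max_left _ _)
  have hmemK : ∀ u ∈ Ball N, cutoff R u ≠ 0 → u ∈ K := fun u hu h =>
    ⟨hK₀' u (sobolevENorm_le_of_cutoff_ne_zero hR h), hu⟩
  -- Nothing is known about `F` where the cutoff vanishes, so the product is estimated from an
  -- endpoint where it does not; the other case follows by exchanging the endpoints.
  have hone : ∀ x ∈ Ball N, ∀ c, x + cmEmbed c ∈ Ball N → cutoff R x ≠ 0 →
      |localize N R F (x + cmEmbed c) - localize N R F x| ≤ (L + B * (1 / R)) * ‖c‖ := by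
    intro x hx c hc h
    have hxK := hmemK x hx h
    have h1 := abs_cutoff_sub_le hR x c
    rw [localize_of_mem hx, localize_of_mem hc]
    by_cases h' : cutoff R (x + cmEmbed c) = 0
    · rw [h'] at h1 ⊢
      have h2 : |F (x + cmEmbed c) * 0 - F x * cutoff R x| = |F x| * |0 - cutoff R x| := by
        rw [← abs_mul]; congr 1; ring
      rw [h2]
      calc |F x| * |0 - cutoff R x| ≤ B * (1 / R * ‖c‖) := by
            gcongr
            exact hBK x hxK
        _ ≤ _ := by nlinarith [mul_nonneg L.coe_nonneg (norm_nonneg c)]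
    · have hyK := hmemK _ hc h'
      have h2 := hL.dist_le_mul _ hyK _ hxK
      rw [Real.dist_eq, dist_eq_norm, add_sub_cancel_left] at h2
      have h3 : |F (x + cmEmbed c) * cutoff R (x + cmEmbed c) - F x * cutoff R x| ≤
          |F (x + cmEmbed c) - F x| * |cutoff R (x + cmEmbed c)| +
            |F x| * |cutoff R (x + cmEmbed c) - cutoff R x| := by
        rw [← abs_mul, ← abs_mul]
        refine le_trans (le_of_eq ?_) (abs_add_le _ _)
        congr 1; ring
      refine h3.trans ?_
      have h4 : |cutoff R (x + cmEmbed c)| ≤ 1 := by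
        rw [abs_of_nonneg (cutoff_nonneg _ _)]
        exact cutoff_le_one _ _
      calc _ ≤ (L * ‖c‖) * 1 + B * (1 / R * ‖c‖) := by
            gcongr
            · exact h2.trans (by gcongr; exact norm_cmEmbed_le c)
            · exact hBK x hxK
        _ = _ := by ring
  refine ⟨B, L + B * (1 / R), hB0, fun u => ?_, fun x hx c hc => ?_⟩
  · rw [localize]
    by_cases hu : u ∈ Ball N
    · rw [Set.indicator_of_mem hu]
      by_cases h : cutoff R u = 0
      · rw [h, mul_zero, abs_zero]; exact hB0
      · rw [abs_mul, abs_of_nonneg (cutoff_nonneg R u)]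
        calc |F u| * cutoff R u ≤ B * 1 := by
              gcongr
              · exact cutoff_nonneg R u
              · exact hBK u (hmemK u hu h)
              · exact cutoff_le_one R u
          _ = B := mul_one B
    · rw [Set.indicator_of_notMem hu, zero_mul, abs_zero]; exact hB0
  · by_cases h : cutoff R x = 0
    · by_cases h' : cutoff R (x + cmEmbed c) = 0
      · rw [localize_of_mem hx, localize_of_mem hc, h, h', mul_zero, mul_zero, sub_zero, abs_zero]
        positivity
      · have hxeq : x = (x + cmEmbed c) + cmEmbed (-c) := by rw [map_neg]; abel
        have := hone _ hc (-c) (hxeq ▸ hx) h'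
        rw [← hxeq, norm_neg, abs_sub_comm] at this
        exact this
    · exact hone x hx c hc h

/-- The product rule. The extra term `|F z| / R` disappears as `R → ∞`. -/
lemma CMSlopeLE.localize {N R : ℝ} (hR : 0 < R) {F : LTwo → ℝ} {z : LTwo} (hz : z ∈ Ball N) {a : ℝ}
    (h : CMSlopeLE N F z a) : CMSlopeLE N (localize N R F) z (a + |F z| * (1 / R)) := by
  intro ε hε
  obtain ⟨δ, hδ, hδ'⟩ := h ε hε
  refine ⟨δ, hδ, fun c hc hcB => ?_⟩
  have h1 := hδ' c hc hcB
  have h2 := abs_cutoff_sub_le hR z c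
  rw [localize_of_mem hz, localize_of_mem hcB]
  have h3 : |F (z + cmEmbed c) * cutoff R (z + cmEmbed c) - F z * cutoff R z| ≤
      |F (z + cmEmbed c) - F z| * |cutoff R (z + cmEmbed c)| +
        |F z| * |cutoff R (z + cmEmbed c) - cutoff R z| := by
    rw [← abs_mul, ← abs_mul]
    refine le_trans (le_of_eq ?_) (abs_add_le _ _)
    congr 1; ring
  have h4 : |cutoff R (z + cmEmbed c)| ≤ 1 := by
    rw [abs_of_nonneg (cutoff_nonneg _ _)]
    exact cutoff_le_one _ _
  calc _ ≤ _ := h3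
    _ ≤ |F (z + cmEmbed c) - F z| * 1 + |F z| * (1 / R * ‖c‖) := by gcongr
    _ ≤ (a + ε) * ‖c‖ + |F z| * (1 / R * ‖c‖) := by rw [mul_one]; gcongr
    _ = _ := by ring

/-! ### The logarithmic Sobolev inequality for bounded Lipschitz functions -/

lemma abs_sqrt_sq_add_sq_sub_le {e : ℝ} (he : 0 < e) (x y : ℝ) :
    |√(x ^ 2 + e ^ 2) - √(y ^ 2 + e ^ 2)| ≤ |x - y| := by
  have hX : 0 < √(x ^ 2 + e ^ 2) := Real.sqrt_pos.2 (by positivity)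
  have hY : 0 < √(y ^ 2 + e ^ 2) := Real.sqrt_pos.2 (by positivity)
  have hx : |x| ≤ √(x ^ 2 + e ^ 2) := Real.abs_le_sqrt (by nlinarith [sq_nonneg e])
  have hy : |y| ≤ √(y ^ 2 + e ^ 2) := Real.abs_le_sqrt (by nlinarith [sq_nonneg e])
  have h1 : (√(x ^ 2 + e ^ 2) - √(y ^ 2 + e ^ 2)) * (√(x ^ 2 + e ^ 2) + √(y ^ 2 + e ^ 2)) =
      (x - y) * (x + y) := by
    have hsx := Real.sq_sqrt (show 0 ≤ x ^ 2 + e ^ 2 by positivity)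
    have hsy := Real.sq_sqrt (show 0 ≤ y ^ 2 + e ^ 2 by positivity)
    nlinarith
  have h2 : |√(x ^ 2 + e ^ 2) - √(y ^ 2 + e ^ 2)| * (√(x ^ 2 + e ^ 2) + √(y ^ 2 + e ^ 2)) =
      |x - y| * |x + y| := by
    rw [← abs_mul, ← h1, abs_mul, abs_of_pos (add_pos hX hY)]
  have h3 : |x + y| ≤ √(x ^ 2 + e ^ 2) + √(y ^ 2 + e ^ 2) :=
    (abs_add_le x y).trans (add_le_add hx hy)
  have h4 : |√(x ^ 2 + e ^ 2) - √(y ^ 2 + e ^ 2)| * (√(x ^ 2 + e ^ 2) + √(y ^ 2 + e ^ 2)) ≤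
      |x - y| * (√(x ^ 2 + e ^ 2) + √(y ^ 2 + e ^ 2)) := by
    rw [h2]; gcongr
  exact le_of_mul_le_mul_right h4 (add_pos hX hY)

lemma abs_log_sub_log_le {a b m : ℝ} (hm : 0 < m) (ha : m ≤ a) (hb : m ≤ b) :
    |Real.log a - Real.log b| ≤ |a - b| / m := by
  have key : ∀ {a b : ℝ}, m ≤ a → m ≤ b → Real.log a - Real.log b ≤ |a - b| / m := by
    intro a b ha hb
    have ha0 := hm.trans_le ha
    have hb0 := hm.trans_le hb
    rw [← Real.log_div ha0.ne' hb0.ne']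
    calc Real.log (a / b) ≤ a / b - 1 := Real.log_le_sub_one_of_pos (by positivity)
      _ = (a - b) / b := by field_simp
      _ ≤ |a - b| / b := by gcongr; exact le_abs_self _
      _ ≤ _ := by gcongr
  rw [abs_le]
  constructor
  · have := key hb ha
    rw [abs_sub_comm] at this
    linarith
  · exact key ha hb

lemma CMLipschitz.log_sqrt {N L e : ℝ} (he : 0 < e) {f : LTwo → ℝ} (h : CMLipschitz N L f) :
    CMLipschitz N (2 / e * L) fun z => 2 * Real.log √(f z ^ 2 + e ^ 2) := by
  intro x hx c hc
  have hge : ∀ y : ℝ, e ≤ √(y ^ 2 + e ^ 2) := fun y =>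
    Real.le_sqrt_of_sq_le (by nlinarith [sq_nonneg y])
  have h1 := abs_log_sub_log_le he (hge (f (x + cmEmbed c))) (hge (f x))
  have h2 := (abs_sqrt_sq_add_sq_sub_le he (f (x + cmEmbed c)) (f x)).trans (h x hx c hc)
  rw [← mul_sub, abs_mul, abs_of_pos two_pos]
  calc _ ≤ 2 * (L * ‖c‖ / e) := by
        gcongr
        exact h1.trans (by gcongr)
    _ = _ := by ring

/-- The chain rule for `log (f² + e²)`, without differentiability: `x ↦ √(x² + e²)` is nonexpanding,
and the logarithm has slope close to `1 / X` near `X`. Compared with the direct bound, the factor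
`|f| / √(f² + e²) ≤ 1` is given up. -/
lemma CMSlopeLE.log_sqrt {N e a : ℝ} (he : 0 < e) (ha : 0 ≤ a) {f : LTwo → ℝ} {z : LTwo}
    (h : CMSlopeLE N f z a) :
    CMSlopeLE N (fun z => 2 * Real.log √(f z ^ 2 + e ^ 2)) z (2 * a / √(f z ^ 2 + e ^ 2)) := by
  intro ε hε
  set X := √(f z ^ 2 + e ^ 2) with hX
  have hX0 : 0 < X := Real.sqrt_pos.2 (by positivity)
  have hden : Tendsto (fun η : ℝ => X - (a + η) * η) (𝓝[>] 0) (𝓝 (X - (a + 0) * 0)) := by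
    have : Continuous fun η : ℝ => X - (a + η) * η := by fun_prop
    exact (this.tendsto 0).mono_left nhdsWithin_le_nhds
  have hnum : Tendsto (fun η : ℝ => 2 * (a + η)) (𝓝[>] 0) (𝓝 (2 * (a + 0))) := by
    have : Continuous fun η : ℝ => 2 * (a + η) := by fun_prop
    exact (this.tendsto 0).mono_left nhdsWithin_le_nhds
  rw [mul_zero, sub_zero] at hden
  rw [add_zero] at hnum
  have hquot := hnum.div hden hX0.ne'
  obtain ⟨η, ⟨h1, h2⟩, hη⟩ := (((hden.eventually (lt_mem_nhds hX0)).and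
    (hquot.eventually (gt_mem_nhds (show 2 * a / X < 2 * a / X + ε by linarith)))).and
      self_mem_nhdsWithin).exists
  have hη : 0 < η := hη
  obtain ⟨δ, hδ, hδ'⟩ := h η hη
  refine ⟨min δ η, lt_min hδ hη, fun c hc hcB => ?_⟩
  have hcδ := hδ' c (hc.trans_le (min_le_left _ _)) hcB
  have hcη : ‖c‖ ≤ η := (hc.trans_le (min_le_right _ _)).le
  set Y := √(f (z + cmEmbed c) ^ 2 + e ^ 2) with hY
  have hYX : |Y - X| ≤ (a + η) * ‖c‖ := (abs_sqrt_sq_add_sq_sub_le he _ _).trans hcδ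
  have hm : (a + η) * ‖c‖ ≤ (a + η) * η := by gcongr
  have h3 := abs_log_sub_log_le h1 (a := Y) (b := X) (by linarith [(abs_le.1 hYX).1])
    (by nlinarith)
  rw [← mul_sub, abs_mul, abs_of_pos two_pos]
  calc 2 * |Real.log Y - Real.log X| ≤ 2 * ((a + η) * ‖c‖ / (X - (a + η) * η)) := by
        gcongr
        exact h3.trans (by gcongr)
    _ = 2 * (a + η) / (X - (a + η) * η) * ‖c‖ := by ring
    _ ≤ _ := by gcongr; exact h2.le

/-- Adding `e²` makes the logarithm of the density bounded and Lipschitz. The weight `f² + e²`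
cancels the denominator of the squared slope `4 G² / (f² + e²)`, leaving `2 G² / α`. -/
theorem entropy_sq_add_sq_le {N lam α L B e : ℝ} (hN : 0 < N) (hlam : 0 ≤ lam)
    (h1 : lam * N ≤ 1 / 16) (hα : 0 < α) (hαle : 12 * (lam * N) ≤ 1 - α)
    {f : LTwo → ℝ} (hf : Measurable f) (hB : ∀ z, |f z| ≤ B) (hL : CMLipschitz N L f)
    {G : LTwo → ℝ} (hG0 : ∀ z, 0 ≤ G z) (hG : ∀ z ∈ Ball N, CMSlopeLE N f z (G z)) (he : 0 < e) :
    ENNReal.ofReal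
      ((∫ z, (f z ^ 2 + e ^ 2) * Real.log (f z ^ 2 + e ^ 2) ∂gibbs N lam) -
        (∫ z, (f z ^ 2 + e ^ 2) ∂gibbs N lam) * Real.log (∫ z, (f z ^ 2 + e ^ 2) ∂gibbs N lam)) ≤
      ∫⁻ z, ENNReal.ofReal (2 / α * G z ^ 2) ∂gibbs N lam := by
  set g : LTwo → ℝ := fun z => 2 * Real.log √(f z ^ 2 + e ^ 2) with hg
  have hpos : ∀ z, 0 < f z ^ 2 + e ^ 2 := fun z => by positivity
  have hglog : ∀ z, g z = Real.log (f z ^ 2 + e ^ 2) := fun z => by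
    simp only [hg]
    rw [Real.log_sqrt (hpos z).le]
    ring
  have hexp : ∀ z, Real.exp (g z) = f z ^ 2 + e ^ 2 := fun z => by
    rw [hglog, Real.exp_log (hpos z)]
  have hgm : Measurable g := by
    simp only [hg]
    fun_prop
  have hgb : ∀ z, |g z| ≤ max |Real.log (e ^ 2)| |Real.log (B ^ 2 + e ^ 2)| := by
    intro z
    rw [hglog]
    have hfB : f z ^ 2 ≤ B ^ 2 := by
      rw [← sq_abs]
      have := hB z
      gcongr
    refine abs_le_max_abs_abs (Real.log_le_log (by positivity) (by nlinarith [sq_nonneg (f z)]))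
      (Real.log_le_log (hpos z) (by linarith))
  have key := entropy_exp_le hN hlam h1 hα hαle hgm hgb (hL.log_sqrt he)
    fun z hz => (hG z hz).log_sqrt he (hG0 z)
  simp only [hexp] at key
  simp only [hglog] at key
  simp only [mul_comm (Real.log _) (_ + _)] at key
  refine key.trans (lintegral_mono fun z => ENNReal.ofReal_le_ofReal (le_of_eq ?_))
  rw [div_pow, Real.sq_sqrt (hpos z).le]
  have := (hpos z).ne'
  field_simp

/-! ### Passage to the limit in the entropy -/

lemma mul_log_add_one_nonneg {x : ℝ} (hx : 0 ≤ x) : 0 ≤ x * Real.log x + 1 := by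
  rcases hx.eq_or_lt with rfl | hx
  · simp
  · have h := mul_le_mul_of_nonneg_left (Real.one_sub_inv_le_log_of_pos hx) hx.le
    rw [mul_sub, mul_inv_cancel₀ hx.ne'] at h
    linarith

/-- Lower semicontinuity of the entropy along an almost everywhere convergent sequence of bounded
functions with convergent integrals. -/
lemma entropy_le_of_tendsto {Ω : Type*} [MeasurableSpace Ω] {ν : Measure Ω} [IsProbabilityMeasure ν]
    {h : ℕ → Ω → ℝ} {k : Ω → ℝ} {R : ℕ → ℝ} {R₀ : ℝ} (hm : ∀ n, Measurable (h n))
    (h0 : ∀ n z, 0 ≤ h n z) (hB : ∀ n, ∃ B, ∀ z, h n z ≤ B) (hkm : AEMeasurable k ν)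
    (hk0 : ∀ z, 0 ≤ k z) (hlim : ∀ᵐ z ∂ν, Tendsto (fun n => h n z) atTop (𝓝 (k z)))
    (hmean : Tendsto (fun n => ∫ z, h n z ∂ν) atTop (𝓝 (∫ z, k z ∂ν)))
    (hR : Tendsto R atTop (𝓝 R₀)) (hR0 : ∀ n, 0 ≤ R n)
    (hent : ∀ n, (∫ z, h n z * Real.log (h n z) ∂ν) -
      (∫ z, h n z ∂ν) * Real.log (∫ z, h n z ∂ν) ≤ R n) :
    Integrable (fun z => k z * Real.log (k z)) ν ∧
      ∫ z, k z * Real.log (k z) ∂ν ≤ R₀ + (∫ z, k z ∂ν) * Real.log (∫ z, k z ∂ν) := by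
  set φ : ℝ → ℝ := fun x => x * Real.log x + 1 with hφ
  have hφc : Continuous φ := Real.continuous_mul_log.add continuous_const
  have hφint : ∀ n, Integrable (fun z => h n z * Real.log (h n z)) ν := by
    intro n
    obtain ⟨B, hB⟩ := hB n
    obtain ⟨C, hC⟩ := (isCompact_Icc (a := (0 : ℝ)) (b := B)).exists_bound_of_continuousOn
      Real.continuous_mul_log.continuousOn
    exact Integrable.of_bound (Real.continuous_mul_log.measurable.comp (hm n)).aestronglyMeasurable C
      (ae_of_all _ fun z => hC _ ⟨h0 n z, hB z⟩)
  have hm0 : ∀ n, 0 ≤ ∫ z, h n z ∂ν := fun n => integral_nonneg (h0 n)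
  have hR₀ : 0 ≤ R₀ := ge_of_tendsto' hR hR0
  set m := ∫ z, k z ∂ν with hmdef
  have hm00 : 0 ≤ m := integral_nonneg hk0
  have hbound : ∀ n, ∫⁻ z, ENNReal.ofReal (φ (h n z)) ∂ν ≤
      ENNReal.ofReal (R n + φ (∫ z, h n z ∂ν)) := by
    intro n
    have hφh : Integrable (fun z => φ (h n z)) ν := (hφint n).add (integrable_const 1)
    rw [← ofReal_integral_eq_lintegral_ofReal hφh
      (ae_of_all _ fun z => mul_log_add_one_nonneg (h0 n z))]
    refine ENNReal.ofReal_le_ofReal ?_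
    rw [integral_add (hφint n) (integrable_const 1)]
    have := hent n
    simp only [hφ, integral_const, probReal_univ, smul_eq_mul]
    linarith
  -- Since `x log x + 1 ≥ 0` on `x ≥ 0` and the measure has mass `1`, the shift by `1` makes Fatou's
  -- lemma applicable; it also yields the integrability of the limit.
  have hfatou : ∫⁻ z, ENNReal.ofReal (φ (k z)) ∂ν ≤ ENNReal.ofReal (R₀ + φ m) := by
    have hlim' : Tendsto (fun n => ENNReal.ofReal (R n + φ (∫ z, h n z ∂ν))) atTop
        (𝓝 (ENNReal.ofReal (R₀ + φ m))) :=
      ENNReal.tendsto_ofReal (hR.add ((hφc.tendsto m).comp hmean))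
    calc ∫⁻ z, ENNReal.ofReal (φ (k z)) ∂ν
        = ∫⁻ z, liminf (fun n => ENNReal.ofReal (φ (h n z))) atTop ∂ν := by
          refine lintegral_congr_ae ?_
          filter_upwards [hlim] with z hz
          exact (ENNReal.tendsto_ofReal ((hφc.tendsto _).comp hz)).liminf_eq.symm
      _ ≤ liminf (fun n => ∫⁻ z, ENNReal.ofReal (φ (h n z)) ∂ν) atTop :=
          lintegral_liminf_le fun n => (hφc.measurable.comp (hm n)).ennreal_ofReal
      _ ≤ liminf (fun n => ENNReal.ofReal (R n + φ (∫ z, h n z ∂ν))) atTop :=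
          liminf_le_liminf (Eventually.of_forall hbound)
      _ = _ := hlim'.liminf_eq
  have hφk : Integrable (fun z => φ (k z)) ν := by
    refine ⟨(hφc.measurable.comp_aemeasurable hkm).aestronglyMeasurable, ?_⟩
    rw [hasFiniteIntegral_iff_ofReal (ae_of_all _ fun z => mul_log_add_one_nonneg (hk0 z))]
    exact hfatou.trans_lt ENNReal.ofReal_lt_top
  have hk : Integrable (fun z => k z * Real.log (k z)) ν := by
    refine (hφk.sub (integrable_const 1)).congr (ae_of_all _ fun z => ?_)
    simp [hφ]
  refine ⟨hk, ?_⟩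
  rw [← ofReal_integral_eq_lintegral_ofReal hφk
    (ae_of_all _ fun z => mul_log_add_one_nonneg (hk0 z)),
    ENNReal.ofReal_le_ofReal_iff (add_nonneg hR₀ (mul_log_add_one_nonneg hm00)),
    integral_add hk (integrable_const 1)] at hfatou
  simp only [integral_const, probReal_univ, smul_eq_mul] at hfatou
  linarith

lemma ae_gibbs_of_ae_loopMeasure {N lam : ℝ} {p : LTwo → Prop} (h : ∀ᵐ u ∂loopMeasure, p u) :
    ∀ᵐ u ∂gibbs N lam, p u := by
  unfold gibbs
  exact Measure.ae_smul_measure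
    ((withDensity_absolutelyContinuous _ _).ae_le (ae_restrict_of_ae h)) _

/-- The logarithmic Sobolev inequality for a locally Lipschitz function with a bound for its slope
along the Cameron–Martin directions. -/
theorem logSobolev_of_slope {N lam α : ℝ} (hN : 0 < N) (hlam : 0 ≤ lam) (h1 : lam * N ≤ 1 / 16)
    (hα : 0 < α) (hαle : 12 * (lam * N) ≤ 1 - α) {F G : LTwo → ℝ}
    (hF : LocallyLipschitzOn (Ball N) F) (hF2 : MemLp F 2 (gibbs N lam))
    (hG2 : MemLp G 2 (gibbs N lam)) (hG0 : ∀ z, 0 ≤ G z)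
    (hG : ∀ z ∈ Ball N, CMSlopeLE N F z (G z)) : LogSobolev (gibbs N lam) α F G := by
  set ν := gibbs N lam with hν
  have : IsProbabilityMeasure ν := isProbabilityMeasure_gibbs hN hlam h1
  set e : ℕ → ℝ := fun n => 1 / ((n : ℝ) + 1) with he
  have he0 : ∀ n, 0 < e n := fun n => by positivity
  have he1 : ∀ n, e n ≤ 1 := fun n => by
    rw [he, div_le_one (by positivity)]
    linarith [n.cast_nonneg (α := ℝ)]
  have hetend : Tendsto e atTop (𝓝 0) := tendsto_one_div_add_atTop_nhds_zero_nat
  set f : ℕ → LTwo → ℝ := fun n => localize N (n + 1) F with hf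
  have hfm : ∀ n, Measurable (f n) := fun n =>
    (measurable_indicator_ball hF.continuousOn).mul (measurable_cutoff _)
  set a : ℕ → LTwo → ℝ := fun n z => G z + |F z| * e n with ha
  have ha0 : ∀ n z, 0 ≤ a n z := fun n z =>
    add_nonneg (hG0 z) (mul_nonneg (abs_nonneg _) (he0 n).le)
  have haLp : ∀ n, MemLp (a n) 2 ν := fun n => hG2.add (hF2.abs.mul_const (e n))
  have hFint : Integrable (fun z => F z ^ 2) ν := hF2.integrable_sq
  have hball := ae_mem_ball_gibbs N lam
  have hR : Tendsto (fun n => ∫ z, 2 / α * a n z ^ 2 ∂ν) atTop (𝓝 (2 / α * ∫ z, G z ^ 2 ∂ν)) := by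
    rw [← integral_const_mul]
    refine tendsto_integral_of_dominated_convergence (fun z => 2 / α * (G z + |F z|) ^ 2)
      (fun n => ((haLp n).integrable_sq.const_mul _).aestronglyMeasurable)
      ((hG2.add hF2.abs).integrable_sq.const_mul _) (fun n => ae_of_all _ fun z => ?_)
      (ae_of_all _ fun z => ?_)
    · rw [Real.norm_of_nonneg (by positivity)]
      have : a n z ≤ G z + |F z| := by
        simp only [ha]
        nlinarith [he1 n, abs_nonneg (F z)]
      have := ha0 n z
      gcongr
    · have : Tendsto (fun n => 2 / α * (G z + |F z| * e n) ^ 2) atTop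
          (𝓝 (2 / α * (G z + |F z| * 0) ^ 2)) :=
        ((tendsto_const_nhds.add (hetend.const_mul _)).pow 2).const_mul _
      simpa using this
  have hlim : ∀ᵐ z ∂ν, Tendsto (fun n => f n z ^ 2 + e n ^ 2) atTop (𝓝 (F z ^ 2)) := by
    filter_upwards [hball, ae_gibbs_of_ae_loopMeasure
      (ae_sobolevENorm_ne_top (s := 1 / 4) (by norm_num))] with z hz hz'
    have h2 : Tendsto (fun n : ℕ => (F z * cutoff (n + 1) z) ^ 2 + e n ^ 2) atTop
        (𝓝 ((F z * 1) ^ 2 + 0 ^ 2)) :=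
      (((tendsto_cutoff hz').const_mul _).pow 2).add (hetend.pow 2)
    simpa [hf, localize_of_mem hz] using h2
  have hF1int : Integrable (fun z => F z ^ 2 + 1) ν := hFint.add (integrable_const 1)
  have hmean : Tendsto (fun n => ∫ z, (f n z ^ 2 + e n ^ 2) ∂ν) atTop (𝓝 (∫ z, F z ^ 2 ∂ν)) := by
    refine tendsto_integral_of_dominated_convergence (fun z => F z ^ 2 + 1)
      (fun n => ((hfm n).pow_const 2 |>.add_const _).aestronglyMeasurable)
      hF1int (fun n => ?_) hlim
    filter_upwards [hball] with z hz
    rw [Real.norm_of_nonneg (by positivity)]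
    simp only [hf, localize_of_mem hz, mul_pow]
    have hc : cutoff (n + 1) z ^ 2 ≤ 1 := pow_le_one₀ (cutoff_nonneg _ _) (cutoff_le_one _ _)
    have he2 : e n ^ 2 ≤ 1 := pow_le_one₀ (he0 n).le (he1 n)
    nlinarith [sq_nonneg (F z)]
  have hB : ∀ n, ∃ B, ∀ z, f n z ^ 2 + e n ^ 2 ≤ B := fun n => by
    obtain ⟨B, -, hB0, hB, -⟩ := exists_bound_localize (N := N) (R := n + 1) (by positivity) hF
    exact ⟨B ^ 2 + e n ^ 2, fun z => by simpa [hf] using sq_le_sq' (abs_le.1 (hB z)).1 (abs_le.1 (hB z)).2⟩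
  have hent : ∀ n, (∫ z, (f n z ^ 2 + e n ^ 2) * Real.log (f n z ^ 2 + e n ^ 2) ∂ν) -
      (∫ z, (f n z ^ 2 + e n ^ 2) ∂ν) * Real.log (∫ z, (f n z ^ 2 + e n ^ 2) ∂ν) ≤
      ∫ z, 2 / α * a n z ^ 2 ∂ν := by
    intro n
    obtain ⟨B, L, -, hB, hL⟩ := exists_bound_localize (N := N) (R := n + 1) (by positivity) hF
    have h := entropy_sq_add_sq_le hN hlam h1 hα hαle (hfm n) hB hL (ha0 n)
      (fun z hz => (hG z hz).localize (by positivity) hz) (he0 n)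
    rw [← ofReal_integral_eq_lintegral_ofReal ((haLp n).integrable_sq.const_mul _)
      (ae_of_all _ fun z => by positivity),
      ENNReal.ofReal_le_ofReal_iff (integral_nonneg fun z => by positivity)] at h
    exact h
  obtain ⟨hint, hle⟩ := entropy_le_of_tendsto (ν := ν) (h := fun n z => f n z ^ 2 + e n ^ 2)
    (k := fun z => F z ^ 2) (fun n => (hfm n).pow_const 2 |>.add_const _)
    (fun n z => by positivity) hB hFint.aemeasurable (fun z => sq_nonneg _) hlim hmean hR
    (fun n => integral_nonneg fun z => by positivity) hent
  set m := ∫ z, F z ^ 2 ∂ν with hm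
  -- If `m = 0`, the conventions `x / 0 = 0` and `log 0 = 0` make the entropy integrand vanish.
  rcases eq_or_ne m 0 with hm0 | hm0
  · refine ⟨by simp [← hm, hm0], ?_⟩
    simp only [← hm, hm0, div_zero, Real.log_zero, mul_zero, integral_zero]
    have : 0 ≤ ∫ z, G z ^ 2 ∂ν := integral_nonneg fun z => sq_nonneg _
    positivity
  · have heq : (fun z => F z ^ 2 * Real.log (F z ^ 2 / m)) =
        fun z => F z ^ 2 * Real.log (F z ^ 2) - F z ^ 2 * Real.log m := by
      ext z
      rcases eq_or_ne (F z ^ 2) 0 with h | h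
      · simp [h]
      · rw [Real.log_div h hm0, mul_sub]
    refine ⟨by rw [← hm, heq]; exact hint.sub (hFint.mul_const _), ?_⟩
    rw [← hm, heq, integral_sub hint (hFint.mul_const _), integral_mul_const, ← hm]
    linarith

/-! ### The metric norm of the gradient -/

lemma tsum_enorm_fourierCoeff_sq (u : LTwo) : ∑' k, ‖fourierCoeff u k‖ₑ ^ 2 = ‖u‖ₑ ^ 2 := by
  simp only [← fourierBasis_repr]
  rw [Seq.tsum_enorm_sq, LinearIsometryEquiv.norm_map, ofReal_norm]

lemma enorm_le_sobolevENorm {s : ℝ} (hs : 0 ≤ s) (u : LTwo) : ‖u‖ₑ ≤ sobolevENorm s u := by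
  rw [← ENNReal.pow_le_pow_left_iff two_ne_zero, sobolevENorm_sq, ← tsum_enorm_fourierCoeff_sq]
  refine ENNReal.tsum_le_tsum fun k => le_mul_of_one_le_left' ?_
  rw [ENNReal.one_le_ofReal, sobolevWeight]
  split_ifs with h
  · exact le_rfl
  · exact Real.one_le_rpow (by exact_mod_cast Int.one_le_abs h) (by positivity)

/-- The `H¹` norm dominates the `L²` norm, so a local `L²` Lipschitz constant bounds the slope.
Finiteness ensures that passing to `toReal` loses nothing. -/
lemma slope_ne_top {N : ℝ} {F : LTwo → ℝ} (hF : LocallyLipschitzOn (Ball N) F) {z : LTwo}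
    (hz : z ∈ Ball N) : slope N F z ≠ ∞ := by
  obtain ⟨K, t, ht, hK⟩ := hF hz
  have hzt : z ∈ t := mem_of_mem_nhdsWithin hz ht
  have hle : comap (fun v => sobolevENorm 1 (v - z)) (𝓝 0) ⊓ 𝓟 (Ball N \ {z}) ≤ 𝓝[Ball N] z := by
    refine inf_le_inf ?_ (principal_mono.2 Set.sdiff_subset)
    refine tendsto_id'.1 (tendsto_iff_edist_tendsto_0.2 ?_)
    refine tendsto_of_tendsto_of_tendsto_of_le_of_le tendsto_const_nhds tendsto_comap
      (fun _ => zero_le) fun v => ?_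
    rw [edist_eq_enorm_sub]
    exact enorm_le_sobolevENorm zero_le_one _
  refine ne_top_of_le_ne_top (ENNReal.coe_ne_top (r := K)) (limsup_le_of_le (by isBoundedDefault) ?_)
  filter_upwards [hle ht] with v hv
  refine ENNReal.div_le_of_le_mul ?_
  rw [← edist_eq_enorm_sub]
  refine (hK hv hzt).trans ?_
  gcongr
  rw [edist_eq_enorm_sub]
  exact enorm_le_sobolevENorm zero_le_one _

lemma cmSlopeLE_slope {N : ℝ} {F : LTwo → ℝ} (hF : LocallyLipschitzOn (Ball N) F) {z : LTwo}
    (hz : z ∈ Ball N) : CMSlopeLE N F z (slope N F z).toReal := by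
  intro ε hε
  have htop := slope_ne_top hF hz
  have hev := eventually_lt_of_limsup_lt (ENNReal.lt_add_right htop
    (ENNReal.ofReal_pos.2 hε).ne')
  obtain ⟨a, ha, hev⟩ := ((ENNReal.nhds_zero_basis.comap
    fun v => sobolevENorm 1 (v - z)).inf_principal (Ball N \ {z})).eventually_iff.1 hev
  obtain ⟨δ, hδ0, hδ⟩ := ENNReal.lt_iff_exists_nnreal_btwn.1 ha
  refine ⟨δ, by exact_mod_cast hδ0, fun c hc hcz => ?_⟩
  -- The slope excludes `v = z`, while `cmEmbed` kills the zero frequency of `c`.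
  by_cases h0 : cmEmbed c = 0
  · rw [h0, add_zero, sub_self, abs_zero]
    positivity
  · have hsub : z + cmEmbed c - z = cmEmbed c := add_sub_cancel_left _ _
    have hnorm := sobolevENorm_cmEmbed_le le_rfl c
    have hlt : sobolevENorm 1 (z + cmEmbed c - z) < a := by
      rw [hsub]
      refine hnorm.trans_lt (lt_of_le_of_lt ?_ hδ)
      rw [← ENNReal.ofReal_coe_nnreal]
      exact ENNReal.ofReal_le_ofReal hc.le
    have h := (hev ⟨hlt, hcz, by simpa using h0⟩).le
    rw [hsub, ENNReal.div_le_iff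
      (ne_of_gt ((enorm_pos.2 h0).trans_le (enorm_le_sobolevENorm zero_le_one _)))
      (ne_top_of_le_ne_top ENNReal.ofReal_ne_top hnorm)] at h
    have h' : ‖F (z + cmEmbed c) - F z‖ₑ ≤ (slope N F z + ENNReal.ofReal ε) * ENNReal.ofReal ‖c‖ :=
      h.trans (mul_le_mul_right hnorm _)
    rw [← ENNReal.ofReal_toReal htop, ← ENNReal.ofReal_add ENNReal.toReal_nonneg hε.le,
      ← ENNReal.ofReal_mul (by positivity), ← ofReal_norm,
      ENNReal.ofReal_le_ofReal_iff (by positivity)] at h'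
    exact h'

/-! ### Gradients of differentiable functions -/

lemma sobolevENorm_ne_top_of_nonpos {s : ℝ} (hs : s ≤ 0) (u : LTwo) : sobolevENorm s u ≠ ∞ := by
  refine ne_top_of_le_ne_top (enorm_ne_top (x := u)) ?_
  rw [← ENNReal.pow_le_pow_left_iff two_ne_zero, sobolevENorm_sq, ← tsum_enorm_fourierCoeff_sq]
  refine ENNReal.tsum_le_tsum fun k => mul_le_of_le_one_left' ?_
  rw [ENNReal.ofReal_le_one, sobolevWeight]
  split_ifs with h
  · exact le_rfl
  · exact Real.rpow_le_one_of_one_le_of_nonpos (by exact_mod_cast Int.one_le_abs h) (by linarith)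

lemma norm_invFreq_sq_le_sobolevWeight (k : ℤ) : ‖invFreq k‖ ^ 2 ≤ sobolevWeight (-1) k := by
  unfold invFreq sobolevWeight
  split_ifs with h
  · simp
  · rw [norm_div, norm_one, Complex.norm_intCast, mul_neg_one, Real.rpow_neg (abs_nonneg _),
      Real.rpow_two, div_pow, one_pow, one_div]

lemma real_inner_eq_re (u v : LTwo) : inner ℝ u v = (inner ℂ u v).re := by
  rw [L2.inner_def, L2.inner_def, ← RCLike.re_eq_complex_re, ← integral_re (L2.integrable_inner u v)]
  rfl

/-- The norms of `H^{-1}` and `H^1` are dual to each other. -/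
lemma abs_inner_cmEmbed_le (u : LTwo) (c : Seq) :
    |inner ℝ u (cmEmbed c)| ≤ (sobolevENorm (-1) u).toReal * ‖c‖ := by
  -- The adjoint of `cmEmbed` applied to `u`. Its norm omits the zero frequency and is therefore at
  -- most the `H⁻¹` norm.
  set d : Seq := diag invFreq norm_invFreq_le_one (fourierBasis.repr u) with hd
  have h1 : inner ℂ u (cmEmbed c) = inner ℂ d c := by
    rw [← fourierBasis.repr.inner_map_map, lp.inner_eq_tsum, lp.inner_eq_tsum]
    refine tsum_congr fun k => ?_
    rw [fourierBasis_repr, fourierBasis_repr, fourierCoeff_cmEmbed, hd, diag_apply, fourierBasis_repr]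
    have hq : (starRingEnd ℂ) (invFreq k) = invFreq k := by
      unfold invFreq
      split_ifs <;> simp
    simp only [RCLike.inner_apply, map_mul, hq]
    ring
  have h2 : ‖d‖ ≤ (sobolevENorm (-1) u).toReal := by
    rw [← ENNReal.ofReal_le_iff_le_toReal (sobolevENorm_ne_top_of_nonpos (by norm_num) u),
      ← ENNReal.pow_le_pow_left_iff two_ne_zero, sobolevENorm_sq, ← Seq.tsum_enorm_sq]
    refine ENNReal.tsum_le_tsum fun k => ?_
    rw [hd, diag_apply, fourierBasis_repr, enorm_mul, mul_pow, ← ofReal_norm (invFreq k),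
      ← ENNReal.ofReal_pow (norm_nonneg _)]
    gcongr
    exact norm_invFreq_sq_le_sobolevWeight k
  rw [real_inner_eq_re, h1]
  calc |(inner ℂ d c).re| ≤ ‖inner ℂ d c‖ := Complex.abs_re_le_norm _
    _ ≤ ‖d‖ * ‖c‖ := norm_inner_le_norm _ _
    _ ≤ _ := by gcongr

/-- The linear part is bounded by duality; the remainder is small relative to the `L²` norm of
`cmEmbed c`, hence relative to `‖c‖`. -/
lemma cmSlopeLE_gradientWithin {N : ℝ} {F : LTwo → ℝ} {z : LTwo}
    (hF : DifferentiableWithinAt ℝ F (Ball N) z) :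
    CMSlopeLE N F z (sobolevENorm (-1) (gradientWithin F (Ball N) z)).toReal := by
  intro ε hε
  have h := hasGradientWithinAt_iff_isLittleO.1 hF.hasGradientWithinAt
  obtain ⟨δ, hδ, hball⟩ := Metric.mem_nhdsWithin_iff.1 (h.def hε)
  refine ⟨δ, hδ, fun c hc hcz => ?_⟩
  have hmem : z + cmEmbed c ∈ Metric.ball z δ ∩ Ball N := by
    refine ⟨?_, hcz⟩
    rw [Metric.mem_ball, dist_eq_norm, add_sub_cancel_left]
    exact (norm_cmEmbed_le c).trans_lt hc
  have h' := hball hmem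
  simp only [Set.mem_ofPred_eq, add_sub_cancel_left] at h'
  rw [Real.norm_eq_abs] at h'
  have h3 := abs_inner_cmEmbed_le (gradientWithin F (Ball N) z) c
  have h4 := abs_add_le (F (z + cmEmbed c) - F z - inner ℝ (gradientWithin F (Ball N) z) (cmEmbed c))
    (inner ℝ (gradientWithin F (Ball N) z) (cmEmbed c))
  rw [sub_add_cancel] at h4
  have h5 : ε * ‖cmEmbed c‖ ≤ ε * ‖c‖ := mul_le_mul_of_nonneg_left (norm_cmEmbed_le c) hε.le
  linarith

lemma locallyLipschitzOn_ball_of_contDiffOn {N : ℝ} (hN : 0 ≤ N) {F : LTwo → ℝ}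
    (hF : ContDiffOn ℝ 1 F (Ball N)) : LocallyLipschitzOn (Ball N) F := fun z hz =>
  (hF z hz).exists_lipschitzOnWith (convex_ball hN)

end NLSGibbs

end

theorem proposition3p1 (N lam : ℝ) (hN : 0 < N) (h0 : 0 ≤ lam * N)
    (h1 : lam * N < 3 / (14 * Real.pi ^ 2)) :
    MeasureTheory.IsProbabilityMeasure (NLSGibbs.gibbs N lam) ∧
    -- `C¹` functions on the ball, with the `H⁻¹` norm of the gradient
    (∀ F : NLSGibbs.LTwo → ℝ, ContDiffOn ℝ 1 F (NLSGibbs.Ball N) →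
      MeasureTheory.MemLp F 2 (NLSGibbs.gibbs N lam) →
      MeasureTheory.MemLp
        (fun u => (NLSGibbs.sobolevENorm (-1) (gradientWithin F (NLSGibbs.Ball N) u)).toReal) 2
        (NLSGibbs.gibbs N lam) →
      NLSGibbs.LogSobolev (NLSGibbs.gibbs N lam) (1 - 14 * Real.pi ^ 2 * N * lam / 3) F
        (fun u => (NLSGibbs.sobolevENorm (-1) (gradientWithin F (NLSGibbs.Ball N) u)).toReal)) ∧
    -- locally Lipschitz functions on the ball, with the metric norm of the gradient
    (∀ F : NLSGibbs.LTwo → ℝ, LocallyLipschitzOn (NLSGibbs.Ball N) F →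
      MeasureTheory.MemLp F 2 (NLSGibbs.gibbs N lam) →
      MeasureTheory.MemLp (fun u => (NLSGibbs.slope N F u).toReal) 2 (NLSGibbs.gibbs N lam) →
      NLSGibbs.LogSobolev (NLSGibbs.gibbs N lam) (1 - 14 * Real.pi ^ 2 * N * lam / 3) F
        (fun u => (NLSGibbs.slope N F u).toReal)) := by
  have hlam : 0 ≤ lam := nonneg_of_mul_nonneg_left h0 hN
  -- With `π² > 9` one has `14 π² / 3 > 42 ≥ 12`, the constant that the convexity defect requires,
  -- and `3 / (14 π²) < 1 / 42 ≤ 1 / 16`, the threshold for finiteness of `Z`.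
  have hpi : 9 < Real.pi ^ 2 := by nlinarith [Real.pi_gt_three]
  rw [lt_div_iff₀ (by positivity)] at h1
  have hα : 0 < 1 - 14 * Real.pi ^ 2 * N * lam / 3 := by linarith
  have h16 : lam * N ≤ 1 / 16 := by nlinarith
  have hαle : 12 * (lam * N) ≤ 1 - (1 - 14 * Real.pi ^ 2 * N * lam / 3) := by nlinarith
  refine ⟨NLSGibbs.isProbabilityMeasure_gibbs hN hlam h16, fun F hF hF2 hG2 => ?_,
    fun F hF hF2 hG2 => ?_⟩
  · exact NLSGibbs.logSobolev_of_slope hN hlam h16 hα hαle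
      (NLSGibbs.locallyLipschitzOn_ball_of_contDiffOn hN.le hF) hF2 hG2
      (fun _ => ENNReal.toReal_nonneg) fun z hz =>
        NLSGibbs.cmSlopeLE_gradientWithin (hF.differentiableOn one_ne_zero z hz)
  · exact NLSGibbs.logSobolev_of_slope hN hlam h16 hα hαle hF hF2 hG2
      (fun _ => ENNReal.toReal_nonneg) fun z hz => NLSGibbs.cmSlopeLE_slope hF hz
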